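/- Call a set $A\subseteq\mathbb R$ a t$\mathbb R$-set (tame in $\mathbb R$) if for every $Y\subseteq\mathbb R$ that is homeomorphic to $A$ (both with the subspace topology) there is a homeomorphism $f\colon\mathbb R\to\mathbb R$ with $f[A]=Y$. There are at most $\omega_1$ pairwise non-homeomorphic t$\mathbb R$-sets: every family of pairwise non-homeomorphic t$\mathbb R$-sets has cardinality at most $\omega_1=\aleph_1$. -/

import Mathlib

/-- A set `A` of real numbers is *tame in `ℝ`* (a t`ℝ`-set) if every copy `Y ⊆ ℝ` of `A`, that is,
every subset of `ℝ` homeomorphic to `A` in the subspace topologies, is the image of `A` under some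
homeomorphism of `ℝ` onto itself. -/
def IsTameInReal (A : Set ℝ) : Prop :=
  ∀ Y : Set ℝ, Nonempty (↥A ≃ₜ ↥Y) → ∃ f : ℝ ≃ₜ ℝ, f '' A = Y

/-! A tame set `A` is compact: `arctan` makes a bounded copy, and inversion at a missing limit point
would make an unbounded one. Homeomorphisms of the line are monotone, so any two copies of `A` show
the same pair of ends up to reflection. This rigidity is used twice.

First, call a point endable if some copy of `A` begins with it. If `A` has at least three
components, endable points of different components are equivalent under self-homeomorphisms of `A`
(`selfEquiv_of_endable`). A component without endable points is fat: nondegenerate, with `A`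
accumulating at both ends. Hence the remaining components all look alike, and by
`exists_model_or_noFreeEnd` there are two cases. Either every point outside the fat components lies
in a clopen block of one fixed type (a point, an interval or a Cantor set), or `A` has only
singleton and fat components, the fat ones dense; the latter determines `A` up to homeomorphism by a
coloured Cantor back-and-forth (`NoFreeEnd.iso_of_fatDense`).

Second, call a fat component flippable if its left germ is homeomorphic to its reflected right germ.
In the block case at most one fat component is not flippable (`Good.good1_of_isTameInReal`): given
two, put one at the left end of a copy and the other at the right end, in either orientation; these
copies cannot be matched by a monotone map.

For a fixed block, left germs at fat components are then comparable (`germ_trichotomy`): two germs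
agree, or one of them occurs, at flippable components, arbitrarily close to the base point of the
other. The proof is a back-and-forth inside an induction, which is available because every nonempty
family of fat components has an isolated member (`exists_isolated`). A set has only countably many
fat components, so every germ has countably many germs below it, and a total relation with countable
initial segments lives on at most `ℵ₁` points.

The two germs of a fat component determine a clopen neighbourhood of it, so `ℵ₁` compact sets
exhibit all local types. A compact set has countably many clopen parts, and each tame set is a
finite disjoint union of clopen parts of listed types. This leaves at most `ℵ₁` homeomorphism types
(`mk_le_of_locallyIn`). -/

namespace TameReal
-- Clopen parts of compact sets and bijections between them
open Set Filter Topology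
open scoped Pointwise

/-- `f` restricts to a continuous bijection from `X` onto `Y`. -/
def EmbOn (f : ℝ → ℝ) (X Y : Set ℝ) : Prop := ContinuousOn f X ∧ BijOn f X Y

/-- There is a continuous bijection from `X` onto `Y`; for compact `X`, a homeomorphism. -/
def Iso (X Y : Set ℝ) : Prop := ∃ f, EmbOn f X Y

/-- `W` is a relatively clopen part of the closed set `A`. -/
def IsPiece (W A : Set ℝ) : Prop := W ⊆ A ∧ IsClosed W ∧ IsClosed (A \ W)

variable {A B C W V U X Y Z : Set ℝ} {f g : ℝ → ℝ} {a b u v x y : ℝ}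

theorem EmbOn.mem (h : EmbOn f X Y) (hx : x ∈ X) : f x ∈ Y := h.2.mapsTo hx

theorem EmbOn.image_eq (h : EmbOn f X Y) : f '' X = Y := h.2.image_eq

theorem EmbOn.isCompact (h : EmbOn f X Y) (hX : IsCompact X) : IsCompact Y :=
  h.image_eq ▸ hX.image_of_continuousOn h.1

theorem EmbOn.exists_inv (h : EmbOn f X Y) (hX : IsCompact X) :
    ∃ g, EmbOn g Y X ∧ (∀ x ∈ X, g (f x) = x) ∧ ∀ y ∈ Y, f (g y) = y := by
  obtain ⟨hc, hb⟩ := h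
  have hinv := hb.invOn_invFunOn
  refine ⟨Function.invFunOn f X, ⟨?_, hinv.symm.bijOn hb.surjOn.mapsTo_invFunOn hb.mapsTo⟩,
    fun x hx => hinv.1 hx, fun y hy => hinv.2 hy⟩
  rw [continuousOn_iff_isClosed]
  intro t ht
  refine ⟨f '' (X ∩ t), ((hX.inter_right ht).image_of_continuousOn
    (hc.mono inter_subset_left)).isClosed, ?_⟩
  ext y
  constructor
  · rintro ⟨h1, h2⟩
    exact ⟨⟨_, ⟨hb.surjOn.mapsTo_invFunOn h2, h1⟩, hinv.2 h2⟩, h2⟩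
  · rintro ⟨⟨x, ⟨hx, hxt⟩, rfl⟩, h2⟩
    refine ⟨?_, h2⟩
    rw [mem_preimage, hinv.1 hx]
    exact hxt

theorem EmbOn.comp (hg : EmbOn g Y Z) (hf : EmbOn f X Y) : EmbOn (g ∘ f) X Z :=
  ⟨hg.1.comp hf.1 hf.2.mapsTo, hg.2.comp hf.2⟩

theorem embOn_id (X : Set ℝ) : EmbOn id X X := ⟨continuousOn_id, bijOn_id X⟩

theorem Iso.refl (X : Set ℝ) : Iso X X := ⟨id, embOn_id X⟩

theorem Iso.symm (h : Iso X Y) (hX : IsCompact X) : Iso Y X := by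
  obtain ⟨f, hf⟩ := h
  obtain ⟨g, hg, -⟩ := hf.exists_inv hX
  exact ⟨g, hg⟩

theorem Iso.trans (h : Iso X Y) (h' : Iso Y Z) : Iso X Z := by
  obtain ⟨f, hf⟩ := h
  obtain ⟨g, hg⟩ := h'
  exact ⟨_, hg.comp hf⟩

theorem Iso.homeomorph (h : Iso X Y) (hX : IsCompact X) : Nonempty (↥X ≃ₜ ↥Y) := by
  obtain ⟨f, hf⟩ := h
  have : CompactSpace X := isCompact_iff_compactSpace.1 hX
  exact ⟨Continuous.homeoOfEquivCompactToT2 (f := hf.2.equiv f)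
    (hf.1.mapsToRestrict hf.2.mapsTo)⟩

theorem EmbOn.image (h : EmbOn f X Y) (hW : W ⊆ X) : EmbOn f W (f '' W) :=
  ⟨h.1.mono hW, (h.2.injOn.mono hW).bijOn_image⟩

theorem EmbOn.preimage (h : EmbOn f X Y) (hV : V ⊆ Y) : EmbOn f (X ∩ f ⁻¹' V) V := by
  refine ⟨h.1.mono inter_subset_left, fun x hx => hx.2, h.2.injOn.mono inter_subset_left, ?_⟩
  intro y hy
  obtain ⟨x, hx, rfl⟩ := h.2.surjOn (hV hy)
  exact ⟨x, ⟨hx, hy⟩, rfl⟩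

theorem IsPiece.isCompact (h : IsPiece W A) (hA : IsCompact A) : IsCompact W :=
  hA.of_isClosed_subset h.2.1 h.1

theorem IsPiece.refl (hA : IsClosed A) : IsPiece A A := ⟨Subset.rfl, hA, by simp⟩

theorem IsPiece.empty (hA : IsClosed A) : IsPiece ∅ A := ⟨empty_subset _, isClosed_empty, by simpa⟩

theorem IsPiece.trans (h : IsPiece W V) (h' : IsPiece V A) : IsPiece W A := by
  refine ⟨h.1.trans h'.1, h.2.1, ?_⟩
  have : A \ W = (A \ V) ∪ (V \ W) := by
    ext x; have := @h.1 x; have := @h'.1 x; simp only [Set.mem_sdiff, mem_union]; tauto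
  rw [this]; exact h'.2.2.union h.2.2

theorem IsPiece.compl (h : IsPiece W A) : IsPiece (A \ W) A :=
  ⟨sdiff_subset, h.2.2, by rw [sdiff_sdiff_cancel_left h.1]; exact h.2.1⟩

theorem IsPiece.inter_closed (h : IsPiece W A) (hB : IsClosed B) : IsPiece (W ∩ B) (A ∩ B) := by
  refine ⟨inter_subset_inter_left _ h.1, h.2.1.inter hB, ?_⟩
  have : (A ∩ B) \ (W ∩ B) = (A \ W) ∩ B := by ext x; simp only [Set.mem_sdiff, mem_inter_iff]; tauto
  rw [this]; exact h.2.2.inter hB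

/-- A piece of `A` contained in a closed `B ⊆ A` is a piece of `B`. -/
theorem IsPiece.of_subset (h : IsPiece W A) (hWB : W ⊆ B) (hBA : B ⊆ A) (hB : IsClosed B) :
    IsPiece W B := by
  have := h.inter_closed hB
  rwa [inter_eq_left.2 hWB, inter_eq_right.2 hBA] at this

theorem IsPiece.inter (h : IsPiece W A) (h' : IsPiece V A) : IsPiece (W ∩ V) A := by
  refine ⟨inter_subset_left.trans h.1, h.2.1.inter h'.2.1, ?_⟩
  rw [sdiff_inter]; exact h.2.2.union h'.2.2

theorem IsPiece.union (h : IsPiece W A) (h' : IsPiece V A) : IsPiece (W ∪ V) A := by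
  refine ⟨union_subset h.1 h'.1, h.2.1.union h'.2.1, ?_⟩
  rw [diff_union_eq_diff_inter_diff]; exact h.2.2.inter h'.2.2
  where
  diff_union_eq_diff_inter_diff : A \ (W ∪ V) = (A \ W) ∩ (A \ V) := by
    ext x; simp only [Set.mem_sdiff, mem_inter_iff, mem_union]; tauto

theorem IsPiece.diff (h : IsPiece W A) (h' : IsPiece V A) : IsPiece (W \ V) A := by
  have := h.inter h'.compl
  have e : W ∩ (A \ V) = W \ V := by
    ext x; have := @h.1 x; simp only [Set.mem_sdiff, mem_inter_iff]; tauto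
  rwa [e] at this

theorem isPiece_Iio (hA : IsClosed A) (hu : u ∉ A) : IsPiece (A ∩ Iio u) A := by
  have e : A ∩ Iio u = A ∩ Iic u := by
    ext x; simp only [mem_inter_iff, mem_Iio, mem_Iic]
    exact ⟨fun h => ⟨h.1, h.2.le⟩, fun h => ⟨h.1, lt_of_le_of_ne h.2 fun e => hu (e ▸ h.1)⟩⟩
  refine ⟨inter_subset_left, e ▸ hA.inter isClosed_Iic, ?_⟩
  have : A \ (A ∩ Iio u) = A ∩ Ici u := by ext x; simp
  rw [this]; exact hA.inter isClosed_Ici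

theorem isPiece_Ioi (hA : IsClosed A) (hu : u ∉ A) : IsPiece (A ∩ Ioi u) A := by
  have e : A ∩ Ioi u = A ∩ Ici u := by
    ext x; simp only [mem_inter_iff, mem_Ioi, mem_Ici]
    exact ⟨fun h => ⟨h.1, h.2.le⟩, fun h => ⟨h.1, lt_of_le_of_ne h.2 fun e => hu (e ▸ h.1)⟩⟩
  refine ⟨inter_subset_left, e ▸ hA.inter isClosed_Ici, ?_⟩
  have : A \ (A ∩ Ioi u) = A ∩ Iic u := by ext x; simp
  rw [this]; exact hA.inter isClosed_Iic

theorem isPiece_Ioo (hA : IsClosed A) (hu : u ∉ A) (hv : v ∉ A) : IsPiece (A ∩ Ioo u v) A := by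
  have := (isPiece_Ioi hA hu).inter (isPiece_Iio hA hv)
  rwa [← inter_inter_distrib_left, Ioi_inter_Iio] at this

theorem IsPiece.eventually_mem (h : IsPiece W A) (hx : x ∈ W) : ∀ᶠ y in 𝓝 x, y ∈ A → y ∈ W := by
  have : (A \ W)ᶜ ∈ 𝓝 x := h.2.2.isOpen_compl.mem_nhds (fun h' => h'.2 hx)
  filter_upwards [this] with y hy hyA
  by_contra hyW
  exact hy ⟨hyA, hyW⟩

theorem IsPiece.exists_Ioo (h : IsPiece W A) (hx : x ∈ W) :
    ∃ ε > 0, ∀ y ∈ A, x - ε < y → y < x + ε → y ∈ W := by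
  obtain ⟨ε, hε, H⟩ := Metric.eventually_nhds_iff.1 (h.eventually_mem hx)
  refine ⟨ε, hε, fun y hy h1 h2 => H ?_ hy⟩
  rw [Real.dist_eq, abs_lt]; constructor <;> linarith

theorem EmbOn.isPiece_image (h : EmbOn f X Y) (hX : IsCompact X) (hW : IsPiece W X) :
    IsPiece (f '' W) Y := by
  refine ⟨h.image_eq ▸ image_mono hW.1,
    ((hW.isCompact hX).image_of_continuousOn (h.1.mono hW.1)).isClosed, ?_⟩
  have : Y \ f '' W = f '' (X \ W) := by
    rw [h.2.injOn.image_sdiff_subset hW.1, h.image_eq]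
  rw [this]
  exact ((hW.compl.isCompact hX).image_of_continuousOn (h.1.mono sdiff_subset)).isClosed

theorem EmbOn.isPiece_preimage (h : EmbOn f X Y) (hX : IsCompact X) (hV : IsPiece V Y) :
    IsPiece (X ∩ f ⁻¹' V) X := by
  refine ⟨inter_subset_left, h.1.preimage_isClosed_of_isClosed hX.isClosed hV.2.1, ?_⟩
  have : X \ (X ∩ f ⁻¹' V) = X ∩ f ⁻¹' (Y \ V) := by
    ext x; have := fun hx : x ∈ X => h.2.mapsTo hx
    simp only [Set.mem_sdiff, mem_inter_iff, mem_preimage]; tauto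
  rw [this]
  exact h.1.preimage_isClosed_of_isClosed hX.isClosed hV.2.2

/-- Two bijections on closed sets that agree on the overlap glue to one on the union. -/
theorem EmbOn.glue {X₁ X₂ Y₁ Y₂ : Set ℝ} {f₁ f₂ : ℝ → ℝ} (h₁ : EmbOn f₁ X₁ Y₁)
    (h₂ : EmbOn f₂ X₂ Y₂) (c₁ : IsClosed X₁) (c₂ : IsClosed X₂)
    (he : ∀ x ∈ X₁, x ∈ X₂ → f₁ x = f₂ x)
    (hi : ∀ y ∈ Y₁, y ∈ Y₂ → ∃ x ∈ X₁, x ∈ X₂ ∧ f₁ x = y) :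
    ∃ f, EmbOn f (X₁ ∪ X₂) (Y₁ ∪ Y₂) ∧ (∀ x ∈ X₁, f x = f₁ x) ∧ ∀ x ∈ X₂, f x = f₂ x := by
  classical
  have e1 : EqOn (X₁.piecewise f₁ f₂) f₁ X₁ := fun x hx => piecewise_eq_of_mem _ _ _ hx
  have e2 : EqOn (X₁.piecewise f₁ f₂) f₂ X₂ := fun x hx => by
    by_cases h : x ∈ X₁
    · rw [e1 h, he x h hx]
    · exact piecewise_eq_of_notMem _ _ _ h
  have key : ∀ x ∈ X₁, ∀ y ∈ X₂, f₁ x = f₂ y → x = y := by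
    intro x hx y hy hxy
    obtain ⟨z, hz1, hz2, hz⟩ := hi (f₁ x) (h₁.mem hx) (hxy ▸ h₂.mem hy)
    have a1 : z = x := h₁.2.injOn hz1 hx hz
    have a2 : z = y := h₂.2.injOn hz2 hy (by rw [← he z hz1 hz2, hz, hxy])
    rw [← a1, a2]
  refine ⟨X₁.piecewise f₁ f₂, ⟨(h₁.1.congr e1).union_of_isClosed (h₂.1.congr e2) c₁ c₂, ?_⟩, e1, e2⟩
  refine ⟨?_, ?_, ?_⟩
  · rintro x (hx | hx)
    · rw [e1 hx]; exact Or.inl (h₁.mem hx)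
    · rw [e2 hx]; exact Or.inr (h₂.mem hx)
  · rintro x (hx | hx) y (hy | hy) hxy
    · rw [e1 hx, e1 hy] at hxy; exact h₁.2.injOn hx hy hxy
    · rw [e1 hx, e2 hy] at hxy; exact key x hx y hy hxy
    · rw [e2 hx, e1 hy] at hxy; exact (key y hy x hx hxy.symm).symm
    · rw [e2 hx, e2 hy] at hxy; exact h₂.2.injOn hx hy hxy
  · rintro y (hy | hy)
    · obtain ⟨x, hx, rfl⟩ := h₁.2.surjOn hy
      exact ⟨x, Or.inl hx, e1 hx⟩
    · obtain ⟨x, hx, rfl⟩ := h₂.2.surjOn hy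
      exact ⟨x, Or.inr hx, e2 hx⟩

theorem EmbOn.glue_disjoint {X₁ X₂ Y₁ Y₂ : Set ℝ} {f₁ f₂ : ℝ → ℝ} (h₁ : EmbOn f₁ X₁ Y₁)
    (h₂ : EmbOn f₂ X₂ Y₂) (c₁ : IsClosed X₁) (c₂ : IsClosed X₂)
    (hX : Disjoint X₁ X₂) (hY : Disjoint Y₁ Y₂) :
    ∃ f, EmbOn f (X₁ ∪ X₂) (Y₁ ∪ Y₂) ∧ (∀ x ∈ X₁, f x = f₁ x) ∧ ∀ x ∈ X₂, f x = f₂ x :=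
  h₁.glue h₂ c₁ c₂ (fun _ h h' => (disjoint_left.1 hX h h').elim)
    (fun _ h h' => (disjoint_left.1 hY h h').elim)

theorem Iso.union {X₁ X₂ Y₁ Y₂ : Set ℝ} (h₁ : Iso X₁ Y₁)
    (h₂ : Iso X₂ Y₂) (c₁ : IsClosed X₁) (c₂ : IsClosed X₂)
    (hX : Disjoint X₁ X₂) (hY : Disjoint Y₁ Y₂) : Iso (X₁ ∪ X₂) (Y₁ ∪ Y₂) := by
  obtain ⟨f, hf⟩ := h₁
  obtain ⟨g, hg⟩ := h₂
  obtain ⟨k, hk, -⟩ := hf.glue_disjoint hg c₁ c₂ hX hY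
  exact ⟨k, hk⟩

/-- Local-to-global principle for pieces of a compact set. -/
theorem piece_induction {Pr : Set ℝ → Prop} {K : Set ℝ} (hA : IsCompact A) (hK : IsPiece K A)
    (h0 : Pr ∅)
    (hU : ∀ V W, IsPiece V A → IsPiece W A → Disjoint V W → Pr V → Pr W → Pr (V ∪ W))
    (hloc : ∀ x ∈ K, ∃ W, IsPiece W A ∧ x ∈ W ∧ ∀ V, IsPiece V A → V ⊆ W → Pr V) :
    ∀ V, IsPiece V A → V ⊆ K → Pr V := by
  -- The compactness induction runs on a hereditary property, valid for all subpieces of a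
  -- neighbourhood, so that a piece inside `W ∪ W'` can be cut along `W`.
  have : ∃ W, IsPiece W A ∧ K ⊆ W ∧ ∀ V, IsPiece V A → V ⊆ W → Pr V := by
    refine (hK.isCompact hA).induction_on
      (p := fun s => ∃ W, IsPiece W A ∧ s ⊆ W ∧ ∀ V, IsPiece V A → V ⊆ W → Pr V) ?_ ?_ ?_ ?_
    · exact ⟨∅, .empty hA.isClosed, Subset.rfl, fun V _ hV => by
        rw [subset_empty_iff.1 hV]; exact h0⟩
    · rintro s t hst ⟨W, h1, h2, h3⟩
      exact ⟨W, h1, hst.trans h2, h3⟩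
    · rintro s t ⟨W, h1, h2, h3⟩ ⟨W', h1', h2', h3'⟩
      refine ⟨W ∪ W', h1.union h1', union_subset_union h2 h2', fun V hV hVW => ?_⟩
      rw [← inter_union_sdiff V W]
      refine hU _ _ (hV.inter h1) (hV.diff h1) ?_ (h3 _ (hV.inter h1) inter_subset_right)
        (h3' _ (hV.diff h1) fun x hx => (hVW hx.1).resolve_left hx.2)
      exact disjoint_left.2 fun x hx hx' => hx'.2 hx.2
    · intro x hx
      obtain ⟨W, h1, h2, h3⟩ := hloc x hx
      refine ⟨K ∩ W, ?_, W, h1, inter_subset_right, h3⟩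
      filter_upwards [self_mem_nhdsWithin, nhdsWithin_le_nhds (h1.eventually_mem h2)] with y hy h
      exact ⟨hy, h (hK.1 hy)⟩
  obtain ⟨W, -, h2, h3⟩ := this
  exact fun V hV hVK => h3 V hV (hVK.trans h2)

end TameReal

/-! ### Components of compact sets; isolated components -/

namespace TameReal
open Set Filter Topology
open scoped Pointwise

/-- The complement of `A` accumulates at `a` from the left. -/
def LGap (A : Set ℝ) (a : ℝ) : Prop := ∀ u < a, ∃ c, u < c ∧ c < a ∧ c ∉ A

/-- The complement of `A` accumulates at `b` from the right. -/
def RGap (A : Set ℝ) (b : ℝ) : Prop := ∀ v, b < v → ∃ c, b < c ∧ c < v ∧ c ∉ A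

/-- `[a, b]` is a connected component of `A`. -/
structure IsComp (A : Set ℝ) (a b : ℝ) : Prop where
  le : a ≤ b
  sub : Icc a b ⊆ A
  lgap : LGap A a
  rgap : RGap A b

/-- `[a, b]` is a nondegenerate component of `A` at both of whose ends `A` accumulates. -/
structure Fat (A : Set ℝ) (a b : ℝ) : Prop extends IsComp A a b where
  lt : a < b
  lacc : ∀ u < a, ∃ y ∈ A, u < y ∧ y < a
  racc : ∀ v, b < v → ∃ y ∈ A, b < y ∧ y < v

variable {A B C W V U X Y Z T : Set ℝ} {f g : ℝ → ℝ} {a b c d u v x y a' b' : ℝ}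

theorem LGap.neg (h : LGap A a) : RGap (-A) (-a) := fun v hv => by
  obtain ⟨c, h1, h2, h3⟩ := h (-v) (by linarith)
  exact ⟨-c, by linarith, by linarith, by simpa using h3⟩

theorem RGap.neg (h : RGap A a) : LGap (-A) (-a) := fun v hv => by
  obtain ⟨c, h1, h2, h3⟩ := h (-v) (by linarith)
  exact ⟨-c, by linarith, by linarith, by simpa using h3⟩

theorem IsComp.neg (h : IsComp A a b) : IsComp (-A) (-b) (-a) where
  le := neg_le_neg h.le
  sub := fun x hx => h.sub ⟨by linarith [hx.2], by linarith [hx.1]⟩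
  lgap := h.rgap.neg
  rgap := h.lgap.neg

theorem Fat.neg (h : Fat A a b) : Fat (-A) (-b) (-a) where
  toIsComp := h.toIsComp.neg
  lt := neg_lt_neg h.lt
  lacc := fun u hu => by
    obtain ⟨y, h1, h2, h3⟩ := h.racc (-u) (by linarith)
    exact ⟨-y, by simpa using h1, by linarith, by linarith⟩
  racc := fun u hu => by
    obtain ⟨y, h1, h2, h3⟩ := h.lacc (-u) (by linarith)
    exact ⟨-y, by simpa using h1, by linarith, by linarith⟩

theorem IsComp.left_mem (h : IsComp A a b) : a ∈ A := h.sub (left_mem_Icc.2 h.le)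
theorem IsComp.right_mem (h : IsComp A a b) : b ∈ A := h.sub (right_mem_Icc.2 h.le)

/-- The left end is the infimum of all `y` with `[y, x]` inside `A`; an interval of `A` further left
would contradict minimality. -/
theorem exists_left_end (hA : IsCompact A) (hx : x ∈ A) :
    ∃ a ≤ x, Icc a x ⊆ A ∧ LGap A a := by
  set S : Set ℝ := {y | y ≤ x ∧ Icc y x ⊆ A} with hS
  have hxS : x ∈ S := ⟨le_rfl, by simpa using hx⟩
  have hSA : S ⊆ A := fun y hy => hy.2 (left_mem_Icc.2 hy.1)
  have hbd : BddBelow S := hA.bddBelow.mono hSA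
  have hax : sInf S ≤ x := csInf_le hbd hxS
  have haA : sInf S ∈ A :=
    closure_minimal hSA hA.isClosed (csInf_mem_closure ⟨x, hxS⟩ hbd)
  have hsub : Icc (sInf S) x ⊆ A := by
    intro z hz
    rcases hz.1.eq_or_lt with h | h
    · exact h ▸ haA
    · obtain ⟨y, hy, hyz⟩ := exists_lt_of_csInf_lt ⟨x, hxS⟩ h
      exact hy.2 ⟨hyz.le, hz.2⟩
  refine ⟨sInf S, hax, hsub, fun u hu => ?_⟩
  by_contra! hcon
  obtain ⟨m, hm1, hm2⟩ := exists_between hu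
  have : m ∈ S := ⟨hm2.le.trans hax, fun z hz => by
    rcases lt_or_ge z (sInf S) with h | h
    · exact hcon z (hm1.trans_le hz.1) h
    · exact hsub ⟨h, hz.2⟩⟩
  exact absurd (csInf_le hbd this) (not_le.2 hm2)

theorem exists_isComp (hA : IsCompact A) (hx : x ∈ A) :
    ∃ a b, IsComp A a b ∧ a ≤ x ∧ x ≤ b := by
  obtain ⟨a, ha, hs, hg⟩ := exists_left_end hA hx
  obtain ⟨b, hb, hs', hg'⟩ := exists_left_end (A := -A) (x := -x) hA.neg (by simpa using hx)
  refine ⟨a, -b, ⟨by linarith, fun z hz => ?_, hg, by simpa using hg'.neg⟩, ha, by linarith⟩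
  rcases le_total z x with h | h
  · exact hs ⟨hz.1, h⟩
  · have := @hs' (-z) ⟨by linarith [hz.2], by linarith⟩
    simpa using this

theorem IsComp.mem_of_uIcc (h : IsComp A a b) (hx : x ∈ Icc a b) (hy : uIcc x y ⊆ A) :
    y ∈ Icc a b := by
  constructor
  · by_contra! hya
    obtain ⟨c, h1, h2, h3⟩ := h.lgap y hya
    exact h3 (hy (by rw [uIcc_of_ge (by linarith [hx.1])]; exact ⟨h1.le, by linarith [hx.1]⟩))
  · by_contra! hya
    obtain ⟨c, h1, h2, h3⟩ := h.rgap y hya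
    exact h3 (hy (by rw [uIcc_of_le (by linarith [hx.2])]; exact ⟨by linarith [hx.2], h2.le⟩))

theorem IsComp.eq_of_mem (h : IsComp A a b) (h' : IsComp A c d) (hx : x ∈ Icc a b)
    (hx' : x ∈ Icc c d) : a = c ∧ b = d := by
  have k : ∀ {p q r s : ℝ}, IsComp A p q → IsComp A r s → x ∈ Icc p q → x ∈ Icc r s →
      p ≤ r ∧ s ≤ q := by
    intro p q r s k1 k2 m1 m2
    exact ⟨(k1.mem_of_uIcc m1 ((uIcc_subset_Icc m2 (left_mem_Icc.2 k2.le)).trans k2.sub)).1,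
      (k1.mem_of_uIcc m1 ((uIcc_subset_Icc m2 (right_mem_Icc.2 k2.le)).trans k2.sub)).2⟩
  have k1 := k h h' hx hx'
  have k2 := k h' h hx' hx
  exact ⟨le_antisymm k1.1 k2.1, le_antisymm k2.2 k1.2⟩

/-- A point outside `A` lies on one side of each interval contained in `A`. -/
theorem lt_of_notMem {s : ℝ} (hs : s ∉ A) (hsub : Icc a b ⊆ A) (hsb : s < b) : s < a := by
  by_contra! h
  exact hs (hsub ⟨h, hsb.le⟩)

theorem gt_of_notMem {s : ℝ} (hs : s ∉ A) (hsub : Icc a b ⊆ A) (hsb : a < s) : b < s := by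
  by_contra! h
  exact hs (hsub ⟨hsb.le, h⟩)

theorem IsPiece.isPreconnected_subset (h : IsPiece W A) {S : Set ℝ} (hS : IsPreconnected S)
    (hSA : S ⊆ A) (hx : x ∈ S) (hxW : x ∈ W) : S ⊆ W := by
  rcases isPreconnected_iff_subset_of_disjoint_closed.1 hS W (A \ W) h.2.1 h.2.2
    (by rw [union_sdiff_cancel h.1]; exact hSA) (by ext; simp) with k | k
  · exact k
  · exact ((k hx).2 hxW).elim

theorem IsPiece.comp_subset (h : IsPiece W A) (hc : IsComp A a b) (hx : x ∈ Icc a b)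
    (hxW : x ∈ W) : Icc a b ⊆ W :=
  h.isPreconnected_subset isPreconnected_Icc hc.sub hx hxW

/-- Among components meeting `T`, one is isolated, provided the closure of `T` consists of
points of nondegenerate components. -/
theorem exists_isolated (hA : IsCompact A) (hT : T.Nonempty) (hTZ : T ⊆ Z) (hZA : Z ⊆ A)
    (hZ : IsClosed Z) (hZI : ∀ z ∈ Z, ∃ c d, c < d ∧ c ≤ z ∧ z ≤ d ∧ Icc c d ⊆ A) :
    ∃ x ∈ T, ∃ u v, u < x ∧ x < v ∧ u ∉ A ∧ v ∉ A ∧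
      ∀ y ∈ T, u < y → y < v → uIcc x y ⊆ A := by
  obtain ⟨m, hm⟩ := hA.bddBelow
  -- The measure of the complement to the left of `x`. This function is 1-Lipschitz, constant on
  -- components of `A` and strictly increasing from one component to the next, so it collapses
  -- exactly the components.
  set q : ℝ → ℝ := fun x => (MeasureTheory.volume (Icc m x \ A)).toReal with hq
  have hfin : ∀ x, MeasureTheory.volume (Icc m x \ A) ≠ ⊤ := fun x =>
    ((MeasureTheory.measure_mono sdiff_subset).trans_lt (by simp [Real.volume_Icc])).ne
  have hmono : Monotone q := fun x y hxy => ENNReal.toReal_mono (hfin y)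
    (MeasureTheory.measure_mono (sdiff_subset_sdiff_left (Icc_subset_Icc_right hxy)))
  have hlip : ∀ x y, x ≤ y → q y - q x ≤ y - x := by
    intro x y hxy
    have h1 : MeasureTheory.volume (Icc m y \ A) ≤
        MeasureTheory.volume (Icc m x \ A) + ENNReal.ofReal (y - x) := by
      rw [← Real.volume_Ioc]
      refine (MeasureTheory.measure_mono ?_).trans (MeasureTheory.measure_union_le _ _)
      intro z hz
      rcases le_or_gt z x with h | h
      · exact Or.inl ⟨⟨hz.1.1, h⟩, hz.2⟩
      · exact Or.inr ⟨h, hz.1.2⟩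
    have h2 := ENNReal.toReal_mono (by finiteness [hfin x]) h1
    rw [ENNReal.toReal_add (hfin x) ENNReal.ofReal_ne_top, ENNReal.toReal_ofReal (by linarith)] at h2
    simp only [hq]; linarith
  have hcont : Continuous q := by
    refine (LipschitzWith.of_dist_le_mul (K := 1) fun x y => ?_).continuous
    rw [Real.dist_eq, Real.dist_eq, NNReal.coe_one, one_mul]
    rcases le_total x y with h | h
    · rw [abs_of_nonpos (by linarith [hmono h]), abs_of_nonpos (by linarith)]
      linarith [hlip x y h]
    · rw [abs_of_nonneg (by linarith [hmono h]), abs_of_nonneg (by linarith)]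
      linarith [hlip y x h]
  have hconst : ∀ x y, x ≤ y → Icc x y ⊆ A → q x = q y := by
    intro x y hxy hs
    refine le_antisymm (hmono hxy) (ENNReal.toReal_mono (hfin x) (MeasureTheory.measure_mono ?_))
    intro z hz
    refine ⟨⟨hz.1.1, ?_⟩, hz.2⟩
    by_contra! h
    exact hz.2 (hs ⟨h.le, hz.1.2⟩)
  have hstrict : ∀ x ∈ A, ∀ y, x ≤ y → q x = q y → Icc x y ⊆ A := by
    intro x hx y hxy he z hz
    by_contra hzA
    have hxz : x < z := lt_of_le_of_ne hz.1 fun h => hzA (h ▸ hx)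
    obtain ⟨l, hl, hlA⟩ := exists_Ioc_subset_of_mem_nhds (hA.isClosed.isOpen_compl.mem_nhds hzA)
      ⟨x, hxz⟩
    have hlx : max l x < z := max_lt hl hxz
    have h1 : MeasureTheory.volume (Icc m x \ A) + MeasureTheory.volume (Ioc (max l x) z) ≤
        MeasureTheory.volume (Icc m y \ A) := by
      rw [← MeasureTheory.measure_union _ measurableSet_Ioc]
      · refine MeasureTheory.measure_mono ?_
        rintro w (hw | hw)
        · exact ⟨⟨hw.1.1, hw.1.2.trans hxy⟩, hw.2⟩
        · exact ⟨⟨(hm hx).trans ((le_max_right _ _).trans hw.1.le), hw.2.trans hz.2⟩,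
            hlA ⟨(le_max_left _ _).trans_lt hw.1, hw.2⟩⟩
      · exact disjoint_left.2 fun w hw hw' =>
          absurd (hw.1.2.trans (le_max_right l x)) (not_le.2 hw'.1)
    have h2 := ENNReal.toReal_mono (hfin y) h1
    rw [Real.volume_Ioc, ENNReal.toReal_add (hfin x) ENNReal.ofReal_ne_top,
      ENNReal.toReal_ofReal (by linarith)] at h2
    simp only [hq] at he
    linarith
  -- Each nondegenerate component contains a rational with the same value of `q`.
  have hcount : (q '' Z).Countable := by
    refine (countable_range fun r : ℚ => q (r : ℝ)).mono ?_
    rintro _ ⟨z, hz, rfl⟩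
    obtain ⟨c, d, hcd, hc, hd, hs⟩ := hZI z hz
    obtain ⟨r, hr1, hr2⟩ := exists_rat_btwn hcd
    refine ⟨r, ?_⟩
    simp only
    rw [← hconst c z hc ((Icc_subset_Icc_right hd).trans hs),
      ← hconst c r hr1.le ((Icc_subset_Icc_right hr2.le).trans hs)]
  have hcl : closure (q '' T) ⊆ q '' Z :=
    closure_minimal (image_mono hTZ)
      ((hA.of_isClosed_subset hZ hZA).image hcont).isClosed
  -- The closure of `q '' T` lies in the countable set `q '' Z`, so it is not perfect: a nonempty
  -- perfect set contains a copy of the Cantor space. Hence `q '' T` has an isolated point.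
  have hnp : ¬ Preperfect (q '' T) := by
    intro hp
    obtain ⟨F, hF, -, hinj⟩ := hp.perfect_closure.exists_nat_bool_injection (hT.image q).closure
    have h1 : Countable (range F) := hcount.mono (hF.trans hcl)
    have h2 : Countable (ℕ → Bool) := (rangeFactorization_injective.2 hinj).countable
    have h3 := Cardinal.mk_le_aleph0_iff.2 h2
    simp only [← Cardinal.power_def, Cardinal.mk_bool, Cardinal.mk_nat] at h3
    exact absurd h3 (not_le.2 (Cardinal.cantor _))
  rw [preperfect_iff_nhds] at hnp
  push Not at hnp
  obtain ⟨_, ⟨x, hxT, rfl⟩, U, hU, hiso⟩ := hnp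
  obtain ⟨ε, hε, hεU⟩ := Metric.mem_nhds_iff.1 hU
  obtain ⟨a, b, hc, hax, hxb⟩ := exists_isComp hA (hZA (hTZ hxT))
  -- Gap points within `ε` of the component: by the Lipschitz bound everything between them has
  -- `q`-value in the isolating ball.
  obtain ⟨u, hu1, hu2, hu3⟩ := hc.lgap (a - ε) (by linarith)
  obtain ⟨v, hv1, hv2, hv3⟩ := hc.rgap (b + ε) (by linarith)
  have e1 : q a = q x := hconst a x hax ((Icc_subset_Icc_right hxb).trans hc.sub)
  have e2 : q x = q b := hconst x b hxb ((Icc_subset_Icc_left hax).trans hc.sub)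
  refine ⟨x, hxT, u, v, by linarith, by linarith, hu3, hv3, fun y hy huy hyv => ?_⟩
  have hqy : q y = q x := by
    refine hiso _ ⟨hεU ?_, y, hy, rfl⟩
    rw [Metric.mem_ball, Real.dist_eq, abs_lt]
    have := hmono huy.le
    have := hmono hyv.le
    have := hlip u a hu2.le
    have := hlip b v hv1.le
    constructor <;> linarith
  rcases le_total x y with h | h
  · rw [uIcc_of_le h]; exact hstrict x (hZA (hTZ hxT)) y h hqy.symm
  · rw [uIcc_of_ge h]; exact hstrict y (hZA (hTZ hy)) x h hqy

end TameReal

/-! ### One-sided germs at the ends of components -/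

namespace TameReal
open Set Filter Topology
open scoped Pointwise

/-- The left germs of `A` at `a` and of `B` at `b` are homeomorphic. -/
def LGerm (A : Set ℝ) (a : ℝ) (B : Set ℝ) (b : ℝ) : Prop :=
  ∃ U V f, IsPiece U (A ∩ Iic a) ∧ a ∈ U ∧ IsPiece V (B ∩ Iic b) ∧ b ∈ V ∧ EmbOn f U V ∧ f a = b

/-- The left germ of `A` at `a` is homeomorphic to its right germ at `b`. -/
def Flip (A : Set ℝ) (a b : ℝ) : Prop := LGerm A a (-A) (-b)

variable {A B C W V U X Y Z T : Set ℝ} {f g : ℝ → ℝ} {a b c d u v x y a' b' : ℝ}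

theorem LGerm.refl (hA : IsClosed A) (ha : a ∈ A) : LGerm A a A a :=
  ⟨A ∩ Iic a, A ∩ Iic a, id, .refl (hA.inter isClosed_Iic), ⟨ha, self_mem_Iic⟩,
    .refl (hA.inter isClosed_Iic), ⟨ha, self_mem_Iic⟩, embOn_id _, rfl⟩

theorem LGerm.symm (h : LGerm A a B b) (hA : IsCompact A) : LGerm B b A a := by
  obtain ⟨U, V, f, hU, ha, hV, hb, hf, hab⟩ := h
  obtain ⟨g, hg, h1, h2⟩ := hf.exists_inv (hU.isCompact (hA.inter_right isClosed_Iic))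
  exact ⟨V, U, g, hV, hb, hU, ha, hg, by rw [← hab, h1 a ha]⟩

theorem LGerm.trans (h : LGerm A a B b) (h' : LGerm B b C c) (hA : IsCompact A)
    (hB : IsCompact B) : LGerm A a C c := by
  obtain ⟨U, V, f, hU, ha, hV, hb, hf, rfl⟩ := h
  obtain ⟨V', W, g, hV', hb', hW, hc, hg, rfl⟩ := h'
  have cB := hB.inter_right (isClosed_Iic (a := f a))
  have cA := hA.inter_right (isClosed_Iic (a := a))
  have hI := hV.inter hV'
  have p1 : IsPiece (V ∩ V') V := hI.of_subset inter_subset_left hV.1 hV.2.1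
  have p2 : IsPiece (V ∩ V') V' := hI.of_subset inter_subset_right hV'.1 hV'.2.1
  refine ⟨U ∩ f ⁻¹' (V ∩ V'), g '' (V ∩ V'), g ∘ f,
    (hf.isPiece_preimage (hU.isCompact cA) p1).trans hU, ⟨ha, hb, hb'⟩,
    (hg.isPiece_image (hV'.isCompact cB) p2).trans hW, ⟨_, ⟨hb, hb'⟩, rfl⟩,
    (hg.image inter_subset_right).comp (hf.preimage inter_subset_left), rfl⟩

/-- Because the complement accumulates at both base points, a representative can be cut at gap
points as close as desired; the two cuts are combined by a preimage. -/
theorem LGerm.shrink (h : LGerm A a B b) (hA : IsCompact A) (hB : IsCompact B)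
    (ga : LGap A a) (gb : LGap B b) (hu : u < a) (hv : v < b) :
    ∃ U V f, IsPiece U (A ∩ Iic a) ∧ a ∈ U ∧ IsPiece V (B ∩ Iic b) ∧ b ∈ V ∧ EmbOn f U V ∧
      f a = b ∧ U ⊆ Ioc u a ∧ V ⊆ Ioc v b := by
  obtain ⟨U, V, f, hU, ha, hV, hb, hf, rfl⟩ := h
  obtain ⟨c, hc1, hc2, hc3⟩ := ga u hu
  obtain ⟨d, hd1, hd2, hd3⟩ := gb v hv
  have cB := hB.inter_right (isClosed_Iic (a := f a))
  have cA := hA.inter_right (isClosed_Iic (a := a))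
  have pU : IsPiece (U ∩ Ioi c) U := isPiece_Ioi hU.2.1 fun h => hc3 (hU.1 h).1
  have pV : IsPiece (V ∩ Ioi d) V := isPiece_Ioi hV.2.1 fun h => hd3 (hV.1 h).1
  have pW := (hf.isPiece_preimage (hU.isCompact cA) pV).inter pU
  refine ⟨_, f '' (U ∩ f ⁻¹' (V ∩ Ioi d) ∩ (U ∩ Ioi c)), f, pW.trans hU,
    ⟨⟨ha, hb, hd2⟩, ha, hc2⟩, (hf.isPiece_image (hU.isCompact cA) pW).trans hV,
    ⟨a, ⟨⟨ha, hb, hd2⟩, ha, hc2⟩, rfl⟩, hf.image pW.1, rfl, ?_, ?_⟩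
  · exact fun x hx => ⟨hc1.trans hx.2.2, (hU.1 hx.2.1).2⟩
  · rintro _ ⟨x, hx, rfl⟩
    exact ⟨hd1.trans hx.1.2.2, (hV.1 hx.1.2.1).2⟩

theorem LGerm.congr (hA : IsClosed A) (hB : IsClosed B) (ha : a ∈ A)
    (hua : u < a) (h : A ∩ Ioo u v = B ∩ Ioo u v) (hav : a < v) (hg : LGap A a) :
    LGerm A a B a := by
  obtain ⟨c, hc1, hc2, hc3⟩ := hg u hua
  have key : ∀ x, u < x → x < v → (x ∈ A ↔ x ∈ B) := fun x h1 h2 => by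
    have := Set.ext_iff.1 h x
    simpa [h1, h2] using this
  have e : A ∩ Iic a ∩ Ioi c = B ∩ Iic a ∩ Ioi c := by
    ext x
    simp only [mem_inter_iff, mem_Iic, mem_Ioi]
    constructor
    · rintro ⟨⟨h1, h2⟩, h3⟩
      exact ⟨⟨(key x (hc1.trans h3) (h2.trans_lt hav)).1 h1, h2⟩, h3⟩
    · rintro ⟨⟨h1, h2⟩, h3⟩
      exact ⟨⟨(key x (hc1.trans h3) (h2.trans_lt hav)).2 h1, h2⟩, h3⟩
  refine ⟨A ∩ Iic a ∩ Ioi c, B ∩ Iic a ∩ Ioi c, id,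
    isPiece_Ioi (hA.inter isClosed_Iic) fun h => hc3 h.1, ⟨⟨ha, self_mem_Iic⟩, hc2⟩,
    isPiece_Ioi (hB.inter isClosed_Iic) fun h => hc3 ((key c hc1 (hc2.trans hav)).2 h.1),
    e ▸ ⟨⟨ha, self_mem_Iic⟩, hc2⟩, ?_, rfl⟩
  rw [← e]; exact embOn_id _

theorem Flip.neg (h : Flip A a b) (hA : IsCompact A) : Flip (-A) (-b) (-a) := by
  have := LGerm.symm h hA
  rw [Flip, neg_neg, neg_neg]; exact this

theorem LGerm.orderIso (hA : IsCompact A) (ha : a ∈ A) (h : ℝ ≃o ℝ) :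
    LGerm A a (h '' A) (h a) := by
  have hc : Continuous h := h.continuous
  have e : h '' A ∩ Iic (h a) = h '' (A ∩ Iic a) := by
    ext x; constructor
    · rintro ⟨⟨y, hy, rfl⟩, hy'⟩
      exact ⟨y, ⟨hy, h.le_iff_le.1 hy'⟩, rfl⟩
    · rintro ⟨y, ⟨hy, hy'⟩, rfl⟩
      exact ⟨⟨y, hy, rfl⟩, h.monotone hy'⟩
  have ca := hA.inter_right (isClosed_Iic (a := a))
  refine ⟨A ∩ Iic a, h '' (A ∩ Iic a), h, .refl ca.isClosed, ⟨ha, self_mem_Iic⟩, ?_,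
    ⟨a, ⟨ha, self_mem_Iic⟩, rfl⟩, ⟨hc.continuousOn, h.injective.injOn.bijOn_image⟩, rfl⟩
  rw [e]; exact .refl (ca.image hc).isClosed

theorem LGap.orderIso (hg : LGap A a) (h : ℝ ≃o ℝ) : LGap (h '' A) (h a) := fun u hu => by
  obtain ⟨c, h1, h2, h3⟩ := hg (h.symm u) (h.symm_apply_lt.2 hu)
  exact ⟨h c, h.symm_apply_lt.1 h1, h.lt_iff_lt.2 h2, fun ⟨y, hy, e⟩ => h3 (h.injective e ▸ hy)⟩

theorem RGap.orderIso (hg : RGap A a) (h : ℝ ≃o ℝ) : RGap (h '' A) (h a) := fun u hu => by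
  obtain ⟨c, h1, h2, h3⟩ := hg (h.symm u) (h.lt_symm_apply.2 hu)
  exact ⟨h c, h.lt_iff_lt.2 h1, h.lt_symm_apply.1 h2, fun ⟨y, hy, e⟩ => h3 (h.injective e ▸ hy)⟩

theorem Fat.orderIso (hF : Fat A a b) (h : ℝ ≃o ℝ) : Fat (h '' A) (h a) (h b) where
  le := h.monotone hF.le
  sub := by rw [← h.image_Icc]; exact image_mono hF.sub
  lgap := hF.lgap.orderIso h
  rgap := hF.rgap.orderIso h
  lt := h.strictMono hF.lt
  lacc := fun u hu => by
    obtain ⟨c, h1, h2, h3⟩ := hF.lacc (h.symm u) (h.symm_apply_lt.2 hu)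
    exact ⟨h c, ⟨c, h1, rfl⟩, h.symm_apply_lt.1 h2, h.lt_iff_lt.2 h3⟩
  racc := fun u hu => by
    obtain ⟨c, h1, h2, h3⟩ := hF.racc (h.symm u) (h.lt_symm_apply.2 hu)
    exact ⟨h c, ⟨c, h1, rfl⟩, h.lt_iff_lt.2 h2, h.lt_symm_apply.1 h3⟩

/-- The order automorphism `x ↦ -h (-x)`. -/
noncomputable def conjNeg (h : ℝ ≃o ℝ) : ℝ ≃o ℝ :=
  ((OrderIso.neg ℝ).trans h.dual).trans (OrderIso.neg ℝ).symm

theorem conjNeg_apply (h : ℝ ≃o ℝ) (x : ℝ) : conjNeg h x = -h (-x) := rfl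

theorem image_conjNeg (h : ℝ ≃o ℝ) (A : Set ℝ) : conjNeg h '' (-A) = -(h '' A) := by
  ext x; constructor
  · rintro ⟨y, hy, rfl⟩
    exact ⟨-y, hy, by simp [conjNeg_apply]⟩
  · rintro ⟨y, hy, e⟩
    exact ⟨-y, by simpa using hy, by simp [conjNeg_apply, e]⟩

theorem RGerm.orderIso (hA : IsCompact A) (ha : a ∈ A) (h : ℝ ≃o ℝ) :
    LGerm (-A) (-a) (-(h '' A)) (-h a) := by
  have := LGerm.orderIso hA.neg (a := -a) (by simpa using ha) (conjNeg h)
  rwa [image_conjNeg, conjNeg_apply, neg_neg] at this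

theorem Flip.orderIso (hF : Flip A a b) (hA : IsCompact A) (ha : a ∈ A) (hb : b ∈ A)
    (h : ℝ ≃o ℝ) : Flip (h '' A) (h a) (h b) := by
  have hc : IsCompact (h '' A) := hA.image h.continuous
  exact ((LGerm.orderIso hA ha h).symm hA).trans (LGerm.trans hF (RGerm.orderIso hA hb h) hA hA.neg)
    hc hA

theorem exists_embOn_Icc (h : a < b) (h' : a' < b') :
    ∃ f, EmbOn f (Icc a b) (Icc a' b') ∧ f a = a' ∧ f b = b' := by
  have hk : 0 < (b' - a') / (b - a) := div_pos (by linarith) (by linarith)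
  have hb : (b - a) ≠ 0 := by linarith
  set k := (b' - a') / (b - a) with hkdef
  have hkb : k * (b - a) = b' - a' := by rw [hkdef]; field_simp
  refine ⟨fun x => a' + k * (x - a), ⟨by fun_prop, ?_, ?_, ?_⟩, by simp, by simp [hkb]⟩
  · intro x hx
    refine ⟨by nlinarith [hx.1], ?_⟩
    have : k * (x - a) ≤ k * (b - a) := by gcongr; exact hx.2
    show a' + k * (x - a) ≤ b'
    linarith
  · intro x _ y _ hxy
    have : k * (x - a) = k * (y - a) := by simpa using hxy
    have := mul_left_cancel₀ hk.ne' this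
    linarith
  · intro y hy
    refine ⟨a + (y - a') / k, ⟨?_, ?_⟩, ?_⟩
    · have : 0 ≤ (y - a') / k := div_nonneg (by linarith [hy.1]) hk.le
      linarith
    · have : (y - a') / k ≤ b - a := by rw [div_le_iff₀ hk]; linarith [hy.2]
      linarith
    · show a' + k * (a + (y - a') / k - a) = y
      field_simp; ring

theorem embOn_neg (X : Set ℝ) : EmbOn (fun x => -x) X (-X) :=
  ⟨continuousOn_id.neg, fun x hx => by simpa using hx, neg_injective.injOn,
    fun y hy => ⟨-y, hy, by simp⟩⟩

theorem IsPiece.neg (h : IsPiece W A) : IsPiece (-W) (-A) :=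
  ⟨by simpa using h.1, h.2.1.neg, by
    have : (-A) \ (-W) = -(A \ W) := by ext; simp
    rw [this]; exact h.2.2.neg⟩

/-- Homeomorphisms of the left and the right germs extend over the components in between. -/
theorem exists_embOn_nhd (hA : IsCompact A) (hB : IsCompact B)
    (hab : IsComp A a b) (hab' : IsComp B a' b') (lt : a < b) (lt' : a' < b')
    (hl : LGerm A a B a') (hr : LGerm (-A) (-b) (-B) (-b')) {s t s' t' : ℝ}
    (hs : s < a) (ht : b < t) (hs' : s' < a') (ht' : b' < t') :
    ∃ U V, IsPiece U A ∧ IsPiece V B ∧ Icc a b ⊆ U ∧ Icc a' b' ⊆ V ∧ U ⊆ Ioo s t ∧ V ⊆ Ioo s' t' ∧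
      Iso U V := by
  obtain ⟨U, V, f, hU, haU, hV, haV, hf, hfa, hUs, hVs⟩ := hl.shrink hA hB hab.lgap hab'.lgap hs hs'
  obtain ⟨U₁, V₁, f₁, hU₁, haU₁, hV₁, haV₁, hf₁, hfa₁, hUs₁, hVs₁⟩ :=
    hr.shrink hA.neg hB.neg hab.neg.lgap hab'.neg.lgap (neg_lt_neg ht) (neg_lt_neg ht')
  obtain ⟨k, hk, hka, hkb⟩ := exists_embOn_Icc lt lt'
  -- The right germs were compared after reflection; conjugating by negation brings the map back to
  -- the right of `b`.
  have hg : EmbOn (fun x => -(f₁ (-x))) (-U₁) (-V₁) := by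
    have h1 := (embOn_neg V₁).comp (hf₁.comp (by simpa using embOn_neg (-U₁)))
    exact h1
  have mU : ∀ x ∈ U, x ∈ A ∧ s < x ∧ x ≤ a := fun x hx => ⟨(hU.1 hx).1, hUs hx⟩
  have mV : ∀ x ∈ V, x ∈ B ∧ s' < x ∧ x ≤ a' := fun x hx => ⟨(hV.1 hx).1, hVs hx⟩
  have mU₁ : ∀ x ∈ -U₁, x ∈ A ∧ x < t ∧ b ≤ x := fun x hx =>
    ⟨by simpa using (hU₁.1 hx).1, by linarith [(hUs₁ hx).1], by linarith [(hUs₁ hx).2]⟩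
  have mV₁ : ∀ x ∈ -V₁, x ∈ B ∧ x < t' ∧ b' ≤ x := fun x hx =>
    ⟨by simpa using (hV₁.1 hx).1, by linarith [(hVs₁ hx).1], by linarith [(hVs₁ hx).2]⟩
  obtain ⟨F, hF, hF1, hF2⟩ := hf.glue hk hU.2.1 isClosed_Icc
    (fun x hx hx' => by
      have : x = a := le_antisymm (mU x hx).2.2 hx'.1
      rw [this, hfa, hka])
    (fun y hy hy' => by
      have : y = a' := le_antisymm (mV y hy).2.2 hy'.1
      exact ⟨a, haU, left_mem_Icc.2 lt.le, by rw [this, hfa]⟩)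
  have bU : b ∈ -U₁ := by simpa using haU₁
  obtain ⟨G, hG, -⟩ := hF.glue hg (hU.2.1.union isClosed_Icc) hU₁.2.1.neg
    (fun x hx hx' => by
      have hb := (mU₁ x hx').2.2
      have : x = b := by
        rcases hx with h | h
        · linarith [(mU x h).2.2]
        · exact le_antisymm h.2 hb
      rw [this, hF2 b (right_mem_Icc.2 lt.le), hkb, hfa₁, neg_neg])
    (fun y hy hy' => by
      have hb := (mV₁ y hy').2.2
      have : y = b' := by
        rcases hy with h | h
        · linarith [(mV y h).2.2]
        · exact le_antisymm h.2 hb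
      exact ⟨b, Or.inr (right_mem_Icc.2 lt.le), bU, by
        rw [this, hF2 b (right_mem_Icc.2 lt.le), hkb]⟩)
  -- Only the ends of the component need care: what remains of `A` is the union of the closed
  -- remainders left of `a` and right of `b`.
  have piece : ∀ {A U U₁ : Set ℝ} {a b : ℝ}, IsComp A a b → IsClosed A → IsPiece U (A ∩ Iic a) →
      a ∈ U → IsPiece U₁ (-A ∩ Iic (-b)) → -b ∈ U₁ → IsPiece (U ∪ Icc a b ∪ -U₁) A := by
    intro A U U₁ a b hab cA hU ha hU₁ hb
    have hU₁' : IsPiece (-U₁) (A ∩ Ici b) := by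
      have := hU₁.neg
      rwa [inter_neg, neg_neg, neg_Iic, neg_neg] at this
    refine ⟨union_subset (union_subset (hU.1.trans inter_subset_left) hab.sub)
      (hU₁'.1.trans inter_subset_left), (hU.2.1.union isClosed_Icc).union hU₁'.2.1, ?_⟩
    have : A \ (U ∪ Icc a b ∪ -U₁) = ((A ∩ Iic a) \ U) ∪ ((A ∩ Ici b) \ -U₁) := by
      ext x
      have m1 : x ∈ U → x ≤ a := fun h => (hU.1 h).2
      have m2 : x ∈ -U₁ → b ≤ x := fun h => (hU₁'.1 h).2
      have m3 : x = a → x ∈ U := fun h => h ▸ ha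
      have m4 : x = b → x ∈ -U₁ := fun h => by simpa [h] using hb
      have := hab.le
      simp only [Set.mem_sdiff, mem_union, mem_inter_iff, mem_Iic, mem_Ici, mem_Icc, not_or, not_and,
        not_le]
      constructor
      · rintro ⟨h1, ⟨h2, h3⟩, h4⟩
        rcases le_total x a with h | h
        · exact Or.inl ⟨⟨h1, h⟩, h2⟩
        · exact Or.inr ⟨⟨h1, (h3 h).le⟩, h4⟩
      · rintro (⟨⟨h1, h2⟩, h3⟩ | ⟨⟨h1, h2⟩, h3⟩)
        · have hne : x ≠ a := fun e => h3 (m3 e)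
          have hlt := lt_of_le_of_ne h2 hne
          exact ⟨h1, ⟨h3, fun h => by linarith⟩, fun h => by linarith [m2 h]⟩
        · have hne : x ≠ b := fun e => h3 (m4 e)
          have hlt := lt_of_le_of_ne h2 (Ne.symm hne)
          exact ⟨h1, ⟨fun h => by linarith [m1 h], fun _ => hlt⟩, h3⟩
    rw [this]; exact hU.2.2.union hU₁'.2.2
  refine ⟨_, _, piece hab hA.isClosed hU haU hU₁ haU₁, piece hab' hB.isClosed hV haV hV₁ haV₁,
    fun x hx => Or.inl (Or.inr hx), fun x hx => Or.inl (Or.inr hx), ?_, ?_, G, hG⟩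
  · rintro x ((h | h) | h)
    · exact ⟨(mU x h).2.1, by linarith [(mU x h).2.2]⟩
    · exact ⟨by linarith [h.1], by linarith [h.2]⟩
    · exact ⟨by linarith [(mU₁ x h).2.2], (mU₁ x h).2.1⟩
  · rintro x ((h | h) | h)
    · exact ⟨(mV x h).2.1, by linarith [(mV x h).2.2]⟩
    · exact ⟨by linarith [h.1], by linarith [h.2]⟩
    · exact ⟨by linarith [(mV₁ x h).2.2], (mV₁ x h).2.1⟩

end TameReal

/-! ### Sets made of blocks and fat components -/

namespace TameReal
open Set Filter Topology
open scoped Pointwise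

/-- A compact set all of whose nonempty pieces are homeomorphic to it, and which is connected or
totally disconnected. -/
structure BlockModel (B₀ : Set ℝ) : Prop where
  compact : IsCompact B₀
  hom : ∀ V, IsPiece V B₀ → V.Nonempty → Iso V B₀
  alt : IsPreconnected B₀ ∨ ∀ x y, x < y → ¬ Icc x y ⊆ B₀

/-- `x` lies in a piece of `A` homeomorphic to `B₀`. -/
def Base (B₀ A : Set ℝ) (x : ℝ) : Prop := ∃ W, IsPiece W A ∧ x ∈ W ∧ Iso W B₀

/-- Every point of the compact set `A` lies in a block `B₀` or in a component on both of whose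
sides `A` accumulates. -/
structure Good (B₀ A : Set ℝ) : Prop where
  compact : IsCompact A
  cover : ∀ x ∈ A, Base B₀ A x ∨ ∃ a b, Fat A a b ∧ x ∈ Icc a b
  excl : ∀ a b, Fat A a b → ∀ x ∈ Icc a b, ¬ Base B₀ A x

variable {B₀ A B C W V U X Y Z T : Set ℝ} {f g : ℝ → ℝ} {a b c d u v x y a' b' : ℝ}

theorem iso_neg (X : Set ℝ) : Iso X (-X) := ⟨_, embOn_neg X⟩

theorem iso_of_neg (X : Set ℝ) : Iso (-X) X := by simpa using iso_neg (-X)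

theorem Base.neg (h : Base B₀ A x) : Base B₀ (-A) (-x) := by
  obtain ⟨W, h1, h2, h3⟩ := h
  exact ⟨-W, h1.neg, by simpa using h2, (iso_of_neg W).trans h3⟩

theorem Good.neg (h : Good B₀ A) : Good B₀ (-A) where
  compact := h.compact.neg
  cover := fun x hx => by
    rcases h.cover (-x) (by simpa using hx) with h1 | ⟨a, b, h1, h2⟩
    · exact Or.inl (by simpa using h1.neg)
    · exact Or.inr ⟨-b, -a, h1.neg, by linarith [h2.2], by linarith [h2.1]⟩
  excl := fun a b hF x hx hb => by
    refine h.excl (-b) (-a) (by simpa using hF.neg) (-x) ⟨by linarith [hx.2], by linarith [hx.1]⟩ ?_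
    simpa using hb.neg

/-- The points in no block form a closed set, each lying in a nondegenerate component, so
`exists_isolated` applies with this set as `Z`. -/
theorem Good.isolated (h : Good B₀ A) (hT : T.Nonempty) (hTA : T ⊆ A)
    (hb : ∀ x ∈ T, ¬ Base B₀ A x) :
    ∃ x ∈ T, ∃ u v, u < x ∧ x < v ∧ u ∉ A ∧ v ∉ A ∧
      ∀ y ∈ T, u < y → y < v → uIcc x y ⊆ A := by
  refine exists_isolated (Z := {x | x ∈ A ∧ ¬ Base B₀ A x}) h.compact hT
    (fun x hx => ⟨hTA hx, hb x hx⟩) (fun x hx => hx.1) ?_ ?_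
  · rw [← isOpen_compl_iff, isOpen_iff_mem_nhds]
    intro x hx
    by_cases hxA : x ∈ A
    · have : Base B₀ A x := by by_contra h; exact hx ⟨hxA, h⟩
      obtain ⟨W, h1, h2, h3⟩ := this
      filter_upwards [h1.eventually_mem h2] with y hy hyZ
      exact hyZ.2 ⟨W, h1, hy hyZ.1, h3⟩
    · filter_upwards [h.compact.isClosed.isOpen_compl.mem_nhds hxA] with y hy hyZ
      exact hy hyZ.1
  · rintro z ⟨hz, hzb⟩
    obtain ⟨a, b, h1, h2⟩ := (h.cover z hz).resolve_left hzb
    exact ⟨a, b, h1.lt, h2.1, h2.2, h1.sub⟩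

theorem Fat.mem_left (h : Fat A a b) : a ∈ Icc a b := left_mem_Icc.2 h.le

/-- Induction on the left ends of the components counted by `Fat`. -/
theorem Good.induct (h : Good B₀ A) {P : ℝ → Prop}
    (hP : ∀ a b, Fat A a b → (∃ u < a, ∀ a' b', Fat A a' b' → u < a' → a' < a → P a') → P a) :
    ∀ a b, Fat A a b → P a := by
  by_contra! hcon
  obtain ⟨a, b, hF, hn⟩ := hcon
  -- An isolated counterexample has no other counterexample just to its left, which contradicts the
  -- induction step `hP`.
  obtain ⟨x, ⟨y, hxF, hxn⟩, u, v, hu, hv, -, -, hiso⟩ :=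
    h.isolated (T := {a | ∃ b, Fat A a b ∧ ¬ P a}) ⟨a, b, hF, hn⟩
      (fun x ⟨y, hy, _⟩ => hy.left_mem) (fun x ⟨y, hy, _⟩ => h.excl x y hy x hy.mem_left)
  refine hxn (hP x y hxF ⟨u, hu, fun a' b' hF' h1 h2 => ?_⟩)
  by_contra hn'
  have := hxF.mem_of_uIcc hxF.mem_left (hiso a' ⟨b', hF', hn'⟩ h1 (h2.trans hv))
  exact absurd this.1 (not_le.2 h2)

/-- Otherwise some component met by `W` would be isolated in `W`. But it would be fat, and points of
`W` accumulate at its left end. -/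
theorem Good.exists_base (h : Good B₀ A) (hW : IsPiece W A) (hne : W.Nonempty) :
    ∃ x ∈ W, Base B₀ A x := by
  by_contra! hcon
  obtain ⟨x, hxW, u, v, hu, hv, huA, hvA, hiso⟩ := h.isolated hne hW.1 hcon
  obtain ⟨a, b, hF, hx⟩ := (h.cover x (hW.1 hxW)).resolve_left (hcon x hxW)
  have haW : a ∈ W := hW.comp_subset hF.toIsComp hx hxW hF.mem_left
  have hua : u < a := lt_of_notMem huA hF.sub (hu.trans_le hx.2)
  obtain ⟨ε, hε, hεW⟩ := hW.exists_Ioo haW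
  obtain ⟨y, hyA, hy1, hy2⟩ := hF.lacc (max u (a - ε)) (max_lt hua (by linarith))
  have hyW : y ∈ W := hεW y hyA ((le_max_right _ _).trans_lt hy1) (by linarith)
  have := hF.mem_of_uIcc hx (hiso y hyW ((le_max_left _ _).trans_lt hy1)
    (by linarith [hx.1]))
  exact absurd this.1 (not_le.2 hy2)

theorem Iso.sub_block (hB : BlockModel B₀) (h : Iso W B₀) (hW : IsCompact W)
    (hV : IsPiece V W) (hne : V.Nonempty) :
    Iso V B₀ := by
  obtain ⟨f, hf⟩ := h
  exact Iso.trans ⟨f, hf.image hV.1⟩ (hB.hom _ (hf.isPiece_image hW hV) (hne.image f))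

end TameReal

/-! ### Embedding pieces close to the end of a fat component -/

namespace TameReal
open Set Filter Topology
open scoped Pointwise

/-- `W` is homeomorphic to pieces of `B` in every left neighbourhood of `b`. -/
def EmbNear (W B : Set ℝ) (b : ℝ) : Prop :=
  ∀ v < b, ∃ W', IsPiece W' B ∧ W' ⊆ Ioo v b ∧ Iso W W'

/-- Every left neighbourhood of `b` in `B` contains a flippable component whose ends have the
germ of `A` at `a`. -/
def Below (A : Set ℝ) (a : ℝ) (B : Set ℝ) (b : ℝ) : Prop :=
  ∀ v < b, ∃ a' b', Fat B a' b' ∧ v < a' ∧ a' < b ∧ Flip B a' b' ∧ LGerm A a B a'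

/-- Some piece of `A` around `c` has all its subpieces embeddable near `b`. -/
def LocEmbNear (A : Set ℝ) (c : ℝ) (B : Set ℝ) (b : ℝ) : Prop :=
  ∃ W, IsPiece W A ∧ c ∈ W ∧ ∀ V, IsPiece V A → V ⊆ W → EmbNear V B b

variable {B₀ A B C W V U X Y Z T : Set ℝ} {f g : ℝ → ℝ} {a b c d u v x y a' b' : ℝ}

theorem embNear_empty (hB : IsClosed B) : EmbNear ∅ B b := fun _ _ =>
  ⟨∅, .empty hB, empty_subset _, .refl _⟩

theorem exists_lt_of_compact (hW : IsCompact W) (hWb : W ⊆ Iio b) (hv : v < b) :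
    ∃ w, v ≤ w ∧ w < b ∧ W ⊆ Iic w := by
  rcases W.eq_empty_or_nonempty with rfl | hne
  · exact ⟨v, le_rfl, hv, empty_subset _⟩
  · obtain ⟨m, hm, hmax⟩ := hW.exists_isGreatest hne
    exact ⟨max v m, le_max_left _ _, max_lt hv (hWb hm), fun x hx => (hmax hx).trans (le_max_right _ _)⟩

/-- The copy of the second piece is put to the right of the copy of the first, which is compact and
so stays away from `b`. -/
theorem EmbNear.union (hB : IsCompact B) (hV : IsClosed V) (hW : IsClosed W)
    (hVW : Disjoint V W) (h1 : EmbNear V B b) (h2 : EmbNear W B b) : EmbNear (V ∪ W) B b := by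
  intro v hv
  obtain ⟨V', p1, s1, i1⟩ := h1 v hv
  obtain ⟨w, hvw, hwb, hw⟩ := exists_lt_of_compact (p1.isCompact hB) (fun x hx => (s1 hx).2) hv
  obtain ⟨W', p2, s2, i2⟩ := h2 w hwb
  exact ⟨V' ∪ W', p1.union p2, union_subset s1 fun x hx => ⟨hvw.trans_lt (s2 hx).1, (s2 hx).2⟩,
    i1.union i2 hV hW hVW (disjoint_left.2 fun x hx hx' => absurd (hw hx) (not_le.2 (s2 hx').1))⟩

theorem EmbNear.of_iso (h : EmbNear W B b) (hV : IsCompact W) (hi : Iso W V) : EmbNear V B b :=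
  fun v hv => by
    obtain ⟨W', h1, h2, h3⟩ := h v hv
    exact ⟨W', h1, h2, (hi.symm hV).trans h3⟩

/-- `B` accumulates at `b` from the left, so between two gaps near `b` there is a nonempty clopen
window. It meets a block, and a nonempty clopen part of a block is again a block. -/
theorem Fat.exists_block_near (hBM : BlockModel B₀) (hB : Good B₀ B) (hb : Fat B b d) :
    EmbNear B₀ B b := by
  intro v hv
  obtain ⟨c₁, h1, h2, h3⟩ := hb.lgap v hv
  obtain ⟨y, hyB, hy1, hy2⟩ := hb.lacc c₁ h2
  obtain ⟨c₂, h4, h5, h6⟩ := hb.lgap y hy2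
  have hP := isPiece_Ioo hB.compact.isClosed h3 h6
  obtain ⟨x, hx, W, hW, hxW, hWB⟩ := hB.exists_base hP ⟨y, hyB, hy1, h4⟩
  have hQ := hW.inter hP
  have cW := hW.isCompact hB.compact
  refine ⟨_, hQ, fun z hz => ⟨h1.trans hz.2.2.1, hz.2.2.2.trans h5⟩, ?_⟩
  exact (hWB.sub_block hBM cW (hQ.of_subset inter_subset_left hW.1 hW.2.1) ⟨x, hxW, hx⟩).symm
    (hQ.isCompact hB.compact)

theorem Base.locEmbNear (hBM : BlockModel B₀) (hA : IsCompact A) (hB : Good B₀ B)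
    (hb : Fat B b d) (hx : Base B₀ A x) : LocEmbNear A x B b := by
  obtain ⟨W, hW, hxW, hWB⟩ := hx
  refine ⟨W, hW, hxW, fun V hV hVW => ?_⟩
  rcases V.eq_empty_or_nonempty with rfl | hne
  · exact embNear_empty hB.compact.isClosed
  · have := hWB.sub_block hBM (hW.isCompact hA) (hV.of_subset hVW hW.1 hW.2.1) hne
    exact (hb.exists_block_near hBM hB).of_iso hBM.compact (this.symm (hV.isCompact hA))

/-- Local embeddability at blocks is automatic, so only the fat components inside `(u, a)` have to
be checked; compactness does the rest. -/
theorem embNear_of_loc (hBM : BlockModel B₀) (hA : Good B₀ A) (hB : Good B₀ B) (hb : Fat B b d)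
    (hl : ∀ a' b', Fat A a' b' → u < a' → a' < a → LocEmbNear A a' B b) :
    ∀ V, IsPiece V A → V ⊆ Ioo u a → EmbNear V B b := by
  intro K hK hKu
  refine piece_induction (Pr := fun V => EmbNear V B b) hA.compact hK (embNear_empty hB.compact.isClosed)
    (fun V W hV hW hVW h1 h2 => h1.union hB.compact hV.2.1 hW.2.1 hVW h2) ?_ K hK Subset.rfl
  intro x hx
  rcases hA.cover x (hK.1 hx) with h | ⟨a', b', hF, hxF⟩
  · exact h.locEmbNear hBM hA.compact hB hb
  · have := hKu (hK.comp_subset hF.toIsComp hxF hx hF.mem_left)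
    obtain ⟨W, hW, h1, h2⟩ := hl a' b' hF this.1 this.2
    exact ⟨W, hW, hW.comp_subset hF.toIsComp hF.mem_left h1 hxF, h2⟩

theorem IsPiece.of_Iic (h : IsPiece W (A ∩ Iic a)) (hA : IsClosed A) (ha : a ∉ W) :
    IsPiece W A := by
  refine ⟨h.1.trans inter_subset_left, h.2.1, ?_⟩
  have : A \ W = ((A ∩ Iic a) \ W) ∪ (A ∩ Ici a) := by
    ext x
    have m1 : x ∈ W → x ≤ a := fun k => (h.1 k).2
    have m2 : x ∈ W → x ≠ a := fun k e => ha (e ▸ k)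
    simp only [Set.mem_sdiff, mem_union, mem_inter_iff, mem_Iic, mem_Ici]
    constructor
    · rintro ⟨h1, h2⟩
      rcases le_total x a with k | k <;> tauto
    · rintro (h | h)
      · tauto
      · exact ⟨h.1, fun k => m2 k (le_antisymm (m1 k) h.2)⟩
  rw [this]; exact h.2.2.union (hA.inter isClosed_Ici)

/-- If pieces to the left of a flippable component embed near `b`, so do pieces to its right. -/
theorem embNear_right_of_flip (hA : IsCompact A) (hF : Fat A a' b') (hfl : Flip A a' b')
    (hu : u < a') (hl : ∀ V, IsPiece V A → V ⊆ Ioo u a' → EmbNear V B b) :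
    ∃ t, b' < t ∧ ∀ V, IsPiece V A → V ⊆ Ioo b' t → EmbNear V B b := by
  obtain ⟨U, R, f, hU, haU, hR, hbR, hf, hfa, hUs, -⟩ :=
    LGerm.shrink hfl hA hA.neg hF.lgap hF.rgap.neg hu (v := -b' - 1) (by linarith)
  have cU := hU.isCompact (hA.inter_right isClosed_Iic)
  obtain ⟨ε, hε, hεR⟩ := hR.exists_Ioo hbR
  refine ⟨b' + ε, by linarith, fun V hV hVt => ?_⟩
  have hVR : -V ⊆ R := fun x hx => by
    have hxV := hVt (show -x ∈ V from hx)
    exact hεR x ⟨hV.1 hx, by show x ≤ -b'; linarith [hxV.1]⟩ (by linarith [hxV.2])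
      (by linarith [hxV.1])
  have pV : IsPiece (-V) R := hV.neg.of_subset hVR (hR.1.trans inter_subset_left) hR.2.1
  have p1 := hf.isPiece_preimage cU pV
  -- The pullback of `-V` under the flip avoids `a'` because `V` avoids `b'`. It is therefore a
  -- clopen part of all of `A`, strictly left of `a'`, where `hl` applies.
  have hna : a' ∉ U ∩ f ⁻¹' (-V) := fun h => by
    have : b' ∈ V := by have := h.2; rw [mem_preimage, hfa] at this; simpa using this
    exact absurd (hVt this).1 (lt_irrefl _)
  have p2 := (p1.trans hU).of_Iic hA.isClosed hna
  refine EmbNear.of_iso (hl _ p2 fun x hx => ?_) (p2.isCompact hA)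
    (Iso.trans ⟨f, hf.preimage hVR⟩ (iso_of_neg V))
  exact ⟨(hUs hx.1).1, lt_of_le_of_ne (hUs hx.1).2 fun e => hna (e ▸ hx)⟩

/-- Induction over the fat components `[a', b']` in `(u, a)`. Pieces to the left of `a'` embed by
induction, and flippability carries this over to pieces right of `b'`. A piece containing the
component is split in two: a neighbourhood of `[a', b']`, sent onto a neighbourhood of a component
of `B` near `b` that `Below` provides, and a remainder avoiding `a'`. -/
theorem embNear_of_below (hBM : BlockModel B₀) (hA : Good B₀ A) (hB : Good B₀ B) (hb : Fat B b d)
    (hl : ∀ a' b', Fat A a' b' → u < a' → a' < a → Flip A a' b' ∧ Below A a' B b) :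
    ∀ V, IsPiece V A → V ⊆ Ioo u a → EmbNear V B b := by
  refine embNear_of_loc hBM hA hB hb fun a₀ b₀ hF₀ h₀ h₀' => ?_
  suffices ∀ a' b', Fat A a' b' → (u < a' → a' < a → LocEmbNear A a' B b) from
    this a₀ b₀ hF₀ h₀ h₀'
  refine hA.induct (P := fun a' => u < a' → a' < a → LocEmbNear A a' B b) ?_
  rintro a' b' hF ⟨u₁, hu₁, IH⟩ hua haa
  have cA := hA.compact.isClosed
  obtain ⟨hfl, hbel⟩ := hl a' b' hF hua haa
  have hm : max u u₁ < a' := max_lt hua hu₁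
  have stepL : ∀ V, IsPiece V A → V ⊆ Ioo (max u u₁) a' → EmbNear V B b :=
    embNear_of_loc hBM hA hB hb fun p q hpq h1 h2 =>
      IH p q hpq ((le_max_right _ _).trans_lt h1) h2 ((le_max_left _ _).trans_lt h1) (h2.trans haa)
  obtain ⟨t₀, ht₀, stepR⟩ := embNear_right_of_flip hA.compact hF hfl hm stepL
  obtain ⟨s, hs1, hs2, hs3⟩ := hF.lgap _ hm
  obtain ⟨t, ht1, ht2, ht3⟩ := hF.rgap _ ht₀
  -- A piece missing `a'` misses the whole component, so it splits into a left and a right part.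
  have notin : ∀ V, IsPiece V A → V ⊆ Ioo s t → a' ∉ V → EmbNear V B b := by
    intro V hV hVs hna
    have p1 : IsPiece (V ∩ Iio a') A := (isPiece_Iio hV.2.1 hna).trans hV
    have p2 : IsPiece (V ∩ Ioi a') A := (isPiece_Ioi hV.2.1 hna).trans hV
    have e : V = V ∩ Iio a' ∪ V ∩ Ioi a' := by
      rw [← inter_union_distrib_left, Iio_union_Ioi]
      ext x; simp only [mem_inter_iff, mem_compl_iff, mem_singleton_iff]
      exact ⟨fun h => ⟨h, fun k => hna (k ▸ h)⟩, fun h => h.1⟩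
    rw [e]
    refine (stepL _ p1 fun x hx => ⟨hs1.trans (hVs hx.1).1, hx.2⟩).union hB.compact p1.2.1 p2.2.1
      (disjoint_left.2 fun x hx hx' => lt_asymm (mem_Iio.1 hx.2) (mem_Ioi.1 hx'.2))
      (stepR _ p2 fun x hx => ⟨?_, (hVs hx.1).2.trans ht2⟩)
    by_contra! hxb
    exact hna (hV.comp_subset hF.toIsComp ⟨le_of_lt hx.2, hxb⟩ hx.1 hF.mem_left)
  refine ⟨A ∩ Ioo s t, isPiece_Ioo cA hs3 ht3, ⟨hF.left_mem, hs2, hF.lt.trans ht1⟩, ?_⟩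
  intro V hV hVst
  have hVs : V ⊆ Ioo s t := hVst.trans inter_subset_right
  by_cases haV : a' ∈ V
  swap
  · exact notin V hV hVs haV
  intro v hv
  obtain ⟨a'', b'', hF', hv1, hv2, hfl', hgerm⟩ := hbel v hv
  obtain ⟨w, hw1, hw2, hw3⟩ : ∃ w, b'' < w ∧ w < b ∧ w ∉ B := by
    obtain ⟨w, h1, h2, h3⟩ := hb.lgap a'' hv2
    exact ⟨w, gt_of_notMem h3 hF'.sub h1, h2, h3⟩
  have hbV : b' ∈ V := hV.comp_subset hF.toIsComp hF.mem_left haV (right_mem_Icc.2 hF.le)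
  obtain ⟨ε, hε, hεV⟩ := hV.exists_Ioo haV
  obtain ⟨δ, hδ, hδV⟩ := hV.exists_Ioo hbV
  -- The right germ at `b'` is the left germ at `a'`, hence the left germ of `B` at `a''`, hence the
  -- right germ at `b''`: both components are flippable.
  have hgermR : LGerm (-A) (-b') (-B) (-b'') :=
    (LGerm.symm hfl hA.compact).trans (hgerm.trans hfl' hA.compact hB.compact) hA.compact.neg
      hA.compact
  obtain ⟨U, U', hU, hU', haU, haU', hUs, hUs', hiso⟩ := exists_embOn_nhd hA.compact hB.compact
    hF.toIsComp hF'.toIsComp hF.lt hF'.lt hgerm hgermR (s := a' - ε) (t := b' + δ)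
    (by linarith) (by linarith) hv1 hw1
  have hUV : U ⊆ V := by
    intro x hx
    have hx' := hUs hx
    rcases lt_or_ge x a' with h | h
    · exact hεV x (hU.1 hx) hx'.1 (by linarith)
    · rcases le_or_gt x b' with h' | h'
      · exact hV.comp_subset hF.toIsComp hF.mem_left haV ⟨h, h'⟩
      · exact hδV x (hU.1 hx) (by linarith) hx'.2
  have hD := hV.diff hU
  -- The remainder is embedded between the gap point `w` and `b`, clear of the copy of the
  -- neighbourhood.
  obtain ⟨W, hW, hWw, hisoW⟩ := notin (V \ U) hD (sdiff_subset.trans hVs)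
    (fun h => h.2 (haU hF.mem_left)) w hw2
  refine ⟨U' ∪ W, hU'.union hW, union_subset (fun x hx => ⟨(hUs' hx).1, (hUs' hx).2.trans hw2⟩)
    fun x hx => ⟨?_, (hWw hx).2⟩, ?_⟩
  · have := (hWw hx).1
    have := hF'.lt
    linarith
  · rw [← union_sdiff_cancel hUV]
    exact hiso.union hisoW hU.2.1 hD.2.1 disjoint_sdiff_right
      (disjoint_left.2 fun x hx hx' => lt_asymm (hUs' hx).2 (hWw hx').1)

end TameReal

/-! ### Back and forth, and comparability of germs -/

namespace TameReal
open Set Filter Topology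
open scoped Pointwise

variable {B₀ A B C W V U X Y Z T : Set ℝ} {f g : ℝ → ℝ} {a b c d u v x y a' b' : ℝ}

/-- A homeomorphism between a piece of `A` in `(u, a)` and a piece of `B` in `(v, b)`. -/
structure PartialMatch (A : Set ℝ) (u a : ℝ) (B : Set ℝ) (v b : ℝ) where
  dom : Set ℝ
  cod : Set ℝ
  map : ℝ → ℝ
  dom_piece : IsPiece dom A
  cod_piece : IsPiece cod B
  dom_sub : dom ⊆ Ioo u a
  cod_sub : cod ⊆ Ioo v b
  embOn : EmbOn map dom cod

/-- `q` extends `p`. -/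
def PartialMatch.Le (p q : PartialMatch A u a B v b) : Prop :=
  p.dom ⊆ q.dom ∧ p.cod ⊆ q.cod ∧ ∀ x ∈ p.dom, q.map x = p.map x

theorem PartialMatch.Le.trans {p q r : PartialMatch A u a B v b} (h : p.Le q) (h' : q.Le r) :
    p.Le r :=
  ⟨h.1.trans h'.1, h.2.1.trans h'.2.1, fun x hx => (h'.2.2 x (h.1 hx)).trans (h.2.2 x hx)⟩

/-- Only the part of `W` outside the old domain is new; it is sent beyond `w`, an upper bound of the
old codomain that is still below `b`. -/
theorem PartialMatch.exists_forth (hB : IsCompact B) (hvb : v < b)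
    (hAB : ∀ W, IsPiece W A → W ⊆ Ioo u a → EmbNear W B b)
    (p : PartialMatch A u a B v b) (hW : IsPiece W A) (hWu : W ⊆ Ioo u a) :
    ∃ q : PartialMatch A u a B v b, p.Le q ∧ W ⊆ q.dom := by
  obtain ⟨w, hvw, hwb, hw⟩ := exists_lt_of_compact (p.cod_piece.isCompact hB)
    (fun x hx => (p.cod_sub hx).2) hvb
  have hD := hW.diff p.dom_piece
  obtain ⟨W', hW', hWs, g, hg⟩ := hAB _ hD (sdiff_subset.trans hWu) w hwb
  obtain ⟨F, hF, hF1, -⟩ := p.embOn.glue_disjoint hg p.dom_piece.2.1 hD.2.1 disjoint_sdiff_right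
    (disjoint_left.2 fun x hx hx' => absurd (hw hx) (not_le.2 (hWs hx').1))
  exact ⟨⟨_, _, F, p.dom_piece.union hD, p.cod_piece.union hW',
    union_subset p.dom_sub (sdiff_subset.trans hWu),
    union_subset p.cod_sub fun x hx => ⟨hvw.trans_lt (hWs hx).1, (hWs hx).2⟩, hF⟩,
    ⟨subset_union_left, subset_union_left, hF1⟩, by
      simp only [union_sdiff_self]; exact subset_union_right⟩

theorem PartialMatch.exists_back (hA : IsCompact A) (hua : u < a)
    (hBA : ∀ W, IsPiece W B → W ⊆ Ioo v b → EmbNear W A a)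
    (p : PartialMatch A u a B v b) (hB : IsCompact B) (hW : IsPiece W B) (hWu : W ⊆ Ioo v b) :
    ∃ q : PartialMatch A u a B v b, p.Le q ∧ W ⊆ q.cod := by
  obtain ⟨g, hg, h1, h2⟩ := p.embOn.exists_inv (p.dom_piece.isCompact hA)
  obtain ⟨q, hq, hqW⟩ := PartialMatch.exists_forth (A := B) (B := A) hA hua hBA
    ⟨_, _, g, p.cod_piece, p.dom_piece, p.cod_sub, p.dom_sub, hg⟩ hW hWu
  obtain ⟨k, hk, k1, k2⟩ := q.embOn.exists_inv (q.dom_piece.isCompact hB)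
  refine ⟨⟨_, _, k, q.cod_piece, q.dom_piece, q.cod_sub, q.dom_sub, hk⟩, ⟨hq.2.1, hq.1, ?_⟩, hqW⟩
  intro x hx
  have e : q.map (p.map x) = x := (hq.2.2 _ (p.embOn.mem hx)).trans (h1 x hx)
  show k x = p.map x
  rw [← e, k1 _ (hq.1 (p.embOn.mem hx)), e]

theorem LGap.exists_seq (h : LGap A a) (hu : u < a) :
    ∃ c : ℕ → ℝ, (∀ n, u < c n ∧ c n < a ∧ c n ∉ A) ∧ ∀ z < a, ∃ n, z < c n := by
  have : ∀ n : ℕ, ∃ c, max u (a - 1 / (n + 1)) < c ∧ c < a ∧ c ∉ A := fun n =>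
    h _ (max_lt hu (by have : (0 : ℝ) < 1 / (n + 1) := by positivity
                       linarith))
  choose c hc using this
  refine ⟨c, fun n => ⟨(le_max_left _ _).trans_lt (hc n).1, (hc n).2⟩, fun z hz => ?_⟩
  obtain ⟨n, hn⟩ := exists_nat_one_div_lt (sub_pos.2 hz)
  refine ⟨n, lt_trans ?_ ((le_max_right _ _).trans_lt (hc n).1)⟩
  linarith

/-- Back and forth: if pieces near `a` embed near `b` and conversely, the germs agree. -/
theorem lGerm_of_embNear (hA : IsCompact A) (hB : IsCompact B) (ha : a ∈ A) (hb : b ∈ B)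
    (gA : LGap A a) (gB : LGap B b) (hua : u < a) (hvb : v < b) (hu : u ∉ A) (hv : v ∉ B)
    (hAB : ∀ W, IsPiece W A → W ⊆ Ioo u a → EmbNear W B b)
    (hBA : ∀ W, IsPiece W B → W ⊆ Ioo v b → EmbNear W A a) : LGerm A a B b := by
  classical
  obtain ⟨c, hc, hc'⟩ := gA.exists_seq hua
  obtain ⟨d, hd, hd'⟩ := gB.exists_seq hvb
  have step : ∀ (n : ℕ) (p : PartialMatch A u a B v b), ∃ q : PartialMatch A u a B v b,
      p.Le q ∧ A ∩ Ioo u (c n) ⊆ q.dom ∧ B ∩ Ioo v (d n) ⊆ q.cod := by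
    intro n p
    obtain ⟨q, hq, hq'⟩ := p.exists_forth hB hvb hAB (isPiece_Ioo hA.isClosed hu (hc n).2.2)
      (inter_subset_right.trans (Ioo_subset_Ioo_right (hc n).2.1.le))
    obtain ⟨r, hr, hr'⟩ := q.exists_back hA hua hBA hB (isPiece_Ioo hB.isClosed hv (hd n).2.2)
      (inter_subset_right.trans (Ioo_subset_Ioo_right (hd n).2.1.le))
    exact ⟨r, hq.trans hr, hq'.trans hr.1, hr'⟩
  choose F hF1 hF2 hF3 using step
  let p₀ : PartialMatch A u a B v b := ⟨∅, ∅, id, .empty hA.isClosed, .empty hB.isClosed,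
    empty_subset _, empty_subset _, embOn_id ∅⟩
  let p : ℕ → PartialMatch A u a B v b := fun n => Nat.rec p₀ (fun n q => F n q) n
  have hp1 : ∀ n, (p n).Le (p (n + 1)) := fun n => hF1 n (p n)
  have hle : ∀ {m n}, m ≤ n → (p m).Le (p n) := by
    intro m n hmn
    induction n, hmn using Nat.le_induction with
    | base => exact ⟨Subset.rfl, Subset.rfl, fun _ _ => rfl⟩
    | succ n _ ih => exact ih.trans (hp1 n)
  have hdom : ∀ x ∈ A, u < x → x < a → ∃ n, x ∈ (p n).dom := fun x hx h1 h2 => by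
    obtain ⟨n, hn⟩ := hc' x h2
    exact ⟨n + 1, hF2 n (p n) ⟨hx, h1, hn⟩⟩
  have hcod : ∀ n, ∀ y ∈ B, v < y → y < d n → y ∈ (p (n + 1)).cod := fun n y hy h1 h2 =>
    hF3 n (p n) ⟨hy, h1, h2⟩
  -- The union of the partial maps. No domain contains `a`, so the default value `b` makes `H a =
  -- b`.
  set H : ℝ → ℝ := fun x => if h : ∃ n, x ∈ (p n).dom then (p (Nat.find h)).map x else b with hH
  have Hn : ∀ n, ∀ x ∈ (p n).dom, H x = (p n).map x := fun n x hx => by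
    have h : ∃ n, x ∈ (p n).dom := ⟨n, hx⟩
    simp only [hH, dif_pos h]
    exact ((hle (Nat.find_min' h hx)).2.2 x (Nat.find_spec h)).symm
  have Ha : H a = b := dif_neg fun ⟨n, hn⟩ => lt_irrefl a ((p n).dom_sub hn).2
  have Hlt : ∀ x ∈ A, u < x → x < a → H x ∈ B ∧ v < H x ∧ H x < b := fun x hx h1 h2 => by
    obtain ⟨n, hn⟩ := hdom x hx h1 h2
    rw [Hn n x hn]
    have := (p n).embOn.mem hn
    exact ⟨(p n).cod_piece.1 this, (p n).cod_sub this⟩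
  -- Points whose image is below `d n` lie in the closed set `(p (n + 1)).dom`, which misses `a`.
  -- This gives continuity of `H` at `a`.
  have Hback : ∀ n, ∀ x ∈ A, u < x → x < a → H x < d n → x ∈ (p (n + 1)).dom := by
    intro n x hx h1 h2 h3
    obtain ⟨k1, k2, k3⟩ := Hlt x hx h1 h2
    obtain ⟨z, hz, hzx⟩ := (p (n + 1)).embOn.2.surjOn (hcod n _ k1 k2 h3)
    obtain ⟨m, hm⟩ := hdom x hx h1 h2
    have l1 := hle (le_max_left m (n + 1))
    have l2 := hle (le_max_right m (n + 1))
    have : z = x := (p (max m (n + 1))).embOn.2.injOn (l2.1 hz) (l1.1 hm) (by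
      rw [l2.2.2 z hz, hzx, Hn m x hm, l1.2.2 x hm])
    exact this ▸ hz
  have e : ∀ {S : Set ℝ} {r s : ℝ}, S ∩ Iic s ∩ Ioi r = S ∩ Ioc r s := by
    intro S r s; ext x; simp only [mem_inter_iff, mem_Iic, mem_Ioi, mem_Ioc]; tauto
  refine ⟨A ∩ Iic a ∩ Ioi u, B ∩ Iic b ∩ Ioi v, H,
    isPiece_Ioi (hA.isClosed.inter isClosed_Iic) fun h => hu h.1, ⟨⟨ha, self_mem_Iic⟩, hua⟩,
    isPiece_Ioi (hB.isClosed.inter isClosed_Iic) fun h => hv h.1, ⟨⟨hb, self_mem_Iic⟩, hvb⟩,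
    ?_, Ha⟩
  rw [e, e]
  refine ⟨?_, ?_, ?_, ?_⟩
  · rintro x ⟨hx, hxu, hxa⟩
    rcases hxa.eq_or_lt with rfl | hxa
    · rw [ContinuousWithinAt, Ha, Metric.tendsto_nhds]
      intro ε hε
      obtain ⟨n, hn⟩ := hd' (b - ε) (by linarith)
      have hnx : x ∉ (p (n + 1)).dom := fun h => lt_irrefl x ((p (n + 1)).dom_sub h).2
      filter_upwards [self_mem_nhdsWithin, nhdsWithin_le_nhds
        ((p (n + 1)).dom_piece.2.1.isOpen_compl.mem_nhds hnx)] with z hz hz'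
      rcases hz.2.2.eq_or_lt with rfl | hlt
      · rw [Ha]; simpa using hε
      · have h1 := Hlt z hz.1 hz.2.1 hlt
        have h2 : d n ≤ H z := by
          by_contra! h
          exact hz' (Hback n z hz.1 hz.2.1 hlt h)
        rw [Real.dist_eq, abs_lt]
        constructor <;> linarith [h1.2.2]
    · obtain ⟨n, hn⟩ := hdom x hx hxu hxa
      have h1 : ContinuousWithinAt H (p n).dom x :=
        ((p n).embOn.1.congr (Hn n)) x hn
      refine h1.mono_of_mem_nhdsWithin ?_
      filter_upwards [self_mem_nhdsWithin, nhdsWithin_le_nhds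
        ((p n).dom_piece.eventually_mem hn)] with z hz hz'
      exact hz' hz.1
  · rintro x ⟨hx, hxu, hxa⟩
    rcases hxa.eq_or_lt with rfl | hxa
    · rw [Ha]; exact ⟨hb, hvb, le_rfl⟩
    · have := Hlt x hx hxu hxa
      exact ⟨this.1, this.2.1, this.2.2.le⟩
  · rintro x ⟨hx, hxu, hxa⟩ y ⟨hy, hyu, hya⟩ hxy
    rcases hxa.eq_or_lt with rfl | hxa <;> rcases hya.eq_or_lt with rfl | hya
    · rfl
    · have := (Hlt y hy hyu hya).2.2
      rw [← hxy, Ha] at this; exact absurd this (lt_irrefl _)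
    · have := (Hlt x hx hxu hxa).2.2
      rw [hxy, Ha] at this; exact absurd this (lt_irrefl _)
    · obtain ⟨m, hm⟩ := hdom x hx hxu hxa
      obtain ⟨n, hn⟩ := hdom y hy hyu hya
      have l1 := (hle (le_max_left m n)).1 hm
      have l2 := (hle (le_max_right m n)).1 hn
      exact (p _).embOn.2.injOn l1 l2 (by rw [← Hn _ x l1, ← Hn _ y l2, hxy])
  · rintro y ⟨hy, hyv, hyb⟩
    rcases hyb.eq_or_lt with rfl | hyb
    · exact ⟨a, ⟨ha, hua, le_rfl⟩, Ha⟩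
    · obtain ⟨n, hn⟩ := hd' y hyb
      obtain ⟨x, hx, hxy⟩ := (p (n + 1)).embOn.2.surjOn (hcod n y hy hyv hn)
      have := (p (n + 1)).dom_sub hx
      exact ⟨x, ⟨(p (n + 1)).dom_piece.1 hx, this.1, this.2.le⟩, (Hn (n + 1) x hx).trans hxy⟩

/-- A good set with at most one non-flippable component. -/
structure Good1 (B₀ A : Set ℝ) : Prop extends Good B₀ A where
  flip : ∀ a b a' b', Fat A a b → Fat A a' b' → ¬ Flip A a b → ¬ Flip A a' b' → a = a'

theorem Good1.neg (h : Good1 B₀ A) : Good1 B₀ (-A) where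
  toGood := h.toGood.neg
  flip := fun a b a' b' h1 h2 n1 n2 => by
    have k1 : Fat A (-b) (-a) := by simpa using h1.neg
    have k2 : Fat A (-b') (-a') := by simpa using h2.neg
    have m1 : ¬ Flip A (-b) (-a) := fun k => n1 (by simpa using k.neg h.compact)
    have m2 : ¬ Flip A (-b') (-a') := fun k => n2 (by simpa using k.neg h.compact)
    have e := h.flip _ _ _ _ k1 k2 m1 m2
    have := (k1.toIsComp.eq_of_mem k2.toIsComp k1.mem_left (by rw [e]; exact k2.mem_left)).2
    linarith

/-- At most one component fails to be flippable; if it lies left of `a`, take `u` between the two.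
-/
theorem Good1.eventually_flip (h : Good1 B₀ A) (hF : Fat A a b) :
    ∃ u < a, u ∉ A ∧ ∀ a' b', Fat A a' b' → u < a' → a' < a → Flip A a' b' := by
  by_cases hex : ∃ a' b', Fat A a' b' ∧ a' < a ∧ ¬ Flip A a' b'
  · obtain ⟨a₁, b₁, h1, h2, h3⟩ := hex
    obtain ⟨c, hc1, hc2, hc3⟩ := hF.lgap a₁ h2
    refine ⟨c, hc2, hc3, fun a' b' h1' hca ha => ?_⟩
    by_contra hn
    have := h.flip _ _ _ _ h1 h1' h3 hn
    linarith
  · push Not at hex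
    obtain ⟨c, hc1, hc2, hc3⟩ := hF.lgap (a - 1) (by linarith)
    exact ⟨c, hc2, hc3, fun a' b' h1' _ ha => hex a' b' h1' ha⟩

/-- Double induction on the two components. If all three alternatives fail, then close to `a` and
`b` no flippable component has the opposite germ. The induction hypotheses then force every fat
component near `a` to be `Below` `b` and conversely, so pieces embed in both directions and the
back-and-forth yields equal germs. -/
theorem germ_trichotomy (hBM : BlockModel B₀) (hA : Good1 B₀ A) (hB : Good1 B₀ B) (ha : Fat A a a')
    (hb : Fat B b b') : LGerm A a B b ∨ Below A a B b ∨ Below B b A a := by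
  suffices ∀ a a', Fat A a a' →
      ∀ b b', Fat B b b' → LGerm A a B b ∨ Below A a B b ∨ Below B b A a from
    this a a' ha b b' hb
  refine hA.induct (P := fun a =>
    ∀ b b', Fat B b b' → LGerm A a B b ∨ Below A a B b ∨ Below B b A a) ?_
  rintro a a' ha ⟨u₁, hu₁, IHa⟩
  refine hB.induct (P := fun b => LGerm A a B b ∨ Below A a B b ∨ Below B b A a) ?_
  rintro b b' hb ⟨v₁, hv₁, IHb⟩
  by_contra! hcon
  obtain ⟨hn, hnA, hnB⟩ := hcon
  simp only [Below] at hnA hnB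
  push Not at hnA hnB
  obtain ⟨v₂, hv₂, hv₂'⟩ := hnA
  obtain ⟨u₂, hu₂, hu₂'⟩ := hnB
  obtain ⟨u₃, hu₃, -, hu₃'⟩ := hA.eventually_flip ha
  obtain ⟨v₃, hv₃, -, hv₃'⟩ := hB.eventually_flip hb
  obtain ⟨u, h1, hua, huA⟩ := ha.lgap (max u₁ (max u₂ u₃)) (max_lt hu₁ (max_lt hu₂ hu₃))
  obtain ⟨v, h2, hvb, hvB⟩ := hb.lgap (max v₁ (max v₂ v₃)) (max_lt hv₁ (max_lt hv₂ hv₃))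
  simp only [max_lt_iff] at h1 h2
  have cA := hA.compact
  have cB := hB.compact
  have keyA : ∀ p q, Fat A p q → u < p → p < a → Flip A p q ∧ Below A p B b := by
    intro p q hpq hup hpa
    have hfl := hu₃' p q hpq (h1.2.2.trans hup) hpa
    refine ⟨hfl, ?_⟩
    rcases IHa p q hpq (h1.1.trans hup) hpa b b' hb with h | h | h
    -- Equality of the germs at `p` and `b`, or an occurrence of the germ at `b` below `p`, would
    -- put the germ at `b` at a flippable component close to `a`.
    · exact absurd (h.symm cA) (hu₂' p q hpq (h1.2.1.trans hup) hpa hfl)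
    · exact h
    · obtain ⟨p', q', k1, k2, k3, k4, k5⟩ := h u hup
      exact absurd k5 (hu₂' p' q' k1 (h1.2.1.trans k2) (k3.trans hpa) k4)
  have keyB : ∀ p q, Fat B p q → v < p → p < b → Flip B p q ∧ Below B p A a := by
    intro p q hpq hvp hpb
    have hfl := hv₃' p q hpq (h2.2.2.trans hvp) hpb
    refine ⟨hfl, ?_⟩
    rcases IHb p q hpq (h2.1.trans hvp) hpb with h | h | h
    · exact absurd h (hv₂' p q hpq (h2.2.1.trans hvp) hpb hfl)
    · obtain ⟨p', q', k1, k2, k3, k4, k5⟩ := h v hvp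
      exact absurd k5 (hv₂' p' q' k1 (h2.2.1.trans k2) (k3.trans hpb) k4)
    · exact h
  exact hn (lGerm_of_embNear cA cB ha.left_mem hb.left_mem ha.lgap hb.lgap hua hvb huA hvB
    (embNear_of_below hBM hA.toGood hB.toGood hb keyA)
    (embNear_of_below hBM hB.toGood hA.toGood ha keyB))

end TameReal

/-! ### Counting germs, local types and homeomorphism types -/

namespace TameReal
open Set Filter Topology
open scoped Pointwise

variable {B₀ A B C W V U X Y Z T R : Set ℝ} {f g : ℝ → ℝ} {a b c d u v x y a' b' : ℝ}

open Cardinal in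
/-- A type with a total relation all of whose initial segments are countable has at most `ℵ₁`
elements. -/
theorem mk_le_aleph_one_of_total {Q : Type} (r : Q → Q → Prop) (ht : ∀ x y, r x y ∨ r y x)
    (hc : ∀ y, {x | r x y}.Countable) : #Q ≤ ℵ₁ := by
  by_contra! hlt
  -- The initial segments of `ℵ₁` many points cover only `ℵ₁` points. For `x` outside them, totality
  -- puts all of `S` into the countable initial segment of `x`.
  obtain ⟨S, hS⟩ := le_mk_iff_exists_set.1 hlt.le
  have h1 : #(⋃ y ∈ S, {x | r x y} : Set Q) ≤ ℵ₁ := by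
    refine (mk_biUnion_le _ _).trans ?_
    rw [hS]
    have h0 : (⨆ y : S, #{x | r x y.1}) ≤ ℵ₀ := ciSup_le' fun y => (hc y.1).le_aleph0
    exact (mul_le_mul' le_rfl h0).trans (by simp)
  have h2 : ∃ x, x ∉ ⋃ y ∈ S, {x | r x y} := by
    by_contra! h
    rw [eq_univ_of_forall h, mk_univ] at h1
    exact absurd h1 (not_le.2 hlt)
  obtain ⟨x, hx⟩ := h2
  have h3 : S ⊆ {y | r y x} := fun y hy => (ht y x).resolve_right fun h => hx (by
    simp only [mem_iUnion]; exact ⟨y, hy, h⟩)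
  have h4 := ((hc x).mono h3).le_aleph0
  rw [hS] at h4
  exact absurd h4 (not_le.2 aleph0_lt_aleph_one)

theorem countable_fat_left (A : Set ℝ) : {a | ∃ b, Fat A a b}.Countable := by
  choose! r hr using fun a (h : a ∈ {a | ∃ b, Fat A a b}) => h
  refine Set.PairwiseDisjoint.countable_of_Ioo (y := r) ?_ fun a ha => (hr a ha).lt
  intro a ha b hb hab
  refine disjoint_left.2 fun x hx hx' => hab ?_
  exact ((hr a ha).eq_of_mem (hr b hb).toIsComp (Ioo_subset_Icc_self hx)
    (Ioo_subset_Icc_self hx')).1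

/-- Left ends of the components counted by `Fat` in sets of type `Good1 B₀`. -/
abbrev End (B₀ : Set ℝ) : Type := {p : Set ℝ × ℝ // Good1 B₀ p.1 ∧ ∃ b, Fat p.1 p.2 b}

/-- Equality of germs. -/
def endSetoid (B₀ : Set ℝ) : Setoid (End B₀) where
  r p q := LGerm p.1.1 p.1.2 q.1.1 q.1.2
  iseqv :=
    ⟨fun p => LGerm.refl p.2.1.compact.isClosed p.2.2.choose_spec.left_mem,
      fun {p _} h => h.symm p.2.1.compact,
      fun {p q _} h h' => h.trans h' p.2.1.compact q.2.1.compact⟩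

-- Totality is `germ_trichotomy`. All germs below a given one occur at fat components of one and the
-- same set, and these are countable in number.
open Cardinal in
theorem mk_germ_le (hBM : BlockModel B₀) : #(Quotient (endSetoid B₀)) ≤ ℵ₁ := by
  refine mk_le_aleph_one_of_total
    (fun x y => x = y ∨ Below x.out.1.1 x.out.1.2 y.out.1.1 y.out.1.2) ?_ ?_
  · intro x y
    obtain ⟨h1, a', h2⟩ := x.out.2
    obtain ⟨h3, b', h4⟩ := y.out.2
    rcases germ_trichotomy hBM h1 h3 h2 h4 with h | h | h
    · exact Or.inl (Or.inl (by
        rw [← x.out_eq, ← y.out_eq]; exact Quotient.sound (s := endSetoid B₀) h))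
    · exact Or.inl (Or.inr h)
    · exact Or.inr (Or.inr h)
  · intro y
    have e : {x | x = y ∨ Below x.out.1.1 x.out.1.2 y.out.1.1 y.out.1.2} =
      {y} ∪ {x | Below x.out.1.1 x.out.1.2 y.out.1.1 y.out.1.2} := by ext; simp
    rw [e]
    refine (countable_singleton y).union ?_
    have : Countable {a | ∃ b, Fat y.out.1.1 a b} := countable_fat_left _
    refine (countable_range fun a : {a | ∃ b, Fat y.out.1.1 a b} =>
      Quotient.mk (endSetoid B₀) ⟨(y.out.1.1, a.1), y.out.2.1, a.2⟩).mono ?_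
    intro x hx
    obtain ⟨a', b', h1, -, -, -, h5⟩ := hx (y.out.1.2 - 1) (by linarith)
    refine ⟨⟨a', b', h1⟩, ?_⟩
    rw [← x.out_eq]
    exact Quotient.sound (s := endSetoid B₀) (h5.symm x.out.2.1.compact)

open Cardinal in
/-- Up to homeomorphism of neighbourhoods there are at most `ℵ₁` components of sets of type
`Good1 B₀`. -/
theorem exists_representatives (hBM : BlockModel B₀) : ∃ S : Set (Set ℝ), #S ≤ ℵ₁ ∧
    (∀ R ∈ S, Good1 B₀ R) ∧ ∀ A, Good1 B₀ A → ∀ a b, Fat A a b →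
      ∃ R ∈ S, ∃ a' b', Fat R a' b' ∧ LGerm A a R a' ∧ LGerm (-A) (-b) (-R) (-b') := by
  let X := {p : Set ℝ × ℝ × ℝ // Good1 B₀ p.1 ∧ Fat p.1 p.2.1 p.2.2}
  let φ : X → Quotient (endSetoid B₀) × Quotient (endSetoid B₀) := fun p =>
    (Quotient.mk _ ⟨(p.1.1, p.1.2.1), p.2.1, _, p.2.2⟩,
      Quotient.mk _ ⟨(-p.1.1, -p.1.2.2), p.2.1.neg, _, p.2.2.neg⟩)
  -- One set is chosen for each pair of left and reflected right germs that is realised by a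
  -- component.
  let ψ : range φ → Set ℝ := fun q => q.2.choose.1.1
  refine ⟨range ψ, ?_, ?_, ?_⟩
  · refine mk_range_le.trans ((mk_set_le _).trans ?_)
    rw [← mul_def]
    exact (mul_le_mul' (mk_germ_le hBM) (mk_germ_le hBM)).trans
      (mul_eq_self (aleph0_le_aleph 1)).le
  · rintro _ ⟨q, rfl⟩
    exact q.2.choose.2.1
  · intro A hA a b hab
    let p : X := ⟨(A, a, b), hA, hab⟩
    let q : range φ := ⟨φ p, p, rfl⟩
    have hq : φ q.2.choose = φ p := q.2.choose_spec
    refine ⟨ψ q, ⟨q, rfl⟩, q.2.choose.1.2.1, q.2.choose.1.2.2, q.2.choose.2.2, ?_, ?_⟩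
    · exact LGerm.symm (Quotient.exact (s := endSetoid B₀) (Prod.ext_iff.1 hq).1)
        q.2.choose.2.1.compact
    · exact LGerm.symm (Quotient.exact (s := endSetoid B₀) (Prod.ext_iff.1 hq).2)
        q.2.choose.2.1.compact.neg

/-- Each point of `A` has a piece homeomorphic to a piece of a member of `S`. -/
def LocallyIn (S : Set (Set ℝ)) (A : Set ℝ) : Prop :=
  ∀ x ∈ A, ∃ R ∈ S, ∃ U V, IsPiece U A ∧ x ∈ U ∧ IsPiece V R ∧ Iso U V

theorem LocallyIn.mono {S S' : Set (Set ℝ)} (h : LocallyIn S A) (hS : S ⊆ S') :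
    LocallyIn S' A := fun x hx => by
  obtain ⟨R, hR, h⟩ := h x hx
  exact ⟨R, hS hR, h⟩

-- Block points are modelled in `B₀` itself. At a fat component, agreement of both germs with those
-- of a representative extends to clopen neighbourhoods by `exists_embOn_nhd`.
open Cardinal in
theorem exists_locallyIn (hBM : BlockModel B₀) : ∃ S : Set (Set ℝ), #S ≤ ℵ₁ ∧
    (∀ R ∈ S, IsCompact R) ∧ ∀ A, Good1 B₀ A → LocallyIn S A := by
  obtain ⟨S, h1, h2, h3⟩ := exists_representatives hBM
  refine ⟨insert B₀ S, ?_, ?_, ?_⟩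
  · refine mk_insert_le.trans ((add_le_add h1 one_le_aleph0).trans ?_)
    simp [add_eq_left, aleph0_le_aleph]
  · rintro R (rfl | hR)
    · exact hBM.compact
    · exact (h2 R hR).compact
  · intro A hA x hx
    rcases hA.cover x hx with ⟨W, hW, hxW, hi⟩ | ⟨a, b, hF, hxF⟩
    · exact ⟨B₀, Or.inl rfl, W, B₀, hW, hxW, .refl hBM.compact.isClosed, hi⟩
    · obtain ⟨R, hR, a', b', hF', hl, hr⟩ := h3 A hA a b hF
      obtain ⟨U, V, hU, hV, hU', -, -, -, hi⟩ := exists_embOn_nhd hA.compact (h2 R hR).compact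
        hF.toIsComp hF'.toIsComp hF.lt hF'.lt hl hr (sub_one_lt a) (lt_add_one b)
        (sub_one_lt a') (lt_add_one b')
      exact ⟨R, Or.inr hR, U, V, hU, hU' hxF, hV, hi⟩

/-- By compactness, a clopen part is the trace on `R` of a finite union of members of a countable
basis. -/
theorem countable_pieces (hR : IsCompact R) : {V | IsPiece V R}.Countable := by
  have hb := TopologicalSpace.isBasis_countableBasis ℝ
  refine ((countable_ofPred_finite_subset (TopologicalSpace.countable_countableBasis ℝ)).image
    fun s : Set (Set ℝ) => R ∩ ⋃₀ s).mono ?_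
  intro V hV
  obtain ⟨S, hS, hSU⟩ := hb.open_eq_sUnion hV.2.2.isOpen_compl
  have hVO : V ⊆ (R \ V)ᶜ := fun x hx h => h.2 hx
  obtain ⟨s, hsS, hsf, hs⟩ := (hV.isCompact hR).elim_finite_subcover_image (b := S) (c := id)
    (fun i hi => hb.isOpen (hS hi)) (by simp only [id]; rw [← sUnion_eq_biUnion, ← hSU]; exact hVO)
  refine ⟨s, ⟨hsf, hsS.trans hS⟩, subset_antisymm ?_ ?_⟩
  · rintro x ⟨hxR, t, ht, hxt⟩
    by_contra hxV
    have : x ∈ (R \ V)ᶜ := by rw [hSU]; exact ⟨t, hsS ht, hxt⟩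
    exact this ⟨hxR, hxV⟩
  · intro x hx
    exact ⟨hV.1 hx, by rw [sUnion_eq_biUnion]; exact hs hx⟩

/-- `W` splits into pieces of the homeomorphism types listed. -/
def Coded {ι : Type} (ρ : ι → Set ℝ) : List ι → Set ℝ → Prop
  | [], W => W = ∅
  | i :: l, W => ∃ P, IsPiece P W ∧ Iso P (ρ i) ∧ Coded ρ l (W \ P)

theorem Coded.iso {ι : Type} {ρ : ι → Set ℝ} : ∀ {l : List ι} {V W : Set ℝ}, IsCompact V →
    IsCompact W → Coded ρ l V → Coded ρ l W → Iso V W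
  | [], V, W, _, _, h, h' => by rw [show V = ∅ from h, show W = ∅ from h']; exact .refl _
  | i :: l, V, W, cV, cW, ⟨P, hP, hPi, h⟩, ⟨Q, hQ, hQi, h'⟩ => by
    have e1 : Iso P Q := hPi.trans (hQi.symm (hQ.isCompact cW))
    have e2 := Coded.iso (hP.compl.isCompact cV) (hQ.compl.isCompact cW) h h'
    rw [← union_sdiff_cancel hP.1, ← union_sdiff_cancel hQ.1]
    exact e1.union e2 hP.2.1 hP.2.2 disjoint_sdiff_right disjoint_sdiff_right

theorem Coded.union {ι : Type} {ρ : ι → Set ℝ} : ∀ {l l' : List ι} {V W : Set ℝ},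
    IsClosed V → IsClosed W → Disjoint V W → Coded ρ l V → Coded ρ l' W →
      Coded ρ (l ++ l') (V ∪ W)
  | [], l', V, W, _, _, _, h, h' => by rw [show V = ∅ from h, empty_union]; exact h'
  | i :: l, l', V, W, cV, cW, hd, ⟨P, hP, hPi, h⟩, h' => by
    have hPW : Disjoint P W := hd.mono_left hP.1
    have e : (V ∪ W) \ P = (V \ P) ∪ W := by
      rw [union_sdiff_distrib, hPW.symm.sdiff_eq_left]
    refine ⟨P, ⟨hP.1.trans subset_union_left, hP.2.1, ?_⟩, hPi, ?_⟩
    · rw [e]; exact hP.2.2.union cW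
    · rw [e]; exact Coded.union hP.2.2 cW (hd.mono_left sdiff_subset) h h'

-- By compactness each member of `F` is a finite disjoint union of listed pieces, hence has a code:
-- a finite list over an index type of size at most `ℵ₁`. Sets with the same code are homeomorphic,
-- so the code is injective on `F`.
open Cardinal in
theorem mk_le_of_locallyIn {S F : Set (Set ℝ)} (hS : #S ≤ ℵ₁) (hSc : ∀ R ∈ S, IsCompact R)
    (hFc : ∀ A ∈ F, IsCompact A) (hF : ∀ A ∈ F, LocallyIn S A)
    (hne : ∀ A ∈ F, ∀ B ∈ F, A ≠ B → ¬ Iso A B) : #F ≤ ℵ₁ := by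
  let ι := Σ R : S, {V // IsPiece V R.1}
  have hι : #ι ≤ ℵ₁ := by
    rw [mk_sigma]
    have h0 : ∀ R : S, #{V // IsPiece V R.1} ≤ ℵ₀ := fun R =>
      (countable_pieces (hSc R.1 R.2)).le_aleph0
    calc (Cardinal.sum fun R : S => #{V // IsPiece V R.1}) ≤ Cardinal.sum fun _ : S => ℵ₀ :=
          sum_le_sum _ _ h0
      _ = #S * ℵ₀ := sum_const' _ _
      _ ≤ ℵ₁ * ℵ₀ := mul_le_mul' hS le_rfl
      _ ≤ ℵ₁ := by simp
  let ρ : ι → Set ℝ := fun i => i.2.1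
  have hcode : ∀ A ∈ F, ∃ l, Coded ρ l A := by
    intro A hA
    have cA := hFc A hA
    refine piece_induction (Pr := fun V => ∃ l, Coded ρ l V) cA (.refl cA.isClosed) ⟨[], rfl⟩ ?_ ?_
      A (.refl cA.isClosed) Subset.rfl
    · rintro V W hV hW hd ⟨l, hl⟩ ⟨l', hl'⟩
      exact ⟨l ++ l', hl.union hV.2.1 hW.2.1 hd hl'⟩
    · intro x hx
      obtain ⟨R, hR, U, V, hU, hxU, hV, f, hf⟩ := hF A hA x hx
      refine ⟨U, hU, hxU, fun U' hU' hs => ?_⟩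
      have p1 := hU'.of_subset hs hU.1 hU.2.1
      have p2 := (hf.isPiece_image (hU.isCompact cA) p1).trans hV
      exact ⟨[⟨⟨R, hR⟩, _, p2⟩], U', .refl hU'.2.1, ⟨f, hf.image hs⟩, by simp [Coded]⟩
  choose! code hcode using hcode
  have hinj : Function.Injective fun A : F => code A.1 := by
    intro A B hAB
    by_contra hn
    refine hne A.1 A.2 B.1 B.2 (fun h => hn (Subtype.ext h)) ?_
    refine Coded.iso (hFc _ A.2) (hFc _ B.2) (hcode _ A.2) ?_
    have := hcode _ B.2
    rwa [← show code A.1 = code B.1 from hAB] at this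
  refine (mk_le_of_injective hinj).trans ((mk_list_le_max ι).trans (max_le ?_ hι))
  exact aleph0_le_aleph 1

end TameReal

/-! ### Cantor's isomorphism theorem for coloured orders -/

namespace TameReal

section ColouredCantor

open Order

variable {α β κ : Type} [LinearOrder α] [LinearOrder β]

/-- The colour `k` is dense and unbounded in both directions. -/
structure ColourDense (c : β → κ) (k : κ) : Prop where
  between : ∀ x y, x < y → ∃ z, x < z ∧ z < y ∧ c z = k
  below : ∀ x, ∃ z, z < x ∧ c z = k
  above : ∀ x, ∃ z, x < z ∧ c z = k
  exists_colour : ∃ z, c z = k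

theorem ColourDense.exists_between_finsets {c : β → κ} {k : κ} (h : ColourDense c k)
    (lo hi : Finset β) (hlh : ∀ x ∈ lo, ∀ y ∈ hi, x < y) :
    ∃ m, (∀ x ∈ lo, x < m) ∧ (∀ y ∈ hi, m < y) ∧ c m = k := by
  rcases lo.eq_empty_or_nonempty with rfl | hlo
  · rcases hi.eq_empty_or_nonempty with rfl | hhi
    · obtain ⟨z, hz⟩ := h.exists_colour
      exact ⟨z, by simp, by simp, hz⟩
    · obtain ⟨z, hz, hz'⟩ := h.below (hi.min' hhi)
      exact ⟨z, by simp, fun y hy => hz.trans_le (hi.min'_le y hy), hz'⟩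
  · rcases hi.eq_empty_or_nonempty with rfl | hhi
    · obtain ⟨z, hz, hz'⟩ := h.above (lo.max' hlo)
      exact ⟨z, fun y hy => (lo.le_max' y hy).trans_lt hz, by simp, hz'⟩
    · obtain ⟨z, hz, hz', hz''⟩ := h.between (lo.max' hlo) (hi.min' hhi)
        (hlh _ (lo.max'_mem hlo) _ (hi.min'_mem hhi))
      exact ⟨z, fun y hy => (lo.le_max' y hy).trans_lt hz,
        fun y hy => hz'.trans_le (hi.min'_le y hy), hz''⟩

/-- Finite colour-preserving partial order isomorphisms. -/
abbrev ColPartialIso (c : α → κ) (c' : β → κ) : Type :=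
  { f : Finset (α × β) // (∀ p ∈ f, ∀ q ∈ f, cmp p.1 q.1 = cmp p.2 q.2) ∧ ∀ p ∈ f, c p.1 = c' p.2 }

variable {c : α → κ} {c' : β → κ}

theorem ColPartialIso.exists_across (h : ∀ a, ColourDense c' (c a)) (f : ColPartialIso c c')
    (a : α) : ∃ b : β, (∀ p ∈ f.val, cmp p.1 a = cmp p.2 b) ∧ c a = c' b := by
  by_cases hex : ∃ b, (a, b) ∈ f.val
  · obtain ⟨b, hb⟩ := hex
    exact ⟨b, fun p hp => f.2.1 _ hp _ hb, f.2.2 _ hb⟩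
  have : ∀ x ∈ {p ∈ f.val | p.fst < a}.image Prod.snd,
      ∀ y ∈ {p ∈ f.val | a < p.fst}.image Prod.snd, x < y := by
    intro x hx y hy
    rw [Finset.mem_image] at hx hy
    rcases hx with ⟨p, hp1, rfl⟩
    rcases hy with ⟨q, hq1, rfl⟩
    rw [Finset.mem_filter] at hp1 hq1
    rw [← lt_iff_lt_of_cmp_eq_cmp (f.2.1 _ hp1.1 _ hq1.1)]
    exact lt_trans hp1.right hq1.right
  obtain ⟨b, hb1, hb2, hb3⟩ := (h a).exists_between_finsets _ _ this
  refine ⟨b, ?_, hb3.symm⟩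
  rintro ⟨p1, p2⟩ hp
  have hne : p1 ≠ a := fun he => hex ⟨p2, he ▸ hp⟩
  rcases lt_or_gt_of_ne hne with hl | hr
  · have : p1 < a ∧ p2 < b :=
      ⟨hl, hb1 _ (Finset.mem_image.mpr ⟨(p1, p2), Finset.mem_filter.mpr ⟨hp, hl⟩, rfl⟩)⟩
    rw [← cmp_eq_lt_iff, ← cmp_eq_lt_iff] at this
    exact this.1.trans this.2.symm
  · have : a < p1 ∧ b < p2 :=
      ⟨hr, hb2 _ (Finset.mem_image.mpr ⟨(p1, p2), Finset.mem_filter.mpr ⟨hp, hr⟩, rfl⟩)⟩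
    rw [← cmp_eq_gt_iff, ← cmp_eq_gt_iff] at this
    exact this.1.trans this.2.symm

theorem ColPartialIso.exists_insert_left (h : ∀ a, ColourDense c' (c a)) (f : ColPartialIso c c')
    (a : α) : ∃ g : ColPartialIso c c', (∃ b, (a, b) ∈ g.val) ∧ f ≤ g := by
  classical
  obtain ⟨b, hb, hc⟩ := f.exists_across h a
  refine ⟨⟨insert (a, b) f.val, fun p hp q hq => ?_, fun p hp => ?_⟩,
    ⟨b, Finset.mem_insert_self _ _⟩, Finset.subset_insert _ _⟩
  · rw [Finset.mem_insert] at hp hq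
    rcases hp with (rfl | pf) <;> rcases hq with (rfl | qf)
    · simp only [cmp_self_eq_eq]
    · rw [cmp_eq_cmp_symm]
      exact hb _ qf
    · exact hb _ pf
    · exact f.2.1 _ pf _ qf
  · rw [Finset.mem_insert] at hp
    rcases hp with (rfl | pf)
    · exact hc
    · exact f.2.2 _ pf

/-- The inverse of a partial isomorphism. -/
def ColPartialIso.swap (f : ColPartialIso c c') : ColPartialIso c' c :=
  ⟨f.val.map (Equiv.prodComm α β).toEmbedding, by
    constructor
    · intro p hp q hq
      rw [Finset.mem_map_equiv] at hp hq
      exact (f.2.1 _ hp _ hq).symm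
    · intro p hp
      rw [Finset.mem_map_equiv] at hp
      exact (f.2.2 _ hp).symm⟩

theorem ColPartialIso.mem_swap (f : ColPartialIso c c') {a : α} {b : β} :
    (b, a) ∈ f.swap.val ↔ (a, b) ∈ f.val := by
  rw [swap, Finset.mem_map_equiv]; rfl

theorem ColPartialIso.exists_insert_right (h : ∀ b, ColourDense c (c' b)) (f : ColPartialIso c c')
    (b : β) : ∃ g : ColPartialIso c c', (∃ a, (a, b) ∈ g.val) ∧ f ≤ g := by
  obtain ⟨g, ⟨a, ha⟩, hg⟩ := f.swap.exists_insert_left h b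
  refine ⟨g.swap, ⟨a, g.mem_swap.2 ha⟩, ?_⟩
  rintro ⟨x, y⟩ hxy
  exact g.mem_swap.2 (hg (f.mem_swap.2 hxy))

/-- Coloured version of Cantor's isomorphism theorem. -/
theorem exists_orderIso_of_colourDense [Countable α] [Countable β]
    (h : ∀ a, ColourDense c' (c a)) (h' : ∀ b, ColourDense c (c' b)) :
    ∃ e : α ≃o β, ∀ a, c' (e a) = c a := by
  cases nonempty_encodable α
  cases nonempty_encodable β
  let toCof : α ⊕ β → Cofinal (ColPartialIso c c') := fun p => Sum.recOn p
    (fun a => ⟨{g | ∃ b, (a, b) ∈ g.val}, fun f => f.exists_insert_left h a⟩)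
    (fun b => ⟨{g | ∃ a, (a, b) ∈ g.val}, fun f => f.exists_insert_right h' b⟩)
  let I : Ideal (ColPartialIso c c') := idealOfCofinals ⟨∅, by simp, by simp⟩ toCof
  have hF : ∀ a : α, ∃ b : β, ∃ f ∈ I, (a, b) ∈ f.val := fun a => by
    obtain ⟨f, ⟨b, hb⟩, hf⟩ := cofinal_meets_idealOfCofinals ⟨∅, by simp, by simp⟩ toCof (Sum.inl a)
    exact ⟨b, f, hf, hb⟩
  have hG : ∀ b : β, ∃ a : α, ∃ f ∈ I, (a, b) ∈ f.val := fun b => by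
    obtain ⟨f, ⟨a, hb⟩, hf⟩ := cofinal_meets_idealOfCofinals ⟨∅, by simp, by simp⟩ toCof (Sum.inr b)
    exact ⟨a, f, hf, hb⟩
  choose F hF using hF
  choose G hG using hG
  refine ⟨OrderIso.ofCmpEqCmp F G fun a b => ?_, fun a => ?_⟩
  · obtain ⟨f, hf, ha⟩ := hF a
    obtain ⟨g, hg, hb⟩ := hG b
    obtain ⟨m, -, fm, gm⟩ := I.directed _ hf _ hg
    exact m.2.1 (a, _) (fm ha) (_, b) (gm hb)
  · obtain ⟨f, hf, ha⟩ := hF a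
    exact (f.2.2 _ ha).symm

end ColouredCantor

end TameReal

/-! ### Uniqueness of sets without free ends -/

namespace TameReal
open Set Filter Topology
open scoped Pointwise

variable {A B C W V U X Y Z T R : Set ℝ} {f g : ℝ → ℝ} {a b c d u v x y l r l' r' a' b' : ℝ}

/-- A nonempty compact set without isolated points in which every nondegenerate component is a
limit of other components on both sides. -/
structure NoFreeEnd (A : Set ℝ) : Prop where
  compact : IsCompact A
  nonempty : A.Nonempty
  cover : ∀ x ∈ A, IsComp A x x ∨ ∃ a b, Fat A a b ∧ x ∈ Icc a b
  acc : ∀ x ∈ A, ∀ u v, u < x → x < v → ∃ y ∈ A, u < y ∧ y < v ∧ y ≠ x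

/-- Nondegenerate components are dense in `A`. -/
def FatDense (A : Set ℝ) : Prop :=
  ∀ u v, u ∉ A → v ∉ A → (A ∩ Ioo u v).Nonempty → ∃ a b, Fat A a b ∧ u < a ∧ b < v

/-- `(l, r)` is a bounded gap of `A`. -/
structure IsGap (A : Set ℝ) (l r : ℝ) : Prop where
  lt : l < r
  left_mem : l ∈ A
  right_mem : r ∈ A
  notMem : ∀ x, l < x → x < r → x ∉ A

/-- `(l, r)` is a bounded gap or `[l, r]` is a nondegenerate component. -/
def IsSeg (A : Set ℝ) (l r : ℝ) : Prop := IsGap A l r ∨ Fat A l r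

theorem IsSeg.lt (h : IsSeg A l r) : l < r := h.elim (·.lt) (·.lt)
theorem IsSeg.left_mem (h : IsSeg A l r) : l ∈ A := h.elim (·.left_mem) (·.left_mem)
theorem IsSeg.right_mem (h : IsSeg A l r) : r ∈ A := h.elim (·.right_mem) (·.right_mem)

theorem IsGap.not_fat (h : IsGap A l r) : ¬ Fat A l r' := fun h' => by
  obtain ⟨x, h1, h2⟩ := exists_between (lt_min h.lt h'.lt)
  have := lt_min_iff.1 h2
  exact h.notMem x h1 this.1 (h'.sub ⟨h1.le, this.2.le⟩)

theorem IsGap.right_le (h : IsGap A l r) (hx : x ∈ A) (hlx : l < x) : r ≤ x := by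
  by_contra! h'
  exact h.notMem x hlx h' hx

theorem IsGap.le_left (h : IsGap A l r) (hx : x ∈ A) (hlx : x < r) : x ≤ l := by
  by_contra! h'
  exact h.notMem x h' hlx hx

theorem IsSeg.right_unique (h : IsSeg A l r) (h' : IsSeg A l r') : r = r' := by
  rcases h with h | h <;> rcases h' with h' | h'
  · exact le_antisymm (h.right_le h'.right_mem h'.lt) (h'.right_le h.right_mem h.lt)
  · exact absurd h' h.not_fat
  · exact absurd h h'.not_fat
  · exact (h.toIsComp.eq_of_mem h'.toIsComp (left_mem_Icc.2 h.le) (left_mem_Icc.2 h'.le)).2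

/-- Segments are pairwise disjoint even at their ends: a common end of two gaps would be isolated,
and a gap cannot adjoin a component at whose ends `A` accumulates. -/
theorem NoFreeEnd.seg_lt (hA : NoFreeEnd A) (h : IsSeg A l r) (h' : IsSeg A l' r') (hl : l < l') :
    r < l' := by
  rcases h with h | h
  · refine lt_of_le_of_ne (h.right_le h'.left_mem hl) ?_
    rintro rfl
    rcases h' with h' | h'
    · obtain ⟨y, hy, h1, h2, h3⟩ := hA.acc r h.right_mem l r' h.lt h'.lt
      rcases lt_or_gt_of_ne h3 with k | k
      · exact h.notMem y h1 k hy
      · exact h'.notMem y k h2 hy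
    · obtain ⟨y, hy, h1, h2⟩ := h'.lacc l hl
      exact h.notMem y h1 h2 hy
  · by_contra! hr
    rcases h' with h' | h'
    · rcases hr.eq_or_lt with rfl | hr
      · obtain ⟨y, hy, h1, h2⟩ := h.racc r' h'.lt
        exact h'.notMem y h1 h2 hy
      · obtain ⟨y, h1, h2⟩ := exists_between (lt_min hr h'.lt)
        have := lt_min_iff.1 h2
        exact h'.notMem y h1 this.2 (h.sub ⟨by linarith, this.1.le⟩)
    · have := (h.toIsComp.eq_of_mem h'.toIsComp ⟨hl.le, hr⟩ (left_mem_Icc.2 h'.le)).1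
      linarith

theorem exists_gap (hA : IsCompact A) (hx : x ∈ A) (hy : y ∈ A) (hc : c ∉ A) (hxc : x < c)
    (hcy : c < y) : ∃ l r, IsGap A l r ∧ l < c ∧ c < r ∧ x ≤ l ∧ r ≤ y := by
  obtain ⟨l, hl, hl'⟩ := (hA.inter_right (isClosed_Iic (a := c))).exists_isGreatest ⟨x, hx, hxc.le⟩
  obtain ⟨r, hr, hr'⟩ := (hA.inter_right (isClosed_Ici (a := c))).exists_isLeast ⟨y, hy, hcy.le⟩
  have hlc : l < c := lt_of_le_of_ne hl.2 fun e => hc (e ▸ hl.1)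
  have hcr : c < r := lt_of_le_of_ne hr.2 fun e => hc (e ▸ hr.1)
  refine ⟨l, r, ⟨hlc.trans hcr, hl.1, hr.1, fun z h1 h2 hz => ?_⟩, hlc, hcr, hl' ⟨hx, hxc.le⟩,
    hr' ⟨hy, hcy.le⟩⟩
  rcases le_total z c with h | h
  · exact absurd (hl' ⟨hz, h⟩) (not_le.2 h1)
  · exact absurd (hr' ⟨hz, h⟩) (not_le.2 h2)

/-- Without a gap point between `r` and `l'`, the component of `r` would reach `l'`. This is
impossible if `r` is a component end; if `r` ends a gap, its component is fat, and the gap excludes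
accumulation from the left. -/
theorem NoFreeEnd.gap_between (hA : NoFreeEnd A) (h : IsSeg A l r) (h' : IsSeg A l' r')
    (hl : l < l') : ∃ m n, IsGap A m n ∧ l < m ∧ m < l' ∧ n ≤ l' := by
  have hr := hA.seg_lt h h' hl
  have : ∃ c, r < c ∧ c < l' ∧ c ∉ A := by
    by_contra! hcon
    have hsub : Icc r l' ⊆ A := fun z hz => by
      rcases hz.1.eq_or_lt with e | h1
      · exact e ▸ h.right_mem
      rcases hz.2.eq_or_lt with e | h2
      · exact e ▸ h'.left_mem
      · exact hcon z h1 h2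
    have key : ∀ p q, IsComp A p q → r ∈ Icc p q → l' ≤ q := fun p q hc hrq =>
      (hc.mem_of_uIcc hrq (by rw [uIcc_of_le hr.le]; exact hsub)).2
    rcases hA.cover r h.right_mem with hc | ⟨p, q, hF, hrq⟩
    · exact absurd (key r r hc (by simp)) (not_le.2 hr)
    · rcases h with h | h
      · rcases hrq.1.eq_or_lt with rfl | hpr
        · obtain ⟨y, hy, h1, h2⟩ := hF.lacc l h.lt
          exact h.notMem y h1 h2 hy
        · obtain ⟨z, h1, h2⟩ := exists_between (max_lt hpr h.lt)
          have := max_lt_iff.1 h1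
          exact h.notMem z this.2 h2 (hF.sub ⟨this.1.le, h2.le.trans hrq.2⟩)
      · exact absurd (key l r h.toIsComp (right_mem_Icc.2 h.le)) (not_le.2 hr)
  obtain ⟨c, h1, h2, h3⟩ := this
  obtain ⟨m, n, hg, k1, k2, k3, k4⟩ := exists_gap hA.compact h.right_mem h'.left_mem h3 h1 h2
  exact ⟨m, n, hg, h.lt.trans_le k3, k1.trans h2, k4⟩

/-- Two successive gaps enclose a point of `A`, and density applies to the window cut inside these
gaps. -/
theorem NoFreeEnd.fat_between (hA : NoFreeEnd A) (hD : FatDense A) (h : IsSeg A l r)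
    (h' : IsSeg A l' r') (hl : l < l') : ∃ m n, Fat A m n ∧ l < m ∧ m < l' := by
  obtain ⟨m, n, h1, h2, h3, -⟩ := hA.gap_between h h' hl
  obtain ⟨m', n', k1, k2, k3, -⟩ := hA.gap_between (Or.inl h1) h' h3
  have hn := hA.seg_lt (Or.inl h1) (Or.inl k1) k2
  obtain ⟨c, hc1, hc2⟩ := exists_between h1.lt
  obtain ⟨c', hc1', hc2'⟩ := exists_between k1.lt
  obtain ⟨p, q, hF, hp, hq⟩ := hD c c' (h1.notMem c hc1 hc2) (k1.notMem c' hc1' hc2')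
    ⟨n, h1.right_mem, hc2, hn.trans hc1'⟩
  have := k1.le_left hF.right_mem (hq.trans hc2')
  have := hF.lt
  exact ⟨p, q, hF, by linarith, by linarith⟩

theorem NoFreeEnd.isLeast (hA : NoFreeEnd A) : IsLeast A (sInf A) :=
  hA.compact.isLeast_sInf hA.nonempty

theorem NoFreeEnd.isGreatest (hA : NoFreeEnd A) : IsGreatest A (sSup A) :=
  hA.compact.isGreatest_sSup hA.nonempty

theorem NoFreeEnd.rgap_sInf (hA : NoFreeEnd A) : RGap A (sInf A) := by
  rcases hA.cover _ hA.isLeast.1 with h | ⟨a, b, hF, h⟩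
  · exact h.rgap
  · obtain ⟨y, hy, -, hya⟩ := hF.lacc (a - 1) (by linarith)
    linarith [hA.isLeast.2 hy, h.1]

theorem NoFreeEnd.lgap_sSup (hA : NoFreeEnd A) : LGap A (sSup A) := by
  rcases hA.cover _ hA.isGreatest.1 with h | ⟨a, b, hF, h⟩
  · exact h.lgap
  · obtain ⟨y, hy, hya, -⟩ := hF.racc (b + 1) (by linarith)
    linarith [hA.isGreatest.2 hy, h.2]

theorem NoFreeEnd.sInf_lt (hA : NoFreeEnd A) (h : IsSeg A l r) : sInf A < l := by
  refine lt_of_le_of_ne (hA.isLeast.2 h.left_mem) fun e => ?_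
  rcases h with h | h
  · obtain ⟨y, hy, -, h2, h3⟩ := hA.acc l h.left_mem (l - 1) r (by linarith) h.lt
    have := hA.isLeast.2 hy
    exact h.notMem y (lt_of_le_of_ne (e ▸ this) h3.symm) h2 hy
  · obtain ⟨y, hy, -, hya⟩ := h.lacc (l - 1) (by linarith)
    linarith [hA.isLeast.2 hy]

theorem NoFreeEnd.lt_sSup (hA : NoFreeEnd A) (h : IsSeg A l r) : r < sSup A := by
  refine lt_of_le_of_ne (hA.isGreatest.2 h.right_mem) fun e => ?_
  rcases h with h | h
  · obtain ⟨y, hy, h2, -, h3⟩ := hA.acc r h.right_mem l (r + 1) h.lt (by linarith)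
    have := hA.isGreatest.2 hy
    exact h.notMem y h2 (lt_of_le_of_ne (e ▸ this) h3) hy
  · obtain ⟨y, hy, hya, -⟩ := h.racc (r + 1) (by linarith)
    linarith [hA.isGreatest.2 hy]

theorem NoFreeEnd.gap_below (hA : NoFreeEnd A) (h : IsSeg A l r) :
    ∃ m n, IsGap A m n ∧ m < l := by
  obtain ⟨c, h1, h2, h3⟩ := hA.rgap_sInf l (hA.sInf_lt h)
  obtain ⟨m, n, hg, k1, -⟩ := exists_gap hA.compact hA.isLeast.1 h.left_mem h3 h1 h2
  exact ⟨m, n, hg, k1.trans h2⟩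

theorem NoFreeEnd.gap_above (hA : NoFreeEnd A) (h : IsSeg A l r) :
    ∃ m n, IsGap A m n ∧ l < m := by
  obtain ⟨c, h1, h2, h3⟩ := hA.lgap_sSup r (hA.lt_sSup h)
  obtain ⟨m, n, hg, -, -, k1, -⟩ := exists_gap hA.compact h.right_mem hA.isGreatest.1 h3 h1 h2
  exact ⟨m, n, hg, h.lt.trans_le k1⟩

theorem NoFreeEnd.exists_gap (hA : NoFreeEnd A) : ∃ m n, IsGap A m n := by
  obtain ⟨y, hy, -, -, hne⟩ := hA.acc _ hA.isLeast.1 (sInf A - 1) (sInf A + 1) (by linarith)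
    (by linarith)
  obtain ⟨c, h1, h2, h3⟩ := hA.rgap_sInf y (lt_of_le_of_ne (hA.isLeast.2 hy) hne.symm)
  obtain ⟨m, n, hg, -⟩ := TameReal.exists_gap hA.compact hA.isLeast.1 hy h3 h1 h2
  exact ⟨m, n, hg⟩

/-- Left ends of bounded gaps and nondegenerate components. -/
abbrev SegLeft (A : Set ℝ) : Type := {l : ℝ // ∃ r, IsSeg A l r}

/-- The right end of the segment with left end `l`. -/
noncomputable def SegLeft.right (l : SegLeft A) : ℝ := l.2.choose

theorem SegLeft.isSeg (l : SegLeft A) : IsSeg A l.1 l.right := l.2.choose_spec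

/-- The colour of a segment: whether it is a component. -/
def SegLeft.IsFat (l : SegLeft A) : Prop := Fat A l.1 l.right

theorem SegLeft.right_eq (l : SegLeft A) (h : IsSeg A l.1 r) : l.right = r :=
  l.isSeg.right_unique h

theorem SegLeft.isFat_mk (h : Fat A l r) : SegLeft.IsFat (⟨l, r, Or.inr h⟩ : SegLeft A) = True :=
  eq_true (by rw [IsFat, SegLeft.right_eq _ (Or.inr h)]; exact h)

theorem SegLeft.isFat_mk_gap (h : IsGap A l r) :
    SegLeft.IsFat (⟨l, r, Or.inl h⟩ : SegLeft A) = False :=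
  eq_false h.not_fat

theorem NoFreeEnd.colourDense_false (hA : NoFreeEnd A) :
    ColourDense (SegLeft.IsFat (A := A)) False where
  between x y hxy := by
    obtain ⟨m, n, h, h1, h2, -⟩ := hA.gap_between x.isSeg y.isSeg hxy
    exact ⟨⟨m, n, Or.inl h⟩, h1, h2, SegLeft.isFat_mk_gap h⟩
  below x := by
    obtain ⟨m, n, h, h1⟩ := hA.gap_below x.isSeg
    exact ⟨⟨m, n, Or.inl h⟩, h1, SegLeft.isFat_mk_gap h⟩
  above x := by
    obtain ⟨m, n, h, h1⟩ := hA.gap_above x.isSeg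
    exact ⟨⟨m, n, Or.inl h⟩, h1, SegLeft.isFat_mk_gap h⟩
  exists_colour := by
    obtain ⟨m, n, h⟩ := hA.exists_gap
    exact ⟨⟨m, n, Or.inl h⟩, SegLeft.isFat_mk_gap h⟩

theorem NoFreeEnd.colourDense_true (hA : NoFreeEnd A) (hD : FatDense A) :
    ColourDense (SegLeft.IsFat (A := A)) True where
  between x y hxy := by
    obtain ⟨m, n, h, h1, h2⟩ := hA.fat_between hD x.isSeg y.isSeg hxy
    exact ⟨⟨m, n, Or.inr h⟩, h1, h2, SegLeft.isFat_mk h⟩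
  below x := by
    obtain ⟨m, n, h, h1⟩ := hA.gap_below x.isSeg
    obtain ⟨m', n', h', h1'⟩ := hA.gap_below (Or.inl h)
    obtain ⟨p, q, k, k1, k2⟩ := hA.fat_between hD (Or.inl h') (Or.inl h) h1'
    exact ⟨⟨p, q, Or.inr k⟩, k2.trans h1, SegLeft.isFat_mk k⟩
  above x := by
    obtain ⟨m, n, h, h1⟩ := hA.gap_above x.isSeg
    obtain ⟨p, q, k, k1, k2⟩ := hA.fat_between hD x.isSeg (Or.inl h) h1
    exact ⟨⟨p, q, Or.inr k⟩, k1, SegLeft.isFat_mk k⟩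
  exists_colour := by
    obtain ⟨m, n, h⟩ := hA.exists_gap
    obtain ⟨m', n', h', h1'⟩ := hA.gap_below (Or.inl h)
    obtain ⟨p, q, k, -⟩ := hA.fat_between hD (Or.inl h') (Or.inl h) h1'
    exact ⟨⟨p, q, Or.inr k⟩, SegLeft.isFat_mk k⟩

theorem NoFreeEnd.countable_segLeft (hA : NoFreeEnd A) : Countable (SegLeft A) := by
  have : {l | ∃ r, IsSeg A l r}.Countable := by
    choose! r hr using fun l (h : l ∈ {l | ∃ r, IsSeg A l r}) => h
    refine Set.PairwiseDisjoint.countable_of_Ioo (y := r) ?_ fun a ha => (hr a ha).lt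
    intro a ha b hb hab
    refine disjoint_left.2 fun x hx hx' => ?_
    rcases lt_or_gt_of_ne hab with h | h
    · have := hA.seg_lt (hr a ha) (hr b hb) h
      linarith [hx.2, hx'.1]
    · have := hA.seg_lt (hr b hb) (hr a ha) h
      linarith [hx.1, hx'.2]
  exact this

/-- A strictly monotone relation with dense domain and range extends to an automorphism of `ℝ`. -/
theorem exists_orderIso_extending {G : ℝ → ℝ → Prop}
    (hG : ∀ x y x' y', G x y → G x' y' → (x < x' ↔ y < y'))
    (hd : ∀ x y, x < y → ∃ z w, x < z ∧ z < y ∧ G z w)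
    (hr : ∀ x y, x < y → ∃ z w, x < w ∧ w < y ∧ G z w) : ∃ h : ℝ ≃o ℝ, ∀ x y, G x y → h x = y := by
  have hle : ∀ x y x' y', G x y → G x' y' → x ≤ x' → y ≤ y' := fun x y x' y' h h' hx => by
    by_contra! hy
    exact absurd ((hG _ _ _ _ h' h).2 hy) (not_lt.2 hx)
  -- The monotone extension by suprema. Density of the domain of `G` makes it strictly monotone, and
  -- density of the range makes it continuous.
  set F : ℝ → ℝ := fun x => sSup {y | ∃ z ≤ x, G z y} with hF
  have hne : ∀ x, {y | ∃ z ≤ x, G z y}.Nonempty := fun x => by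
    obtain ⟨z, w, -, h2, h3⟩ := hd (x - 1) x (by linarith)
    exact ⟨w, z, h2.le, h3⟩
  have hub : ∀ x x' y', G x' y' → x ≤ x' → y' ∈ upperBounds {y | ∃ z ≤ x, G z y} := by
    rintro x x' y' h hx y ⟨z, hz, hzy⟩
    exact hle _ _ _ _ hzy h (hz.trans hx)
  have hbd : ∀ x, BddAbove {y | ∃ z ≤ x, G z y} := fun x => by
    obtain ⟨z, w, h1, -, h3⟩ := hd x (x + 1) (by linarith)
    exact ⟨w, hub x z w h3 h1.le⟩
  have hFG : ∀ x y, G x y → F x = y := fun x y h =>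
    le_antisymm (csSup_le (hne x) (hub x x y h le_rfl)) (le_csSup (hbd x) ⟨x, le_rfl, h⟩)
  have hmono : Monotone F := fun x y hxy =>
    csSup_le_csSup (hbd y) (hne x) fun w ⟨z, hz, h⟩ => ⟨z, hz.trans hxy, h⟩
  have hstrict : StrictMono F := fun x y hxy => by
    obtain ⟨m, hm, hm'⟩ := exists_between hxy
    obtain ⟨z, w, h1, h2, h3⟩ := hd x m hm
    obtain ⟨z', w', h1', h2', h3'⟩ := hd m y hm'
    have e1 := hmono h1.le
    have e2 := hmono h2'.le
    rw [hFG _ _ h3] at e1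
    rw [hFG _ _ h3'] at e2
    have := (hG _ _ _ _ h3 h3').1 (h2.trans h1')
    linarith
  have hcont : Continuous F := by
    refine hmono.continuous_of_denseRange ?_
    rw [DenseRange, dense_iff_exists_between]
    intro x y hxy
    obtain ⟨z, w, h1, h2, h3⟩ := hr x y hxy
    exact ⟨w, ⟨z, hFG _ _ h3⟩, h1, h2⟩
  have hsurj : Function.Surjective F := fun y => by
    obtain ⟨z, w, -, h2, h3⟩ := hr (y - 1) y (by linarith)
    obtain ⟨z', w', h1', -, h3'⟩ := hr y (y + 1) (by linarith)
    obtain ⟨x, hx⟩ := mem_range_of_exists_le_of_exists_ge hcont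
      ⟨z, ((hFG _ _ h3).trans_lt h2).le⟩ ⟨z', (h1'.trans_eq (hFG _ _ h3').symm).le⟩
    exact ⟨x, hx⟩
  exact ⟨hstrict.orderIsoOfSurjective F hsurj, hFG⟩

/-- The piecewise affine relation induced by an order isomorphism between the segments. -/
def SegRel (e : SegLeft A ≃o SegLeft B) (x y : ℝ) : Prop :=
  (∃ t, 0 ≤ t ∧ x = sInf A - t ∧ y = sInf B - t) ∨
  (∃ t, 0 ≤ t ∧ x = sSup A + t ∧ y = sSup B + t) ∨
  ∃ (l : SegLeft A) (t : ℝ), 0 ≤ t ∧ t ≤ 1 ∧ x = l + t * (l.right - l) ∧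
    y = (e l) + t * ((e l).right - (e l))

theorem SegRel.symm {e : SegLeft A ≃o SegLeft B} (h : SegRel e x y) : SegRel e.symm y x := by
  rcases h with ⟨t, h1, h2, h3⟩ | ⟨t, h1, h2, h3⟩ | ⟨l, t, h1, h2, h3, h4⟩
  · exact Or.inl ⟨t, h1, h3, h2⟩
  · exact Or.inr (Or.inl ⟨t, h1, h3, h2⟩)
  · exact Or.inr (Or.inr ⟨e l, t, h1, h2, h4, by simpa using h3⟩)

theorem affine_mem {t p q : ℝ} (h : p < q) (h0 : 0 ≤ t) (h1 : t ≤ 1) :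
    p ≤ p + t * (q - p) ∧ p + t * (q - p) ≤ q := by
  constructor <;> nlinarith

theorem NoFreeEnd.segRel_lt (hA : NoFreeEnd A) (hB : NoFreeEnd B) {e : SegLeft A ≃o SegLeft B}
    {x' y' : ℝ} (h : SegRel e x y) (h' : SegRel e x' y') (hx : x < x') : y < y' := by
  have bd : ∀ {A : Set ℝ}, NoFreeEnd A → ∀ (l : SegLeft A) (t : ℝ), 0 ≤ t → t ≤ 1 →
      sInf A < l + t * (l.right - l) ∧ l + t * (l.right - l) < sSup A := fun hA l t h0 h1 =>
    ⟨(hA.sInf_lt l.isSeg).trans_le (affine_mem l.isSeg.lt h0 h1).1,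
      (affine_mem l.isSeg.lt h0 h1).2.trans_lt (hA.lt_sSup l.isSeg)⟩
  have hA' := hA.isLeast.2 hA.isGreatest.1
  have hB' : sInf B < sSup B := by
    obtain ⟨m, n, hg⟩ := hB.exists_gap
    have h1 := hB.sInf_lt (Or.inl hg)
    have h2 := hB.lt_sSup (Or.inl hg)
    linarith [hg.lt]
  rcases h with ⟨t, t0, h2, h3⟩ | ⟨t, t0, h2, h3⟩ | ⟨l, t, t0, t1, h2, h3⟩ <;>
    rcases h' with ⟨s, s0, k2, k3⟩ | ⟨s, s0, k2, k3⟩ | ⟨m, s, s0, s1, k2, k3⟩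
  · linarith
  · linarith
  · linarith [(bd hB (e m) s s0 s1).1]
  · linarith
  · linarith
  · linarith [(bd hA m s s0 s1).2]
  · linarith [(bd hA l t t0 t1).1]
  · linarith [(bd hB (e l) t t0 t1).2]
  · rcases lt_trichotomy l m with hlm | rfl | hlm
    · have := hB.seg_lt (e l).isSeg (e m).isSeg (e.strictMono hlm)
      have := (affine_mem (e l).isSeg.lt t0 t1).2
      have := (affine_mem (e m).isSeg.lt s0 s1).1
      linarith
    · have e1 := l.isSeg.lt
      have e2 := (e l).isSeg.lt
      have : t < s := by
        by_contra! hst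
        have := mul_le_mul_of_nonneg_right hst (sub_nonneg.2 e1.le)
        linarith
      have := mul_lt_mul_of_pos_right this (sub_pos.2 e2)
      linarith
    · have := hA.seg_lt m.isSeg l.isSeg hlm
      have := (affine_mem l.isSeg.lt t0 t1).1
      have := (affine_mem m.isSeg.lt s0 s1).2
      linarith

theorem exists_affine {p q x : ℝ} (hpx : p ≤ x) (hxq : x ≤ q) (hpq : p < q) :
    ∃ t, 0 ≤ t ∧ t ≤ 1 ∧ x = p + t * (q - p) := by
  have : 0 < q - p := by linarith
  refine ⟨(x - p) / (q - p), div_nonneg (by linarith) this.le, (div_le_one this).2 (by linarith), ?_⟩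
  field_simp; ring

theorem SegRel.exists_of_mem (e : SegLeft A ≃o SegLeft B) (h : IsSeg A l r) (h1 : l ≤ x)
    (h2 : x ≤ r) : ∃ y, SegRel e x y := by
  obtain ⟨t, t0, t1, ht⟩ := exists_affine h1 h2 h.lt
  refine ⟨_, Or.inr (Or.inr ⟨⟨l, r, h⟩, t, t0, t1, ?_, rfl⟩)⟩
  rw [SegLeft.right_eq _ h]; exact ht

/-- Points outside `A` lie on an outer ray or inside a gap. Preservation of colours sends gaps to
gaps, and the affine parameter is strictly between `0` and `1`. -/
theorem NoFreeEnd.segRel_of_notMem (hA : NoFreeEnd A) (hB : NoFreeEnd B)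
    (e : SegLeft A ≃o SegLeft B)
    (he : ∀ l, (e l).IsFat = l.IsFat) (hx : x ∉ A) : ∃ y, y ∉ B ∧ SegRel e x y := by
  rcases lt_trichotomy x (sInf A) with h | h | h
  · exact ⟨sInf B - (sInf A - x), fun hy => by linarith [hB.isLeast.2 hy],
      Or.inl ⟨_, by linarith, by ring, rfl⟩⟩
  · exact absurd (h ▸ hA.isLeast.1) hx
  rcases lt_trichotomy x (sSup A) with h' | h' | h'
  · obtain ⟨l, r, hg, h1, h2, -⟩ := TameReal.exists_gap hA.compact hA.isLeast.1 hA.isGreatest.1 hx h h'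
    obtain ⟨t, t0, t1, ht⟩ := exists_affine h1.le h2.le hg.lt
    set L : SegLeft A := ⟨l, r, Or.inl hg⟩ with hL
    refine ⟨_, ?_, Or.inr (Or.inr ⟨L, t, t0, t1, by rw [SegLeft.right_eq _ (Or.inl hg)]; exact ht,
      rfl⟩)⟩
    have hgap : IsGap B (e L) (e L).right := (e L).isSeg.resolve_right fun hf => by
      have h1 : (e L).IsFat := hf
      rw [he, SegLeft.isFat_mk_gap hg] at h1
      exact h1
    have hpos : 0 < r - l := sub_pos.2 hg.lt
    have hpos' : 0 < (e L).right - (e L) := sub_pos.2 hgap.lt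
    have t0' : 0 < t := by by_contra! h; nlinarith
    have t1' : t < 1 := by by_contra! h; nlinarith
    exact hgap.notMem _ (by nlinarith) (by nlinarith)
  · exact absurd (h' ▸ hA.isGreatest.1) hx
  · exact ⟨sSup B + (x - sSup A), fun hy => by linarith [hB.isGreatest.2 hy],
      Or.inr (Or.inl ⟨_, by linarith, by ring, rfl⟩)⟩

/-- An interval inside `A` contains no singleton component, so its points lie in fat components,
where the relation is defined. -/
theorem NoFreeEnd.segRel_dense (hA : NoFreeEnd A) (hB : NoFreeEnd B)
    (e : SegLeft A ≃o SegLeft B) (he : ∀ l, (e l).IsFat = l.IsFat) (hxy : x < y) :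
    ∃ z w, x < z ∧ z < y ∧ SegRel e z w := by
  by_cases h : ∃ c, x < c ∧ c < y ∧ c ∉ A
  · obtain ⟨c, h1, h2, h3⟩ := h
    obtain ⟨w, -, hw⟩ := hA.segRel_of_notMem hB e he h3
    exact ⟨c, w, h1, h2, hw⟩
  · push Not at h
    obtain ⟨z, h1, h2⟩ := exists_between hxy
    rcases hA.cover z (h z h1 h2) with hc | ⟨a, b, hF, hz⟩
    · obtain ⟨c, k1, k2, k3⟩ := hc.rgap y h2
      exact absurd (h c (h1.trans k1) k2) k3
    · obtain ⟨w, hw⟩ := SegRel.exists_of_mem e (Or.inr hF) hz.1 hz.2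
      exact ⟨z, w, h1, h2, hw⟩

/-- The piecewise affine relation extends to an automorphism of the line. It maps complement to
complement in both directions, hence `A` onto `B`. -/
theorem NoFreeEnd.iso_of_orderIso (hA : NoFreeEnd A) (hB : NoFreeEnd B)
    (e : SegLeft A ≃o SegLeft B) (he : ∀ l, (e l).IsFat = l.IsFat) : Iso A B := by
  have he' : ∀ l, (e.symm l).IsFat = l.IsFat := fun l => by
    rw [← he, e.apply_symm_apply]
  obtain ⟨h, hh⟩ := exists_orderIso_extending (G := SegRel e)
    (fun x y x' y' k k' => ⟨hA.segRel_lt hB k k', hB.segRel_lt hA k.symm k'.symm⟩)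
    (fun x y hxy => hA.segRel_dense hB e he hxy)
    (fun x y hxy => by
      obtain ⟨z, w, h1, h2, h3⟩ := hB.segRel_dense hA e.symm he' hxy
      exact ⟨w, z, h1, h2, h3.symm⟩)
  refine ⟨h, h.continuous.continuousOn, ?_, h.injective.injOn, ?_⟩
  · intro x hx
    by_contra hn
    obtain ⟨z, hz, hzx⟩ := hB.segRel_of_notMem hA e.symm he' hn
    exact hz (h.injective (hh _ _ hzx.symm) ▸ hx)
  · intro y hy
    refine ⟨h.symm y, ?_, h.apply_symm_apply y⟩
    by_contra hn
    obtain ⟨z, hz, hzx⟩ := hA.segRel_of_notMem hB e he hn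
    have := hh _ _ hzx
    rw [h.apply_symm_apply] at this
    exact hz (this ▸ hy)

/-- Two sets without free ends are homeomorphic if both have a dense set of nondegenerate
components. -/
theorem NoFreeEnd.iso_of_fatDense (hA : NoFreeEnd A) (hB : NoFreeEnd B) (dA : FatDense A)
    (dB : FatDense B) : Iso A B := by
  have := hA.countable_segLeft
  have := hB.countable_segLeft
  have key : ∀ {A B : Set ℝ}, NoFreeEnd B → FatDense B → ∀ l : SegLeft A,
      ColourDense (SegLeft.IsFat (A := B)) l.IsFat := fun {A B} hB dB l => by
    by_cases h : l.IsFat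
    · rw [eq_true h]; exact hB.colourDense_true dB
    · rw [eq_false h]; exact hB.colourDense_false
  obtain ⟨e, he⟩ := exists_orderIso_of_colourDense (key (A := A) hB dB) (key (A := B) hA dA)
  exact hA.iso_of_orderIso hB e he

/-- Two sets without free ends are homeomorphic if both are totally disconnected. -/
theorem NoFreeEnd.iso_of_no_fat (hA : NoFreeEnd A) (hB : NoFreeEnd B) (dA : ∀ a b, ¬ Fat A a b)
    (dB : ∀ a b, ¬ Fat B a b) : Iso A B := by
  have := hA.countable_segLeft
  have := hB.countable_segLeft
  have key : ∀ {A B : Set ℝ}, NoFreeEnd B → (∀ a b, ¬ Fat A a b) → ∀ l : SegLeft A,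
      ColourDense (SegLeft.IsFat (A := B)) l.IsFat := fun {A B} hB dA l => by
    have h : ¬ l.IsFat := dA _ _
    rw [eq_false h]; exact hB.colourDense_false
  obtain ⟨e, he⟩ := exists_orderIso_of_colourDense (key (A := A) hB dA) (key (A := B) hA dB)
  exact hA.iso_of_orderIso hB e he

end TameReal

/-! ### Models of blocks; points that can be moved to an end -/

namespace TameReal
open Set Filter Topology
open scoped Pointwise

variable {B₀ A B C W V U X Y Z T R : Set ℝ} {f g : ℝ → ℝ} {a b c d u v x y z w l r l' r' a' b' : ℝ}

theorem blockModel_of_isPreconnected (hc : IsCompact C) (hp : IsPreconnected C) : BlockModel C where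
  compact := hc
  hom V hV hne := by
    obtain ⟨x, hx⟩ := hne
    rw [subset_antisymm hV.1 (hV.isPreconnected_subset hp Subset.rfl (hV.1 hx) hx)]
    exact .refl _
  alt := Or.inl hp

theorem NoFreeEnd.isComp_of_no_fat (hC : NoFreeEnd C) (hf : ∀ a b, ¬ Fat C a b) (hx : x ∈ C) :
    IsComp C x x :=
  (hC.cover x hx).resolve_right fun ⟨a, b, h, _⟩ => hf a b h

theorem IsComp.mono (h : IsComp A x x) (hVA : V ⊆ A) (hx : x ∈ V) : IsComp V x x where
  le := le_rfl
  sub := by simpa using hx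
  lgap u hu := by
    obtain ⟨c, h1, h2, h3⟩ := h.lgap u hu
    exact ⟨c, h1, h2, fun h => h3 (hVA h)⟩
  rgap u hu := by
    obtain ⟨c, h1, h2, h3⟩ := h.rgap u hu
    exact ⟨c, h1, h2, fun h => h3 (hVA h)⟩

theorem IsComp.not_Icc (h : IsComp A x x) (hxy : x < y) : ¬ Icc x y ⊆ A := fun hs => by
  obtain ⟨c, h1, h2, h3⟩ := h.rgap y hxy
  exact h3 (hs ⟨h1.le, h2.le⟩)

/-- Such a set is a Cantor set: its nonempty clopen parts again have no isolated points and no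
intervals, so uniqueness applies to them. -/
theorem blockModel_of_no_fat (hC : NoFreeEnd C) (hf : ∀ a b, ¬ Fat C a b) : BlockModel C where
  compact := hC.compact
  hom V hV hne := by
    refine NoFreeEnd.iso_of_no_fat ⟨hV.isCompact hC.compact, hne, fun x hx =>
      Or.inl ((hC.isComp_of_no_fat hf (hV.1 hx)).mono hV.1 hx), ?_⟩ hC ?_ hf
    · intro x hx u v hu hv
      obtain ⟨ε, hε, hεV⟩ := hV.exists_Ioo hx
      obtain ⟨y, hy, h1, h2, h3⟩ := hC.acc x (hV.1 hx) (max u (x - ε)) (min v (x + ε))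
        (max_lt hu (by linarith)) (lt_min hv (by linarith))
      rw [max_lt_iff] at h1
      rw [lt_min_iff] at h2
      exact ⟨y, hεV y hy h1.2 h2.2, h1.1, h2.1, h3⟩
    · intro a b hF
      exact (hC.isComp_of_no_fat hf (hV.1 hF.left_mem)).not_Icc hF.lt (hF.sub.trans hV.1)
  alt := Or.inr fun x y hxy hs =>
    (hC.isComp_of_no_fat hf (hs (left_mem_Icc.2 hxy.le))).not_Icc hxy hs

/-- `x` is the least point of `f '' A` for some embedding `f` of `A`. -/
def Endable (A : Set ℝ) (x : ℝ) : Prop :=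
  ∃ f : ℝ → ℝ, ContinuousOn f A ∧ InjOn f A ∧ ∀ y ∈ A, f x ≤ f y

/-- Some self-homeomorphism of `A` maps `x` to `y`. -/
def SelfEquiv (A : Set ℝ) (x y : ℝ) : Prop := ∃ σ : ℝ → ℝ, EmbOn σ A A ∧ σ x = y

theorem SelfEquiv.symm (hA : IsCompact A) (hx : x ∈ A) (h : SelfEquiv A x y) : SelfEquiv A y x := by
  obtain ⟨σ, hσ, rfl⟩ := h
  obtain ⟨τ, hτ, h1, -⟩ := hσ.exists_inv hA
  exact ⟨τ, hτ, h1 x hx⟩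

theorem SelfEquiv.trans (h : SelfEquiv A x y) (h' : SelfEquiv A y z) : SelfEquiv A x z := by
  obtain ⟨σ, hσ, rfl⟩ := h
  obtain ⟨τ, hτ, rfl⟩ := h'
  exact ⟨_, hτ.comp hσ, rfl⟩

theorem Endable.of_neg (h : Endable (-A) (-x)) : Endable A x := by
  obtain ⟨f, h1, h2, h3⟩ := h
  refine ⟨fun y => f (-y), h1.comp continuousOn_id.neg fun y hy => by simpa using hy, ?_, ?_⟩
  · intro y hy z hz hyz
    exact neg_injective (h2 (by simpa using hy) (by simpa using hz) hyz)
  · exact fun y hy => h3 (-y) (by simpa using hy)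

/-- `x ∈ A` is not a limit of points of `A` from the left. -/
def LeftIso (A : Set ℝ) (x : ℝ) : Prop := x ∈ A ∧ ∃ u < x, ∀ y ∈ A, u < y → x ≤ y

/-- Cut at a gap point just left of `x` and translate everything to the left of the cut beyond the
maximum of `A`. -/
theorem LeftIso.endable (hA : IsCompact A) (h : LeftIso A x) : Endable A x := by
  obtain ⟨hx, u, hu, h⟩ := h
  obtain ⟨c, h1, h2⟩ := exists_between hu
  have hc : c ∉ A := fun hc => absurd (h c hc h1) (not_le.2 h2)
  obtain ⟨m, hm⟩ := hA.bddBelow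
  obtain ⟨M, hM⟩ := hA.bddAbove
  set K := M - m + 1 with hK
  have e1 := (embOn_id A).image (inter_subset_left (t := Ioi c))
  have e2 : EmbOn (fun y => y + K) (A ∩ Iio c) ((fun y => y + K) '' (A ∩ Iio c)) :=
    ⟨by fun_prop, (add_left_injective K).injOn.bijOn_image⟩
  have hbig : ∀ y ∈ A, M < y + K := fun y hy => by linarith [hm hy]
  obtain ⟨f, hf, hf1, hf2⟩ := e1.glue_disjoint e2 (isPiece_Ioi hA.isClosed hc).2.1
    (isPiece_Iio hA.isClosed hc).2.1
    (disjoint_left.2 fun y hy hy' => lt_asymm (mem_Ioi.1 hy.2) (mem_Iio.1 hy'.2))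
    (disjoint_left.2 fun y hy hy' => by
      rw [image_id] at hy
      obtain ⟨z, hz, rfl⟩ := hy'
      exact absurd (hM hy.1) (not_le.2 (hbig z hz.1)))
  have e : A ∩ Ioi c ∪ A ∩ Iio c = A := by
    rw [← inter_union_distrib_left]
    refine inter_eq_left.2 fun y hy => ?_
    rcases lt_trichotomy y c with k | k | k
    · exact Or.inr k
    · exact absurd (k ▸ hy) hc
    · exact Or.inl k
  rw [e] at hf
  refine ⟨f, hf.1, hf.2.injOn, fun y hy => ?_⟩
  rw [hf1 x ⟨hx, h2⟩]
  rcases lt_or_ge y c with k | k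
  · rw [hf2 y ⟨hy, k⟩]
    exact (hM hx).trans (hbig y hy).le
  · have k' : c < y := lt_of_le_of_ne k fun e => hc (e ▸ hy)
    rw [hf1 y ⟨hy, k'⟩]
    exact h y hy (h1.trans k')

/-- Singleton components are endable. -/
theorem IsComp.endable (hA : IsCompact A) (h : IsComp A x x) : Endable A x := by
  classical
  have hx : x ∈ A := h.left_mem
  obtain ⟨m, hm⟩ := hA.bddBelow
  obtain ⟨M, hM⟩ := hA.bddAbove
  obtain ⟨p, hp, hp'⟩ := h.lgap.exists_seq (sub_one_lt x)
  obtain ⟨q, hq, hq'⟩ := h.rgap.neg.exists_seq (sub_one_lt (-x))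
  -- Clopen windows around `x` with intersection `{x}`. They need not be nested, so points are
  -- sorted by the first window `κ y` that omits them.
  set U : ℕ → Set ℝ := fun n => A ∩ Ioo (p n) (-q n) with hU
  have hq2 : ∀ n, -q n ∉ A := fun n hn => (hq n).2.2 (by simpa using hn)
  have pU : ∀ n, IsPiece (U n) A := fun n => isPiece_Ioo hA.isClosed (hp n).2.2 (hq2 n)
  have xU : ∀ n, x ∈ U n := fun n => ⟨hx, (hp n).2.1, by linarith [(hq n).2.1]⟩
  have hex : ∀ y, y ≠ x → ∃ n, y ∉ U n := fun y hy => by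
    rcases lt_or_gt_of_ne hy with k | k
    · obtain ⟨n, hn⟩ := hp' y k
      exact ⟨n, fun h => lt_asymm h.2.1 hn⟩
    · obtain ⟨n, hn⟩ := hq' (-y) (by linarith)
      exact ⟨n, fun h => by linarith [h.2.2]⟩
  set κ : ℝ → ℕ := fun y => sInf {n | y ∉ U n} with hκ
  have κmem : ∀ y, y ≠ x → y ∉ U (κ y) := fun y hy => Nat.sInf_mem (hex y hy)
  have κlt : ∀ y n, n < κ y → y ∈ U n := fun y n hn => by
    by_contra h; exact Nat.notMem_of_lt_sInf hn h
  have κeq : ∀ y n, y ∉ U n → (∀ k < n, y ∈ U k) → κ y = n := fun y n h1 h2 => by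
    refine le_antisymm (Nat.sInf_le h1) ?_
    by_contra! hlt
    exact Nat.sInf_mem (⟨n, h1⟩ : {n | y ∉ U n}.Nonempty) (h2 _ hlt)
  set L : ℝ := M - m + 1 with hL
  have hLpos : 0 < L := by linarith [hm hx, hM hx]
  set s : ℝ → ℝ := fun y => 1 + (y - m) / L with hs
  have s1 : ∀ y ∈ A, 1 ≤ s y := fun y hy => by
    have : 0 ≤ (y - m) / L := div_nonneg (by linarith [hm hy]) hLpos.le
    simp only [hs]; linarith
  have s2 : ∀ y ∈ A, s y < 2 := fun y hy => by
    have : (y - m) / L < 1 := (div_lt_one hLpos).2 (by linarith [hM hy])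
    simp only [hs]; linarith
  -- Layer `n` is mapped affinely into `[t n, 2 * t n)`. The ratio `1/3` keeps these bands disjoint,
  -- and they shrink to `0`, the image of `x`.
  set t : ℕ → ℝ := fun n => (1 / 3 : ℝ) ^ n with ht
  have tpos : ∀ n, 0 < t n := fun n => by positivity
  have tlt : ∀ n k, n < k → 2 * t k < t n := fun n k hnk => by
    have : t k ≤ t (n + 1) := pow_le_pow_of_le_one (by norm_num) (by norm_num) hnk
    have e : t (n + 1) = t n * (1 / 3) := pow_succ _ _
    have := tpos n
    linarith
  set f : ℝ → ℝ := fun y => if y = x then 0 else s y * t (κ y) with hf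
  have fx : f x = 0 := if_pos rfl
  have fne : ∀ y, y ≠ x → f y = s y * t (κ y) := fun y hy => if_neg hy
  have fpos : ∀ y ∈ A, y ≠ x → 0 < f y := fun y hy hyx => by
    rw [fne y hyx]; exact mul_pos (by linarith [s1 y hy]) (tpos _)
  refine ⟨f, ?_, ?_, ?_⟩
  · intro y hy
    by_cases hyx : y = x
    · subst hyx
      rw [ContinuousWithinAt, fx, Metric.tendsto_nhds]
      intro ε hε
      obtain ⟨N, hN⟩ := exists_pow_lt_of_lt_one (half_pos hε) (by norm_num : (1 / 3 : ℝ) < 1)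
      have hev : ∀ᶠ z in 𝓝 y, ∀ k ∈ Finset.range N, z ∈ A → z ∈ U k :=
        (Finset.eventually_all _).2 fun k _ => (pU k).eventually_mem (xU k)
      filter_upwards [self_mem_nhdsWithin, nhdsWithin_le_nhds hev] with z hz hz'
      by_cases hzy : z = y
      · rw [hzy, fx]; simpa using hε
      · have hNκ : N ≤ κ z := by
          by_contra! hlt
          exact κmem z hzy (hz' _ (Finset.mem_range.2 hlt) hz)
        have h1 : t (κ z) ≤ t N := pow_le_pow_of_le_one (by norm_num) (by norm_num) hNκ
        have h2 : t N < ε / 2 := hN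
        rw [Real.dist_eq, sub_zero, abs_of_pos (fpos z hz hzy), fne z hzy]
        nlinarith [s2 z hz, s1 z hz, tpos (κ z)]
    -- Away from `x` the index `κ` is locally constant on `A`, so `f` is locally affine there.
    · have hev : ∀ᶠ z in 𝓝 y, ∀ k ∈ Finset.range (κ y), z ∈ A → z ∈ U k :=
        (Finset.eventually_all _).2 fun k hk =>
          (pU k).eventually_mem (κlt y k (Finset.mem_range.1 hk))
      have hev2 : ∀ᶠ z in 𝓝 y, z ∉ U (κ y) := (pU _).2.1.isOpen_compl.mem_nhds (κmem y hyx)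
      have hcs : ContinuousWithinAt (fun z => s z * t (κ y)) A y := by
        simp only [hs]; fun_prop
      refine hcs.congr_of_eventuallyEq ?_ (fne y hyx)
      filter_upwards [self_mem_nhdsWithin, nhdsWithin_le_nhds hev, nhdsWithin_le_nhds hev2]
        with z hz h1 h2
      have hzx : z ≠ x := fun e => h2 (e ▸ xU _)
      rw [fne z hzx, κeq z (κ y) h2 fun k hk => h1 k (Finset.mem_range.2 hk) hz]
  · intro y hy z hz hyz
    by_cases hyx : y = x <;> by_cases hzx : z = x
    · rw [hyx, hzx]
    · have := fpos z hz hzx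
      rw [← hyz, hyx, fx] at this; exact absurd this (lt_irrefl _)
    · have := fpos y hy hyx
      rw [hyz, hzx, fx] at this; exact absurd this (lt_irrefl _)
    · rw [fne y hyx, fne z hzx] at hyz
      have key : ∀ y ∈ A, ∀ z ∈ A, s y * t (κ y) = s z * t (κ z) → ¬ κ y < κ z := by
        intro y hy z hz e hlt
        have := tlt _ _ hlt
        have := s1 y hy
        have := s2 z hz
        nlinarith [tpos (κ y), tpos (κ z)]
      have e : κ y = κ z := le_antisymm (not_lt.1 (key z hz y hy hyz.symm)) (not_lt.1 (key y hy z hz hyz))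
      rw [e] at hyz
      have := mul_right_cancel₀ (tpos _).ne' hyz
      simp only [hs, add_right_inj] at this
      have := (div_left_inj' hLpos.ne').1 this
      linarith
  · intro y hy
    by_cases hyx : y = x
    · rw [hyx]
    · rw [fx]; exact (fpos y hy hyx).le

theorem exists_cut (h : ¬ uIcc x y ⊆ A) (hA : IsClosed A) (hx : x ∈ A) (hy : y ∈ A) :
    ∃ P, IsPiece P A ∧ x ∈ P ∧ y ∉ P := by
  obtain ⟨c, hc, hcA⟩ := not_subset.1 h
  have hcx : c ≠ x := fun e => hcA (e ▸ hx)
  have hcy : c ≠ y := fun e => hcA (e ▸ hy)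
  rcases le_total x y with k | k
  · rw [uIcc_of_le k] at hc
    exact ⟨_, isPiece_Iio hA hcA, ⟨hx, lt_of_le_of_ne hc.1 hcx.symm⟩, fun h => absurd h.2 (not_lt.2 hc.2)⟩
  · rw [uIcc_of_ge k] at hc
    exact ⟨_, isPiece_Ioi hA hcA, ⟨hx, lt_of_le_of_ne hc.2 hcx⟩, fun h => absurd h.2 (not_lt.2 hc.1)⟩

/-- Separate `x` from `y` by a clopen part `P`. Embed `P` in the negative numbers starting at `x`,
and the rest, reflected, in the positive numbers ending at `y`. -/
theorem Endable.exists_pair (hA : IsCompact A) (hx : x ∈ A) (hy : y ∈ A) (ex : Endable A x)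
    (ey : Endable A y) (h : ¬ uIcc x y ⊆ A) :
    ∃ Y g, EmbOn g A Y ∧ IsLeast Y (g x) ∧ IsGreatest Y (g y) := by
  obtain ⟨P, hP, hxP, hyP⟩ := exists_cut h hA.isClosed hx hy
  obtain ⟨f₁, c₁, i₁, m₁⟩ := ex
  obtain ⟨f₂, c₂, i₂, m₂⟩ := ey
  obtain ⟨M₁, hM₁⟩ := (hA.image_of_continuousOn c₁).bddAbove
  obtain ⟨M₂, hM₂⟩ := (hA.image_of_continuousOn c₂).bddAbove
  have b₁ : ∀ z ∈ A, f₁ z - M₁ - 1 < 0 := fun z hz => by linarith [hM₁ ⟨z, hz, rfl⟩]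
  have b₂ : ∀ z ∈ A, 0 < M₂ + 1 - f₂ z := fun z hz => by linarith [hM₂ ⟨z, hz, rfl⟩]
  have e₁ : EmbOn (fun z => f₁ z - M₁ - 1) P ((fun z => f₁ z - M₁ - 1) '' P) :=
    ⟨((c₁.mono hP.1).sub continuousOn_const).sub continuousOn_const,
      InjOn.bijOn_image fun z hz z' hz' e => i₁ (hP.1 hz) (hP.1 hz') (by simpa using e)⟩
  have e₂ : EmbOn (fun z => M₂ + 1 - f₂ z) (A \ P) ((fun z => M₂ + 1 - f₂ z) '' (A \ P)) :=
    ⟨continuousOn_const.sub (c₂.mono sdiff_subset),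
      InjOn.bijOn_image fun z hz z' hz' e => i₂ hz.1 hz'.1 (by simpa using e)⟩
  obtain ⟨g, hg, g₁, g₂⟩ := e₁.glue_disjoint e₂ hP.2.1 hP.2.2 disjoint_sdiff_right
    (disjoint_left.2 fun z hz hz' => by
      obtain ⟨p, hp, rfl⟩ := hz
      obtain ⟨q, hq, e⟩ := hz'
      have h1 := b₁ p (hP.1 hp)
      have h2 := b₂ q hq.1
      have e' : M₂ + 1 - f₂ q = f₁ p - M₁ - 1 := e
      linarith)
  rw [union_sdiff_cancel hP.1] at hg
  have hyQ : y ∈ A \ P := ⟨hy, hyP⟩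
  refine ⟨_, g, hg, ⟨hg.mem hx, ?_⟩, hg.mem hy, ?_⟩
  · rintro _ (⟨p, hp, rfl⟩ | ⟨q, hq, rfl⟩)
    · rw [g₁ x hxP]; show f₁ x - M₁ - 1 ≤ f₁ p - M₁ - 1; linarith [m₁ p (hP.1 hp)]
    · rw [g₁ x hxP]; exact ((b₁ x hx).trans (b₂ q hq.1)).le
  · rintro _ (⟨p, hp, rfl⟩ | ⟨q, hq, rfl⟩)
    · rw [g₂ y hyQ]; exact ((b₁ p (hP.1 hp)).trans (b₂ y hy)).le
    · rw [g₂ y hyQ]; show M₂ + 1 - f₂ q ≤ M₂ + 1 - f₂ y; linarith [m₂ q hq.1]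

end TameReal

/-! ### Tame sets are compact, and their endable points are homogeneous -/

namespace TameReal
open Set Filter Topology
open scoped Pointwise

variable {B₀ A B C W V U X Y Z T R Y' : Set ℝ} {f g g' : ℝ → ℝ}
  {a b c d u v x y z w l r l' r' a' b' : ℝ}

theorem isCompact_of_isTameInReal (hA : IsTameInReal A) : IsCompact A := by
  have hbd : ∃ K, IsCompact K ∧ A ⊆ K := by
    -- The bounded copy of `A` under `arctan` is an ambient image of `A`, so `A` is bounded.
    have hemb : IsEmbedding Real.arctan := Real.arctan_strictMono.isEmbedding_of_ordConnected
      (by rw [Real.range_arctan]; exact ordConnected_Ioo)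
    obtain ⟨f, hf⟩ := hA _ ⟨hemb.homeomorphImage A⟩
    refine ⟨f ⁻¹' Icc (-(Real.pi / 2)) (Real.pi / 2), f.isCompact_preimage.2 isCompact_Icc, ?_⟩
    intro x hx
    have : f x ∈ Real.arctan '' A := hf ▸ ⟨x, hx, rfl⟩
    obtain ⟨y, -, hy⟩ := this
    rw [mem_preimage, ← hy]
    exact ⟨(Real.arctan_mem_Ioo y).1.le, (Real.arctan_mem_Ioo y).2.le⟩
  obtain ⟨K, hK, hAK⟩ := hbd
  refine hK.of_isClosed_subset (isClosed_of_closure_subset fun p hp => ?_) hAK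
  by_contra hpA
  have hne : ∀ x ∈ A, x - p ≠ 0 := fun x hx h => hpA (sub_eq_zero.1 h ▸ hx)
  -- If `p` were a limit point outside `A`, inversion at `p` would give an unbounded copy, whereas
  -- ambient images of a bounded set are bounded.
  let φ : A ≃ₜ ((fun x => (x - p)⁻¹) '' A) :=
    { toFun := fun x => ⟨(x - p)⁻¹, x, x.2, rfl⟩
      invFun := fun y => ⟨p + y.1⁻¹, by
        obtain ⟨x, hx, h⟩ := y.2
        rw [← h]; simpa using hx⟩
      left_inv := fun x => by simp
      right_inv := fun y => by simp
      continuous_toFun := by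
        refine Continuous.subtype_mk ?_ _
        exact Continuous.inv₀ (by fun_prop) fun x => hne x x.2
      continuous_invFun := by
        refine Continuous.subtype_mk ?_ _
        refine continuous_const.add (Continuous.inv₀ continuous_subtype_val fun y => ?_)
        obtain ⟨x, hx, h⟩ := y.2
        rw [← h]; exact inv_ne_zero (hne x hx) }
  obtain ⟨f, hf⟩ := hA _ ⟨φ⟩
  obtain ⟨M, hM⟩ := isBounded_iff_forall_norm_le.1 (hK.image f.continuous).isBounded
  have hM0 : 0 < |M| + 1 := by positivity
  obtain ⟨x, hx, hxp⟩ := Metric.mem_closure_iff.1 hp (|M| + 1)⁻¹ (by positivity)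
  have h1 : ‖(x - p)⁻¹‖ ≤ M := by
    have : (x - p)⁻¹ ∈ f '' A := by rw [hf]; exact ⟨x, hx, rfl⟩
    exact hM _ (image_mono hAK this)
  rw [norm_inv, Real.norm_eq_abs] at h1
  rw [dist_comm, Real.dist_eq] at hxp
  have h2 : |M| + 1 < |x - p|⁻¹ := by
    rwa [lt_inv_comm₀ hM0 (abs_pos.2 (hne x hx))]
  linarith [le_abs_self M]

/-- The two copies differ by a homeomorphism of the line, which is monotone; a decreasing one is
composed with negation. -/
theorem exists_orderIso_of_isTameInReal (hA : IsTameInReal A) (hg : EmbOn g A Y)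
    (hg' : EmbOn g' A Y') : (∃ k : ℝ ≃o ℝ, k '' Y = Y') ∨ ∃ k : ℝ ≃o ℝ, k '' Y = -Y' := by
  have cA := isCompact_of_isTameInReal hA
  obtain ⟨h₁, e₁⟩ := hA Y (Iso.homeomorph ⟨g, hg⟩ cA)
  obtain ⟨h₂, e₂⟩ := hA Y' (Iso.homeomorph ⟨g', hg'⟩ cA)
  let k := h₁.symm.trans h₂
  have hk : k '' Y = Y' := by
    rw [← e₂, ← e₁, image_image]
    simp [k]
  rcases k.continuous.strictMono_of_inj k.injective with hm | hm
  · exact Or.inl ⟨hm.orderIsoOfSurjective _ k.surjective, hk⟩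
  · have hm' : StrictMono fun x => -k x := fun x y hxy => neg_lt_neg (hm hxy)
    have hs : Function.Surjective fun x => -k x := neg_surjective.comp k.surjective
    refine Or.inr ⟨hm'.orderIsoOfSurjective _ hs, ?_⟩
    rw [← hk]
    show (fun x => -k x) '' Y = -(k '' Y)
    rw [← image_neg_eq_neg, image_image]

/-- Compare a copy with ends `x`, `y` to a copy with ends `z`, `w`. The monotone map between them
matches the ends, directly or reversed. -/
theorem selfEquiv_of_pairs (hA : IsTameInReal A) (hx : x ∈ A) (hy : y ∈ A) (hz : z ∈ A)
    (hw : w ∈ A) (ex : Endable A x) (ey : Endable A y) (ez : Endable A z) (ew : Endable A w)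
    (hxy : ¬ uIcc x y ⊆ A) (hzw : ¬ uIcc z w ⊆ A) :
    (SelfEquiv A x z ∧ SelfEquiv A y w) ∨ (SelfEquiv A x w ∧ SelfEquiv A y z) := by
  have cA := isCompact_of_isTameInReal hA
  obtain ⟨Y, g, hg, lY, gY⟩ := ex.exists_pair cA hx hy ey hxy
  obtain ⟨Y', g', hg', lY', gY'⟩ := ez.exists_pair cA hz hw ew hzw
  obtain ⟨i, hi, i1, -⟩ := hg'.exists_inv cA
  rcases exists_orderIso_of_isTameInReal hA hg hg' with ⟨k, hk⟩ | ⟨k, hk⟩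
  · have hke : EmbOn k Y Y' := hk ▸ ⟨k.continuous.continuousOn, k.injective.injOn.bijOn_image⟩
    have e1 : k (g x) = g' z := (hk ▸ k.monotone.map_isLeast lY).unique lY'
    have e2 : k (g y) = g' w := (hk ▸ k.monotone.map_isGreatest gY).unique gY'
    have hσ := hi.comp (hke.comp hg)
    exact Or.inl ⟨⟨_, hσ, by simp [e1, i1 z hz]⟩, ⟨_, hσ, by simp [e2, i1 w hw]⟩⟩
  · have hke : EmbOn k Y (-Y') := hk ▸ ⟨k.continuous.continuousOn, k.injective.injOn.bijOn_image⟩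
    have e1 : k (g x) = -g' w := (hk ▸ k.monotone.map_isLeast lY).unique
      ⟨by simpa using gY'.1, fun q hq => by linarith [gY'.2 (show -q ∈ Y' from hq)]⟩
    have e2 : k (g y) = -g' z := (hk ▸ k.monotone.map_isGreatest gY).unique
      ⟨by simpa using lY'.1, fun q hq => by linarith [lY'.2 (show -q ∈ Y' from hq)]⟩
    have hn : EmbOn (fun x => -x) (-Y') Y' := by simpa using embOn_neg (-Y')
    have hσ := hi.comp (hn.comp (hke.comp hg))
    exact Or.inr ⟨⟨_, hσ, by simp [e1, i1 w hw]⟩, ⟨_, hσ, by simp [e2, i1 z hz]⟩⟩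

/-- Comparing the pairs `(x, y)` and `(y, z)` gives `x ~ y` or `x ~ z`. In the second case, `(x, z)`
against `(x, y)` gives `z ~ y` or `x ~ y`. -/
theorem selfEquiv_of_three (hA : IsTameInReal A) (hx : x ∈ A) (hy : y ∈ A) (hz : z ∈ A)
    (ex : Endable A x) (ey : Endable A y) (ez : Endable A z)
    (hxy : ¬ uIcc x y ⊆ A) (hyz : ¬ uIcc y z ⊆ A) (hxz : ¬ uIcc x z ⊆ A) : SelfEquiv A x y := by
  have cA := isCompact_of_isTameInReal hA
  rcases selfEquiv_of_pairs hA hx hy hy hz ex ey ey ez hxy hyz with ⟨h, -⟩ | ⟨h, -⟩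
  · exact h
  rcases selfEquiv_of_pairs hA hx hz hx hy ex ez ex ey hxz hxy with ⟨-, h'⟩ | ⟨h', -⟩
  · exact h.trans h'
  · exact h'

/-- `A` has at most two components. -/
def Small (A : Set ℝ) : Prop :=
  ∀ x ∈ A, ∀ y ∈ A, ∀ z ∈ A, uIcc x y ⊆ A ∨ uIcc y z ⊆ A ∨ uIcc x z ⊆ A

theorem exists_leftIso (hA : IsCompact A) (hc : c ∉ A) (hx : x ∈ A) (hcx : c < x) :
    ∃ m, LeftIso A m ∧ c < m ∧ m ≤ x := by
  obtain ⟨m, hm, hm'⟩ := (hA.inter_right (isClosed_Ici (a := c))).exists_isLeast ⟨x, hx, hcx.le⟩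
  have hcm : c < m := lt_of_le_of_ne hm.2 fun e => hc (e ▸ hm.1)
  exact ⟨m, ⟨hm.1, c, hcm, fun y hy h => hm' ⟨hy, h.le⟩⟩, hcm, hm' ⟨hx, hcx.le⟩⟩

theorem exists_notMem_of_sep (hx : x ∈ A) (hy : y ∈ A) (hxy : x < y) (h : ¬ uIcc x y ⊆ A) :
    ∃ c, x < c ∧ c < y ∧ c ∉ A := by
  obtain ⟨c, hc, hcA⟩ := not_subset.1 h
  rw [uIcc_of_le hxy.le] at hc
  exact ⟨c, lt_of_le_of_ne hc.1 fun e => hcA (e ▸ hx), lt_of_le_of_ne hc.2 fun e => hcA (e ▸ hy), hcA⟩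

theorem sep_of_notMem (hc : c ∉ A) (h1 : x < c) (h2 : c < y) : ¬ uIcc x y ⊆ A := fun h =>
  hc (h (by rw [uIcc_of_le (h1.trans h2).le]; exact ⟨h1.le, h2.le⟩))

/-- The first point of `A` after a gap is isolated from the left, hence endable; three separated
points yield three such points, one of them the first point after a number below `A`. -/
theorem exists_three_endable (hA : IsCompact A) (h : ¬ Small A) :
    ∃ x y z, x ∈ A ∧ y ∈ A ∧ z ∈ A ∧ Endable A x ∧ Endable A y ∧ Endable A z ∧
      ¬ uIcc x y ⊆ A ∧ ¬ uIcc y z ⊆ A ∧ ¬ uIcc x z ⊆ A := by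
  have sorted : ∀ x ∈ A, ∀ y ∈ A, ∀ z ∈ A, x < y → y < z → ¬ uIcc x y ⊆ A → ¬ uIcc y z ⊆ A →
      ∃ x y z, x ∈ A ∧ y ∈ A ∧ z ∈ A ∧ Endable A x ∧ Endable A y ∧ Endable A z ∧
        ¬ uIcc x y ⊆ A ∧ ¬ uIcc y z ⊆ A ∧ ¬ uIcc x z ⊆ A := by
    intro x hx y hy z hz hxy hyz h1 h2
    obtain ⟨c, c1, c2, c3⟩ := exists_notMem_of_sep hx hy hxy h1
    obtain ⟨d, d1, d2, d3⟩ := exists_notMem_of_sep hy hz hyz h2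
    obtain ⟨e, he⟩ := hA.bddBelow
    obtain ⟨p, p1, p2, p3⟩ := exists_leftIso hA (c := e - 1)
      (fun h => by linarith [he h]) hx (by linarith [he hx])
    obtain ⟨q, q1, q2, q3⟩ := exists_leftIso hA c3 hy c2
    obtain ⟨r, r1, r2, r3⟩ := exists_leftIso hA d3 hz d2
    exact ⟨p, q, r, p1.1, q1.1, r1.1, p1.endable hA, q1.endable hA, r1.endable hA,
      sep_of_notMem c3 (by linarith) q2, sep_of_notMem d3 (by linarith) r2,
      sep_of_notMem c3 (by linarith) (by linarith)⟩
  simp only [Small] at h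
  push Not at h
  obtain ⟨x, hx, y, hy, z, hz, h1, h2, h3⟩ := h
  have n1 : x ≠ y := fun e => h1 (by subst e; simpa using hx)
  have n2 : y ≠ z := fun e => h2 (by subst e; simpa using hy)
  have n3 : x ≠ z := fun e => h3 (by subst e; simpa using hx)
  have h1' : ¬ uIcc y x ⊆ A := by rwa [uIcc_comm]
  have h2' : ¬ uIcc z y ⊆ A := by rwa [uIcc_comm]
  have h3' : ¬ uIcc z x ⊆ A := by rwa [uIcc_comm]
  rcases lt_or_gt_of_ne n1 with k1 | k1 <;> rcases lt_or_gt_of_ne n2 with k2 | k2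
  · exact sorted x hx y hy z hz k1 k2 h1 h2
  · rcases lt_or_gt_of_ne n3 with k3 | k3
    · exact sorted x hx z hz y hy k3 k2 h3 h2'
    · exact sorted z hz x hx y hy k3 k1 h3' h1
  · rcases lt_or_gt_of_ne n3 with k3 | k3
    · exact sorted y hy x hx z hz k1 k3 h1' h3
    · exact sorted y hy z hz x hx k2 k3 h2 h3'
  · exact sorted z hz y hy x hx k2 k1 h2' h1'

/-- Take three endable points in different components. If `x` and `y` were not equivalent,
`selfEquiv_of_three` would place each of the three in the component of `x` or of `y`, which is too
few components. -/
theorem selfEquiv_of_endable (hA : IsTameInReal A) (hS : ¬ Small A) (hx : x ∈ A) (hy : y ∈ A)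
    (ex : Endable A x) (ey : Endable A y) (hxy : ¬ uIcc x y ⊆ A) : SelfEquiv A x y := by
  have cA := isCompact_of_isTameInReal hA
  obtain ⟨p, q, r, hp, hq, hr, ep, eq, er, h1, h2, h3⟩ := exists_three_endable cA hS
  have tr : ∀ {s t w : ℝ}, uIcc s w ⊆ A → uIcc t w ⊆ A → uIcc s t ⊆ A := fun {s t w} k k' =>
    uIcc_subset_uIcc_union_uIcc.trans (union_subset k (by rwa [uIcc_comm]))
  have key : ∀ z ∈ A, Endable A z → ¬ SelfEquiv A x y → uIcc z x ⊆ A ∨ uIcc z y ⊆ A := by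
    intro z hz ez hn
    by_contra! hcon
    exact hn (selfEquiv_of_three hA hx hy hz ex ey ez hxy (by rw [uIcc_comm]; exact hcon.2)
      (by rw [uIcc_comm]; exact hcon.1))
  by_contra hn
  rcases key p hp ep hn with k1 | k1 <;> rcases key q hq eq hn with k2 | k2 <;>
    rcases key r hr er hn with k3 | k3
  · exact h1 (tr k1 k2)
  · exact h1 (tr k1 k2)
  · exact h3 (tr k1 k3)
  · exact h2 (tr k2 k3)
  · exact h2 (tr k2 k3)
  · exact h3 (tr k1 k3)
  · exact h1 (tr k1 k2)
  · exact h1 (tr k1 k2)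

/-! ### The block structure of tame sets -/

theorem Base.of_selfEquiv (hA : IsCompact A) (h : Base B₀ A x) (he : SelfEquiv A x y) :
    Base B₀ A y := by
  obtain ⟨W, hW, hx, hi⟩ := h
  obtain ⟨σ, hσ, rfl⟩ := he
  exact ⟨σ '' W, hσ.isPiece_image hA hW, ⟨x, hx, rfl⟩,
    (Iso.symm ⟨σ, hσ.image hW.1⟩ (hW.isCompact hA)).trans hi⟩

theorem Base.of_uIcc (h : Base B₀ A x) (hxy : uIcc x y ⊆ A) : Base B₀ A y := by
  obtain ⟨W, hW, hx, hi⟩ := h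
  exact ⟨W, hW, hW.isPreconnected_subset isPreconnected_uIcc hxy left_mem_uIcc hx right_mem_uIcc, hi⟩

/-- A connected block cannot contain the end of a fat component, where points and gaps of `A`
accumulate; a totally disconnected one cannot contain an interval. -/
theorem BlockModel.not_base_of_fat (hBM : BlockModel B₀) (hA : IsCompact A) (hF : Fat A a b)
    (hx : x ∈ Icc a b) : ¬ Base B₀ A x := by
  rintro ⟨W, hW, hxW, f, hf⟩
  have hsub := hW.comp_subset hF.toIsComp hx hxW
  rcases hBM.alt with hp | hp
  · obtain ⟨g, hg, -⟩ := hf.exists_inv (hW.isCompact hA)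
    have hWp : IsPreconnected W := hg.image_eq ▸ hp.image g hg.1
    obtain ⟨ε, hε, hεW⟩ := hW.exists_Ioo (hsub hF.mem_left)
    obtain ⟨y, hy, h1, h2⟩ := hF.lacc (a - ε) (by linarith)
    obtain ⟨c, c1, c2, c3⟩ := hF.lgap y h2
    have := hWp.Icc_subset (hεW y hy h1 (by linarith)) (hsub hF.mem_left)
    exact c3 (hW.1 (this ⟨c1.le, c2.le⟩))
  · have hb : b ∈ W := hsub (right_mem_Icc.2 hF.le)
    have hi : IsPreconnected (f '' Icc a b) := isPreconnected_Icc.image f (hf.1.mono hsub)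
    have hfs : f '' Icc a b ⊆ B₀ := hf.image_eq ▸ image_mono hsub
    have ma : f a ∈ f '' Icc a b := ⟨a, hF.mem_left, rfl⟩
    have mb : f b ∈ f '' Icc a b := ⟨b, right_mem_Icc.2 hF.le, rfl⟩
    have hne : f a ≠ f b := fun e => hF.lt.ne (hf.2.injOn (hsub hF.mem_left) hb e)
    rcases lt_or_gt_of_ne hne with k | k
    · exact hp _ _ k ((hi.Icc_subset ma mb).trans hfs)
    · exact hp _ _ k ((hi.Icc_subset mb ma).trans hfs)

theorem not_leftIso (ha : a ∈ A) (h : ¬ LeftIso A a) : ∀ u < a, ∃ y ∈ A, u < y ∧ y < a := by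
  intro u hu
  by_contra! hcon
  exact h ⟨ha, u, hu, fun y hy h => hcon y hy h⟩

theorem fat_of_not_leftIso (hc : IsComp A a b) (hab : a < b) (h1 : ¬ LeftIso A a)
    (h2 : ¬ LeftIso (-A) (-b)) : Fat A a b where
  toIsComp := hc
  lt := hab
  lacc := not_leftIso hc.left_mem h1
  racc v hv := by
    obtain ⟨y, hy, k1, k2⟩ := not_leftIso (A := -A) (by simpa using hc.right_mem) h2 (-v)
      (neg_lt_neg hv)
    exact ⟨-y, hy, by linarith, by linarith⟩

/-- A singleton is endable, and so is an end at which `A` does not accumulate from outside. If there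
is neither, the component is fat. -/
theorem IsComp.endable_or_fat (hA : IsCompact A) (hc : IsComp A a b) :
    (∃ x ∈ Icc a b, Endable A x) ∨ Fat A a b := by
  rcases hc.le.eq_or_lt with rfl | hab
  · exact Or.inl ⟨a, by simp, hc.endable hA⟩
  by_cases h1 : LeftIso A a
  · exact Or.inl ⟨a, left_mem_Icc.2 hc.le, h1.endable hA⟩
  by_cases h2 : LeftIso (-A) (-b)
  · exact Or.inl ⟨b, right_mem_Icc.2 hc.le, (h2.endable hA.neg).of_neg⟩
  · exact Or.inr (fat_of_not_leftIso hc hab h1 h2)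

/-- Every component that is not fat contains an endable point, to which the block at `x` is
transported by a self-homeomorphism, unless that point lies in the component of `x` itself. -/
theorem good_of_endable_base (hA : IsTameInReal A) (hS : ¬ Small A) (hBM : BlockModel B₀)
    (hx : x ∈ A) (ex : Endable A x) (bx : Base B₀ A x) : Good B₀ A := by
  have cA := isCompact_of_isTameInReal hA
  refine ⟨cA, fun y hy => ?_, fun a b hF z hz => hBM.not_base_of_fat cA hF hz⟩
  obtain ⟨a, b, hc, hay, hyb⟩ := exists_isComp cA hy
  rcases hc.endable_or_fat cA with ⟨z, hz, ez⟩ | hF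
  · left
    have bz : Base B₀ A z := by
      by_cases h : uIcc x z ⊆ A
      · exact bx.of_uIcc h
      · exact bx.of_selfEquiv cA (selfEquiv_of_endable hA hS hx (hc.sub hz) ex ez h)
    exact bz.of_uIcc ((uIcc_subset_Icc hz ⟨hay, hyb⟩).trans hc.sub)
  · exact Or.inr ⟨a, b, hF, hay, hyb⟩

theorem isPiece_Icc_of_leftIso (hA : IsCompact A) (hc : IsComp A a b) (h1 : LeftIso A a)
    (h2 : LeftIso (-A) (-b)) : IsPiece (Icc a b) A := by
  obtain ⟨-, u, hu, h1⟩ := h1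
  obtain ⟨-, v, hv, h2⟩ := h2
  refine ⟨hc.sub, isClosed_Icc, ?_⟩
  have : A \ Icc a b = A ∩ (Iic u ∪ Ici (-v)) := by
    ext x
    simp only [Set.mem_sdiff, mem_Icc, mem_inter_iff, mem_union, mem_Iic, mem_Ici, not_and, not_le]
    constructor
    · rintro ⟨hx, h⟩
      refine ⟨hx, ?_⟩
      by_contra! hcon
      have k1 := h1 x hx hcon.1
      have k2 := h2 (-x) (by simpa using hx) (by linarith)
      linarith [h k1]
    · rintro ⟨hx, h⟩
      refine ⟨hx, fun k => ?_⟩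
      rcases h with h | h <;> linarith
  rw [this]
  exact hA.isClosed.inter (isClosed_Iic.union isClosed_Ici)

theorem iso_Icc (hab : a ≤ b) : Iso (Icc a b) {0} ∨ Iso (Icc a b) (Icc 0 1) := by
  rcases hab.eq_or_lt with rfl | h
  · exact Or.inl ⟨fun _ => 0, by rw [Icc_self]; exact ⟨continuousOn_const, by simp [BijOn, InjOn, SurjOn]⟩⟩
  · obtain ⟨f, hf, -⟩ := exists_embOn_Icc h (zero_lt_one' ℝ)
    exact Or.inr ⟨f, hf⟩

theorem Small.locallyIn (hA : IsCompact A) (h : Small A) : LocallyIn {{0}, Icc 0 1} A := by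
  -- Accumulation at `a` would give infinitely many components: `y`, `z` and `a` are already
  -- separated by the gap points `c` and `d`.
  have left : ∀ {A : Set ℝ} {a : ℝ}, Small A → a ∈ A → LGap A a → LeftIso A a := by
    intro A a h ha hg
    by_contra hn
    have hn := not_leftIso ha hn
    obtain ⟨y, hy, -, hya⟩ := hn (a - 1) (by linarith)
    obtain ⟨c, c1, c2, c3⟩ := hg y hya
    obtain ⟨z, hz, hz1, hz2⟩ := hn c c2
    obtain ⟨d, d1, d2, d3⟩ := hg z hz2
    rcases h y hy z hz a ha with k | k | k
    · exact sep_of_notMem c3 c1 hz1 k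
    · exact sep_of_notMem d3 d1 d2 k
    · exact sep_of_notMem c3 c1 c2 k
  have hneg : Small (-A) := fun x hx y hy z hz => by
    have e : ∀ p q, uIcc (-p) (-q) ⊆ A → uIcc p q ⊆ -A := fun p q h w hw =>
      by
        refine h (?_ : -w ∈ _)
        rw [mem_uIcc] at hw ⊢
        rcases hw with hw | hw
        · exact Or.inr ⟨by linarith, by linarith⟩
        · exact Or.inl ⟨by linarith, by linarith⟩
    rcases h (-x) hx (-y) hy (-z) hz with k | k | k
    · exact Or.inl (e _ _ k)
    · exact Or.inr (Or.inl (e _ _ k))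
    · exact Or.inr (Or.inr (e _ _ k))
  intro x hx
  obtain ⟨a, b, hc, hax, hxb⟩ := exists_isComp hA hx
  have hP := isPiece_Icc_of_leftIso hA hc (left h hc.left_mem hc.lgap)
    (left hneg (by simpa using hc.right_mem) hc.rgap.neg)
  rcases iso_Icc hc.le with hi | hi
  · exact ⟨{0}, by simp, _, {0}, hP, ⟨hax, hxb⟩, .refl isClosed_singleton, hi⟩
  · exact ⟨Icc 0 1, by simp, _, Icc 0 1, hP, ⟨hax, hxb⟩, .refl isClosed_Icc, hi⟩

/-- A block model occurring in tame sets. -/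
def IsModel (C : Set ℝ) : Prop :=
  C = {0} ∨ C = Icc 0 1 ∨ (NoFreeEnd C ∧ ∀ a b, ¬ Fat C a b)

theorem IsModel.blockModel (h : IsModel C) : BlockModel C := by
  rcases h with rfl | rfl | ⟨h1, h2⟩
  · exact blockModel_of_isPreconnected isCompact_singleton isPreconnected_singleton
  · exact blockModel_of_isPreconnected isCompact_Icc isPreconnected_Icc
  · exact blockModel_of_no_fat h1 h2

/-- The interval is carried to a connected subset of `A` through `x`, which must be `{x}`;
injectivity makes the interval a point. -/
theorem IsComp.of_selfEquiv (hA : IsCompact A) (h : IsComp A x x) (he : SelfEquiv A x y)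
    (hy : IsComp A a b) (hya : y ∈ Icc a b) : a = b := by
  by_contra hne
  have hab := lt_of_le_of_ne hy.le hne
  obtain ⟨σ, hσ, hσy⟩ := he.symm hA h.left_mem
  have hsub : σ '' Icc a b ⊆ A := hσ.image_eq ▸ image_mono hy.sub
  have hp : IsPreconnected (σ '' Icc a b) := isPreconnected_Icc.image σ (hσ.1.mono hy.sub)
  have key : ∀ w ∈ Icc a b, σ w = x := fun w hw => by
    have := h.mem_of_uIcc (x := x) (y := σ w) (by simp)
      ((hp.ordConnected.uIcc_subset ⟨y, hya, hσy⟩ ⟨w, hw, rfl⟩).trans hsub)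
    exact le_antisymm this.2 this.1
  exact hne (hσ.2.injOn hy.left_mem hy.right_mem
    ((key a (left_mem_Icc.2 hy.le)).trans (key b (right_mem_Icc.2 hy.le)).symm))

/-- If some endable point has a model block, homogeneity spreads this block over all components that
are not fat. Otherwise no component is clopen, every endable point is a singleton component, and fat
components must be dense. -/
theorem exists_model_or_noFreeEnd (hA : IsTameInReal A) (hS : ¬ Small A) :
    (∃ C, IsModel C ∧ Good C A) ∨ (NoFreeEnd A ∧ FatDense A) := by
  have cA := isCompact_of_isTameInReal hA
  by_cases hex : ∃ C, IsModel C ∧ ∃ x ∈ A, Endable A x ∧ Base C A x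
  · obtain ⟨C, hC, x, hx, ex, bx⟩ := hex
    exact Or.inl ⟨C, hC, good_of_endable_base hA hS hC.blockModel hx ex bx⟩
  right
  push Not at hex
  have hne : A.Nonempty := by
    obtain ⟨x, y, z, hx, -⟩ := exists_three_endable cA hS
    exact ⟨x, hx⟩
  have noPiece : ∀ a b, IsComp A a b → LeftIso A a → ¬ LeftIso (-A) (-b) := by
    intro a b hc h1 h2
    have hP := isPiece_Icc_of_leftIso cA hc h1 h2
    rcases iso_Icc hc.le with hi | hi
    · exact hex {0} (Or.inl rfl) a h1.1 (h1.endable cA) ⟨_, hP, left_mem_Icc.2 hc.le, hi⟩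
    · exact hex _ (Or.inr (Or.inl rfl)) a h1.1 (h1.endable cA) ⟨_, hP, left_mem_Icc.2 hc.le, hi⟩
  -- If all components were nondegenerate, one of them would be isolated, hence clopen.
  have hsing : ∃ s, IsComp A s s := by
    by_contra! hcon
    obtain ⟨x, hx, u, v, hu, hv, huA, hvA, hiso⟩ := exists_isolated cA hne (Subset.refl A)
      Subset.rfl cA.isClosed fun z hz => by
        obtain ⟨a, b, hc, h1, h2⟩ := exists_isComp cA hz
        exact ⟨a, b, lt_of_le_of_ne hc.le fun e => hcon a (by rw [← e] at hc; exact hc), h1, h2, hc.sub⟩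
    obtain ⟨a, b, hc, h1, h2⟩ := exists_isComp cA hx
    have hua : u < a := lt_of_notMem huA hc.sub (hu.trans_le h2)
    have hbv : b < v := gt_of_notMem hvA hc.sub (h1.trans_lt hv)
    have hin : ∀ y ∈ A, u < y → y < v → y ∈ Icc a b := fun y hy k1 k2 =>
      hc.mem_of_uIcc ⟨h1, h2⟩ (hiso y hy k1 k2)
    refine noPiece a b hc ⟨hc.left_mem, u, hua, fun y hy hy' => ?_⟩
      ⟨by simpa using hc.right_mem, -v, neg_lt_neg hbv, fun y hy hy' => ?_⟩
    · by_contra! hlt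
      exact absurd (hin y hy hy' (by linarith [hc.le])).1 (not_le.2 hlt)
    · by_contra! hlt
      exact absurd (hin (-y) hy (by linarith [hc.le]) (by linarith)).2 (by linarith)
  obtain ⟨s, hs⟩ := hsing
  have endSing : ∀ a b, IsComp A a b → ∀ x ∈ Icc a b, Endable A x → a = b := by
    intro a b hc x hx ex
    by_cases h : uIcc s x ⊆ A
    · have := hs.mem_of_uIcc (by simp) h
      have e : x = s := le_antisymm this.2 this.1
      have := hs.eq_of_mem hc (x := s) (by simp) (e ▸ hx)
      rw [← this.1, ← this.2]
    · exact hs.of_selfEquiv cA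
        (selfEquiv_of_endable hA hS hs.left_mem (hc.sub hx) (hs.endable cA) ex h) hc hx
  have hcover : ∀ x ∈ A, IsComp A x x ∨ ∃ a b, Fat A a b ∧ x ∈ Icc a b := by
    intro x hx
    obtain ⟨a, b, hc, h1, h2⟩ := exists_isComp cA hx
    rcases hc.endable_or_fat cA with ⟨z, hz, ez⟩ | hF
    · left
      have e := endSing a b hc z hz ez
      subst e
      have : x = a := le_antisymm h2 h1
      rwa [this]
    · exact Or.inr ⟨a, b, hF, h1, h2⟩
  have hacc : ∀ x ∈ A, ∀ u v, u < x → x < v → ∃ y ∈ A, u < y ∧ y < v ∧ y ≠ x := by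
    intro x hx u v hu hv
    rcases hcover x hx with hc | ⟨a, b, hF, hxF⟩
    · by_cases h1 : LeftIso A x
      · have h2 := noPiece x x hc h1
        obtain ⟨y, hy, k1, k2⟩ := not_leftIso (A := -A) (by simpa using hx) h2 (-v) (by linarith)
        exact ⟨-y, hy, by linarith, by linarith, by linarith⟩
      · obtain ⟨y, hy, k1, k2⟩ := not_leftIso hx h1 u hu
        exact ⟨y, hy, k1, k2.trans hv, k2.ne⟩
    · rcases hxF.2.eq_or_lt with rfl | hlt
      · obtain ⟨y, hy, k1, k2⟩ := hF.racc v hv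
        exact ⟨y, hy, hu.trans k1, k2, k1.ne'⟩
      · obtain ⟨y, k1, k2⟩ := exists_between (lt_min hlt hv)
        have := lt_min_iff.1 k2
        exact ⟨y, hF.sub ⟨by linarith [hxF.1], this.1.le⟩, hu.trans k1, this.2, k1.ne'⟩
  refine ⟨⟨cA, hne, hcover, hacc⟩, fun u v hu hv hWne => ?_⟩
  -- A window without fat components is a Cantor set, that is, a model block around an endable
  -- point, which was excluded.
  by_contra! hcon
  have hP := isPiece_Ioo cA.isClosed hu hv
  have hcomp : ∀ x ∈ A ∩ Ioo u v, IsComp A x x := fun x hx =>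
    (hcover x hx.1).resolve_right fun ⟨a, b, hF, hxF⟩ =>
      absurd (hcon a b hF (lt_of_notMem hu hF.sub (hx.2.1.trans_le hxF.2)))
        (not_le.2 (gt_of_notMem hv hF.sub (hxF.1.trans_lt hx.2.2)))
  have hW : NoFreeEnd (A ∩ Ioo u v) := by
    refine ⟨hP.isCompact cA, hWne, fun x hx => Or.inl ((hcomp x hx).mono inter_subset_left hx), ?_⟩
    intro x hx p q hp hq
    obtain ⟨y, hy, k1, k2, k3⟩ := hacc x hx.1 (max p u) (min q v) (max_lt hp hx.2.1)
      (lt_min hq hx.2.2)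
    rw [max_lt_iff] at k1
    rw [lt_min_iff] at k2
    exact ⟨y, ⟨hy, k1.2, k2.2⟩, k1.1, k2.1, k3⟩
  have hWf : ∀ a b, ¬ Fat (A ∩ Ioo u v) a b := fun a b hF =>
    (hcomp a hF.left_mem).not_Icc hF.lt (hF.sub.trans inter_subset_left)
  obtain ⟨x, hx⟩ := hWne
  exact hex _ (Or.inr (Or.inr ⟨hW, hWf⟩)) x hx.1 ((hcomp x hx).endable cA) ⟨_, hP, hx, .refl _⟩

end TameReal

/-! ### A good tame set has at most one non-flippable component -/

namespace TameReal
open Set Filter Topology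
open scoped Pointwise

/-- `[a, b]` is a component with accumulation on both sides whose two germs differ. -/
def NonFlip (A : Set ℝ) (a b : ℝ) : Prop := Fat A a b ∧ ¬ Flip A a b

/-- The germ of `A` at `a` is the left germ of the first `NonFlip` component of `Y`. -/
def FirstGerm (A : Set ℝ) (a : ℝ) (Y : Set ℝ) : Prop :=
  ∃ p q, NonFlip Y p q ∧ (∀ p' q', NonFlip Y p' q' → p ≤ p') ∧ LGerm A a Y p

variable {B₀ A B C W V U X Y Z T : Set ℝ} {f g : ℝ → ℝ} {a b c d u v x y a' b' : ℝ}

theorem Fat.congr (h : Fat A a b) (e : A ∩ Ioo u v = B ∩ Ioo u v) (hu : u < a) (hv : b < v) :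
    Fat B a b := by
  have key : ∀ x, u < x → x < v → (x ∈ A ↔ x ∈ B) := fun x h1 h2 => by
    have := Set.ext_iff.1 e x
    simpa [h1, h2] using this
  have hab := h.le
  refine { le := h.le, sub := fun x hx => ?_, lgap := fun w hw => ?_, rgap := fun w hw => ?_,
           lt := h.lt, lacc := fun w hw => ?_, racc := fun w hw => ?_ }
  · exact (key x (hu.trans_le hx.1) (hx.2.trans_lt hv)).1 (h.sub hx)
  · obtain ⟨c, h1, h2, h3⟩ := h.lgap (max u w) (max_lt hu hw)
    obtain ⟨h4, h5⟩ := max_lt_iff.1 h1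
    exact ⟨c, h5, h2, fun hc => h3 ((key c h4 (by linarith)).2 hc)⟩
  · obtain ⟨c, h1, h2, h3⟩ := h.rgap (min v w) (lt_min hv hw)
    obtain ⟨h4, h5⟩ := lt_min_iff.1 h2
    exact ⟨c, h1, h5, fun hc => h3 ((key c (by linarith) h4).2 hc)⟩
  · obtain ⟨c, h1, h2, h3⟩ := h.lacc (max u w) (max_lt hu hw)
    obtain ⟨h4, h5⟩ := max_lt_iff.1 h2
    exact ⟨c, (key c h4 (by linarith)).1 h1, h5, h3⟩
  · obtain ⟨c, h1, h2, h3⟩ := h.racc (min v w) (lt_min hv hw)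
    obtain ⟨h4, h5⟩ := lt_min_iff.1 h3
    exact ⟨c, (key c (by linarith) h4).1 h1, h2, h5⟩

theorem NonFlip.congr (hA : IsCompact A) (hB : IsCompact B) (h : NonFlip A a b)
    (e : A ∩ Ioo u v = B ∩ Ioo u v) (hu : u < a) (hv : b < v) : NonFlip B a b := by
  refine ⟨h.1.congr e hu hv, fun hf => h.2 ?_⟩
  have hab := h.1.le
  have h1 := LGerm.congr hA.isClosed hB.isClosed h.1.left_mem hu e (by linarith) h.1.lgap
  have e' : -A ∩ Ioo (-v) (-u) = -B ∩ Ioo (-v) (-u) := by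
    have := congrArg (fun s : Set ℝ => -s) e
    simpa [inter_neg] using this
  have h2 := LGerm.congr hA.neg.isClosed hB.neg.isClosed h.1.neg.left_mem (neg_lt_neg hv) e'
    (by linarith) h.1.neg.lgap
  exact (h1.trans hf hA hB).trans (h2.symm hA.neg) hA hB.neg

theorem NonFlip.neg (hA : IsCompact A) (h : NonFlip A a b) : NonFlip (-A) (-b) (-a) :=
  ⟨h.1.neg, fun hf => h.2 (by simpa using hf.neg hA.neg)⟩

theorem NonFlip.orderIso (hA : IsCompact A) (h : NonFlip A a b) (k : ℝ ≃o ℝ) :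
    NonFlip (k '' A) (k a) (k b) := by
  have hF := h.1.orderIso k
  refine ⟨hF, fun hf => h.2 ?_⟩
  have := hf.orderIso (hA.image k.continuous) hF.left_mem hF.right_mem k.symm
  simpa [image_image] using this

theorem FirstGerm.orderIso (hA : IsCompact A) (hY : IsCompact Y) (h : FirstGerm A a Y)
    (k : ℝ ≃o ℝ) : FirstGerm A a (k '' Y) := by
  obtain ⟨p, q, h1, h2, h3⟩ := h
  refine ⟨k p, k q, h1.orderIso hY k, fun p' q' h' => ?_,
    h3.trans (LGerm.orderIso hY h1.1.left_mem k) hA hY⟩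
  have := h'.orderIso (hY.image k.continuous) k.symm
  exact k.le_symm_apply.1 (h2 _ (k.symm q') (by simpa [image_image] using this))

theorem FirstGerm.unique (hA : IsCompact A) (hB : IsCompact B) (hY : IsCompact Y)
    (h : FirstGerm A a Y) (h' : FirstGerm B b Y) : LGerm A a B b := by
  obtain ⟨p, q, h1, h2, h3⟩ := h
  obtain ⟨p', q', h1', h2', h3'⟩ := h'
  obtain rfl := le_antisymm (h2 _ _ h1') (h2' _ _ h1)
  exact h3.trans (h3'.symm hB) hA hY

/-- The initial part of `Y` is a translate of a window of `A` whose only non-flippable component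
starts at `a`. Both the germ and non-flippability are visible inside the window, so this component
comes first in `Y`. -/
theorem firstGerm_of_window (hA : IsCompact A) (hY : IsCompact Y) (h : NonFlip A a b)
    (hu : u < a) (hv : b < v)
    (huniq : ∀ a' b', NonFlip A a' b' → u < a' → a' < v → a' = a)
    (hc : ∀ x < v, x + c ∈ Y ↔ x ∈ A ∧ u < x) : FirstGerm A a Y := by
  have hab := h.1.le
  have main : ∀ {Y : Set ℝ}, IsCompact Y → (∀ x < v, x ∈ Y ↔ x ∈ A ∧ u < x) →
      FirstGerm A a Y := by
    intro Y hY hc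
    have e : A ∩ Ioo u v = Y ∩ Ioo u v := by
      ext x; constructor
      · exact fun hx => ⟨(hc x hx.2.2).2 ⟨hx.1, hx.2.1⟩, hx.2⟩
      · exact fun hx => ⟨((hc x hx.2.2).1 hx.1).1, hx.2⟩
    have hN := h.congr hA hY e hu hv
    refine ⟨a, b, hN, fun p q hp => ?_,
      LGerm.congr hA.isClosed hY.isClosed h.1.left_mem hu e (by linarith) h.1.lgap⟩
    by_contra hlt
    push Not at hlt
    have hqa : q < a := by
      by_contra hq
      push Not at hq
      have := hp.1.toIsComp.eq_of_mem hN.1.toIsComp (x := a) ⟨hlt.le, hq⟩ hN.1.mem_left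
      exact hlt.ne this.1
    have hup := ((hc p (by linarith)).1 hp.1.left_mem).2
    have := huniq p q (hp.congr hY hA e.symm hup (by linarith)) hup (by linarith)
    exact hlt.ne this
  have := (main (hY.image (OrderIso.addRight (-c)).continuous) (fun x hx => by
    rw [← hc x hx]
    constructor
    · rintro ⟨y, hy, rfl⟩
      simpa using hy
    · exact fun h => ⟨x + c, h, by simp⟩)).orderIso hA (hY.image (OrderIso.addRight (-c)).continuous)
    (OrderIso.addRight c)
  simpa [image_image] using this

theorem embOn_add (X : Set ℝ) (c : ℝ) : EmbOn (fun x => x + c) X {y | y - c ∈ X} :=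
  ⟨by fun_prop, fun x hx => by simpa using hx, (add_left_injective c).injOn,
    fun y hy => ⟨y - c, hy, by simp⟩⟩

theorem embOn_sub (X : Set ℝ) (c : ℝ) : EmbOn (fun x => c - x) X {y | c - y ∈ X} :=
  ⟨by fun_prop, fun x hx => by simpa using hx, (sub_right_injective (b := c)).injOn,
    fun y hy => ⟨c - y, hy, by simp⟩⟩

/-- Two copies of `A` start with the first window and end with the second, which is reflected in one
copy only. Monotone maps preserve the germ of the first non-flippable component, read from either
end. Comparing the copies identifies the left and the reflected right germ at the second component,
contrary to its choice. -/
theorem false_of_windows {a₁ b₁ u₁ v₁ a₂ b₂ u₂ v₂ : ℝ} (hA : IsTameInReal A)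
    (h₁ : NonFlip A a₁ b₁) (h₂ : NonFlip A a₂ b₂) (hu₁ : u₁ < a₁) (hv₁ : b₁ < v₁) (hu₂ : u₂ < a₂)
    (hv₂ : b₂ < v₂) (nu₁ : u₁ ∉ A) (nv₁ : v₁ ∉ A) (nu₂ : u₂ ∉ A) (nv₂ : v₂ ∉ A) (h : v₁ ≤ u₂)
    (w₁ : ∀ a' b', NonFlip A a' b' → u₁ < a' → a' < v₁ → a' = a₁)
    (w₂ : ∀ a' b', NonFlip A a' b' → u₂ < a' → a' < v₂ → a' = a₂) : False := by
  have cA := isCompact_of_isTameInReal hA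
  obtain ⟨R, hR⟩ := (cA.union (Set.toFinite {u₁, v₁, u₂, v₂}).isCompact).isBounded.subset_closedBall 0
  have hR' : ∀ x ∈ A ∪ {u₁, v₁, u₂, v₂}, -R ≤ x ∧ x ≤ R := fun x hx => by
    have := hR hx
    rwa [Metric.mem_closedBall, dist_zero_right, Real.norm_eq_abs, abs_le] at this
  have bA : ∀ x ∈ A, -R ≤ x ∧ x ≤ R := fun x hx => hR' x (Or.inl hx)
  have bu₁ := hR' u₁ (by simp)
  have bv₁ := hR' v₁ (by simp)
  have bu₂ := hR' u₂ (by simp)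
  have bv₂ := hR' v₂ (by simp)
  have hab₁ := h₁.1.le
  have hab₂ := h₂.1.le
  clear hR hR'
  have pP := isPiece_Ioo cA.isClosed nu₁ nv₁
  have pQ := isPiece_Ioo cA.isClosed nu₂ nv₂
  have pM := (pP.union pQ).compl
  set P := A ∩ Ioo u₁ v₁ with hP
  set Q := A ∩ Ioo u₂ v₂ with hQ
  set M := A \ (P ∪ Q) with hM
  have bP : ∀ x ∈ P, -R ≤ x ∧ x ≤ R := fun x hx => bA x hx.1
  have bQ : ∀ x ∈ Q, -R ≤ x ∧ x ≤ R := fun x hx => bA x hx.1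
  have bM : ∀ x ∈ M, -R ≤ x ∧ x ≤ R := fun x hx => bA x hx.1
  have hAe : A = P ∪ M ∪ Q := by
    ext x
    have m1 : x ∈ P → x ∈ A := fun h => h.1
    have m2 : x ∈ Q → x ∈ A := fun h => h.1
    simp only [hM, mem_union, Set.mem_sdiff]
    tauto
  -- With `A` inside `[-R, R]`, the three parts occupy `[-R, R]`, `[2R, 4R]` and `[5R, 7R]`. The
  -- endpoints of the windows are bounded as well, which forces `R > 0`.
  have copy : ∀ {Q' : Set ℝ} {g : ℝ → ℝ}, EmbOn g Q Q' → (∀ y ∈ Q', 5 * R ≤ y) →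
      ∃ f, EmbOn f A (P ∪ {y | y - 3 * R ∈ M} ∪ Q') := by
    intro Q' g hg hQ'
    obtain ⟨f, hf, -⟩ := (embOn_id P).glue_disjoint (embOn_add M (3 * R)) pP.2.1 pM.2.1
      (disjoint_left.2 fun x hx hx' => hx'.2 (Or.inl hx))
      (disjoint_left.2 fun y hy hy' => by linarith [bP y hy, (bM _ hy').1])
    obtain ⟨f', hf', -⟩ := hf.glue_disjoint hg (pP.2.1.union pM.2.1) pQ.2.1
      (disjoint_left.2 fun x hx hx' => by
        rcases hx with hx | hx
        · linarith [hx.2.2, hx'.2.1]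
        · exact hx.2 (Or.inr hx'))
      (disjoint_left.2 fun y hy hy' => by
        have := hQ' y hy'
        rcases hy with hy | hy
        · linarith [bP y hy]
        · linarith [(bM _ hy).2])
    exact ⟨f', by rw [hAe]; exact hf'⟩
  have q₁ : ∀ y ∈ {y | y - 6 * R ∈ Q}, 5 * R ≤ y := fun y hy => by linarith [bQ _ hy]
  have q₂ : ∀ y ∈ {y | 6 * R - y ∈ Q}, 5 * R ≤ y := fun y hy => by linarith [bQ _ hy]
  obtain ⟨f₁, hf₁⟩ := copy (embOn_add Q (6 * R)) q₁
  obtain ⟨f₂, hf₂⟩ := copy (embOn_sub Q (6 * R)) q₂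
  have c₁ := hf₁.isCompact cA
  have c₂ := hf₂.isCompact cA
  have first : ∀ {Q' : Set ℝ}, (∀ y ∈ Q', 5 * R ≤ y) →
      IsCompact (P ∪ {y | y - 3 * R ∈ M} ∪ Q') →
      FirstGerm A a₁ (P ∪ {y | y - 3 * R ∈ M} ∪ Q') := by
    intro Q' hQ' hc
    refine firstGerm_of_window (c := 0) cA hc h₁ hu₁ hv₁ w₁ fun x hx => ?_
    rw [add_zero]
    constructor
    · rintro ((h | h) | h)
      · exact ⟨h.1, h.2.1⟩
      · linarith [bM _ h]
      · linarith [hQ' x h]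
    · exact fun h => Or.inl (Or.inl ⟨h.1, h.2, hx⟩)
  have F₁ := first q₁ c₁
  have F₂ := first q₂ c₂
  have w₂' : ∀ a' b', NonFlip (-A) a' b' → -v₂ < a' → a' < -u₂ → a' = -b₂ := by
    intro a' b' hN h1 h2
    have hN' : NonFlip A (-b') (-a') := by simpa using hN.neg cA.neg
    have hle := hN'.1.le
    have h3 := lt_of_notMem nu₂ hN'.1.sub (by linarith)
    have e := w₂ _ _ hN' h3 (by linarith)
    have := (hN'.1.toIsComp.eq_of_mem h₂.1.toIsComp hN'.1.mem_left (e ▸ h₂.1.mem_left)).2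
    linarith
  have L₁ : FirstGerm (-A) (-b₂) (-(P ∪ {y | y - 3 * R ∈ M} ∪ {y | y - 6 * R ∈ Q})) := by
    refine firstGerm_of_window (c := -(6 * R)) cA.neg c₁.neg (h₂.neg cA) (neg_lt_neg hv₂)
      (neg_lt_neg hu₂) w₂' fun x hx => ?_
    constructor
    · rintro ((h | h) | h)
      · linarith [bP _ h]
      · linarith [bM _ h]
      · have h' : -(x + -(6 * R)) - 6 * R ∈ Q := h
        rw [show -(x + -(6 * R)) - 6 * R = -x by ring] at h'
        exact ⟨h'.1, by linarith [h'.2.2]⟩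
    · intro h
      refine Or.inr (?_ : -(x + -(6 * R)) - 6 * R ∈ Q)
      rw [show -(x + -(6 * R)) - 6 * R = -x by ring]
      exact ⟨h.1, by linarith, by linarith [h.2]⟩
  have L₂ : FirstGerm A a₂ (-(P ∪ {y | y - 3 * R ∈ M} ∪ {y | 6 * R - y ∈ Q})) := by
    refine firstGerm_of_window (c := -(6 * R)) cA c₂.neg h₂ hu₂ hv₂ w₂ fun x hx => ?_
    constructor
    · rintro ((h | h) | h)
      · linarith [bP _ h]
      · linarith [bM _ h]
      · have h' : 6 * R - -(x + -(6 * R)) ∈ Q := h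
        rw [show 6 * R - -(x + -(6 * R)) = x by ring] at h'
        exact ⟨h'.1, h'.2.1⟩
    · intro h
      refine Or.inr (?_ : 6 * R - -(x + -(6 * R)) ∈ Q)
      rw [show 6 * R - -(x + -(6 * R)) = x by ring]
      exact ⟨h.1, h.2, hx⟩
  -- An increasing match compares the right ends, which show the germs at `b₂` and `a₂`. A
  -- decreasing match compares each end with the opposite one, and the germ at `a₁` serves as the
  -- link.
  rcases exists_orderIso_of_isTameInReal hA hf₁ hf₂ with ⟨k, hk⟩ | ⟨k, hk⟩
  · have := L₁.orderIso cA.neg c₁.neg (conjNeg k)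
    rw [image_conjNeg, hk] at this
    exact h₂.2 (L₂.unique cA cA.neg c₂.neg this)
  · have h1 := F₁.orderIso cA c₁ k
    rw [hk] at h1
    have h2 := L₁.orderIso cA.neg c₁.neg (conjNeg k)
    rw [image_conjNeg, hk, neg_neg] at h2
    exact h₂.2 ((L₂.unique cA cA c₂.neg h1).trans (F₂.unique cA cA.neg c₂ h2) cA cA)

/-- A gap point between the two components trims the windows, so that they become disjoint and each
retains only its own component. -/
theorem false_of_pair {a₁ b₁ u₁ v₁ a₂ b₂ u₂ v₂ : ℝ} (hA : IsTameInReal A) (h₁ : NonFlip A a₁ b₁)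
    (h₂ : NonFlip A a₂ b₂) (h : a₁ < a₂) (hu₁ : u₁ < a₁) (hv₁ : a₁ < v₁) (hu₂ : u₂ < a₂)
    (hv₂ : a₂ < v₂) (nu₁ : u₁ ∉ A) (nv₁ : v₁ ∉ A) (nu₂ : u₂ ∉ A) (nv₂ : v₂ ∉ A)
    (w₁ : ∀ a' b', NonFlip A a' b' → u₁ < a' → a' < v₁ → a' = a₁ ∨ a' = a₂)
    (w₂ : ∀ a' b', NonFlip A a' b' → u₂ < a' → a' < v₂ → a' = a₁ ∨ a' = a₂) : False := by
  have hab₁ := h₁.1.le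
  have hlt : b₁ < a₂ := by
    by_contra! hcon
    exact h.ne (h₁.1.toIsComp.eq_of_mem h₂.1.toIsComp ⟨h.le, hcon⟩ h₂.1.mem_left).1
  obtain ⟨c, c1, c2, c3⟩ := h₂.1.lgap b₁ hlt
  have hv₁' := gt_of_notMem nv₁ h₁.1.sub hv₁
  have hv₂' := gt_of_notMem nv₂ h₂.1.sub hv₂
  refine false_of_windows hA h₁ h₂ hu₁ (lt_min hv₁' c1) (max_lt hu₂ c2) hv₂' nu₁ ?_ ?_ nv₂
    ((min_le_right v₁ c).trans (le_max_right u₂ c)) ?_ ?_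
  · rcases min_choice v₁ c with e | e <;> rwa [e]
  · rcases max_choice u₂ c with e | e <;> rwa [e]
  · intro a' b' hN h3 h4
    rw [lt_min_iff] at h4
    exact (w₁ a' b' hN h3 h4.1).resolve_right fun e => by linarith
  · intro a' b' hN h3 h4
    rw [max_lt_iff] at h3
    exact (w₂ a' b' hN h3.1 h4).resolve_left fun e => by linarith

/-- Among several non-flippable components one is isolated, and one of the others is isolated after
its removal. The second window may still contain the first component, which `false_of_pair` allows.
-/
theorem Good.good1_of_isTameInReal (h : Good B₀ A) (hA : IsTameInReal A) : Good1 B₀ A := by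
  refine { h with flip := fun a b a' b' hF hF' hn hn' => ?_ }
  by_contra hne
  let T := {p | ∃ q, NonFlip A p q}
  have hTA : T ⊆ A := fun p ⟨q, hq⟩ => hq.1.left_mem
  have hTb : ∀ x ∈ T, ¬ Base B₀ A x := fun p ⟨q, hq⟩ => h.excl p q hq.1 p hq.1.mem_left
  have eqT : ∀ x ∈ T, ∀ y ∈ T, uIcc x y ⊆ A → y = x := by
    rintro x ⟨x', hx⟩ y ⟨y', hy⟩ hxy
    have := hx.1.toIsComp.mem_of_uIcc hx.1.mem_left hxy
    exact (hy.1.toIsComp.eq_of_mem hx.1.toIsComp hy.1.mem_left this).1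
  obtain ⟨x, hx, u, v, hu, hv, nu, nv, hw⟩ := h.isolated (T := T) ⟨a, b, hF, hn⟩ hTA hTb
  have hT' : (T \ {x}).Nonempty := by
    by_cases e : a = x
    · exact ⟨a', ⟨b', hF', hn'⟩, fun h => hne (e.trans (mem_singleton_iff.1 h).symm)⟩
    · exact ⟨a, ⟨b, hF, hn⟩, e⟩
  obtain ⟨y, ⟨hy, hyx⟩, u', v', hu', hv', nu', nv', hw'⟩ := h.isolated hT'
    (sdiff_subset.trans hTA) fun z hz => hTb z hz.1
  have k : ∀ p q, NonFlip A p q → u < p → p < v → p = x := fun p q hN h1 h2 =>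
    eqT x hx p ⟨q, hN⟩ (hw p ⟨q, hN⟩ h1 h2)
  have k' : ∀ p q, NonFlip A p q → u' < p → p < v' → p = x ∨ p = y := fun p q hN h1 h2 => by
    by_cases e : p = x
    · exact Or.inl e
    · exact Or.inr (eqT y hy p ⟨q, hN⟩ (hw' p ⟨⟨q, hN⟩, e⟩ h1 h2))
  obtain ⟨x', hx'⟩ := hx
  obtain ⟨y', hy'⟩ := hy
  rcases lt_or_gt_of_ne (show y ≠ x from hyx) with hlt | hlt
  · exact false_of_pair hA hy' hx' hlt hu' hv' hu hv nu' nv' nu nv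
      (fun p q hN h1 h2 => (k' p q hN h1 h2).symm) fun p q hN h1 h2 => Or.inr (k p q hN h1 h2)
  · exact false_of_pair hA hx' hy' hlt hu hv hu' hv' nu nv nu' nv'
      (fun p q hN h1 h2 => Or.inl (k p q hN h1 h2)) k'

/-! ### Assembling the local types of all tame sets -/

theorem Base.congr (hC : IsCompact C) (h : Iso C B₀) : Base B₀ A x ↔ Base C A x :=
  ⟨fun ⟨W, h1, h2, h3⟩ => ⟨W, h1, h2, h3.trans (h.symm hC)⟩,
    fun ⟨W, h1, h2, h3⟩ => ⟨W, h1, h2, h3.trans h⟩⟩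

theorem Good.congr (hC : IsCompact C) (h : Iso C B₀) (hA : Good C A) : Good B₀ A where
  compact := hA.compact
  cover := fun x hx => (hA.cover x hx).imp_left (Base.congr hC h).2
  excl := fun a b hF x hx hb => hA.excl a b hF x hx ((Base.congr hC h).1 hb)

-- Within each of the three kinds, models are mutually homeomorphic, so one block per kind suffices
-- and `exists_locallyIn` is applied once for each.
open Cardinal in
theorem exists_locallyIn_of_isModel : ∃ S : Set (Set ℝ), #S ≤ ℵ₁ ∧ (∀ R ∈ S, IsCompact R) ∧
    ∀ A C, IsTameInReal A → IsModel C → Good C A → LocallyIn S A := by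
  have single : ∀ P : Set ℝ → Prop, (∀ C, P C → BlockModel C) → (∀ C D, P C → P D → Iso C D) →
      ∃ S : Set (Set ℝ), #S ≤ ℵ₁ ∧ (∀ R ∈ S, IsCompact R) ∧
        ∀ A C, IsTameInReal A → P C → Good C A → LocallyIn S A := by
    intro P hP hiso
    by_cases hex : ∃ C, P C
    · obtain ⟨C, hC⟩ := hex
      obtain ⟨S, h1, h2, h3⟩ := exists_locallyIn (hP C hC)
      exact ⟨S, h1, h2, fun A D hA hD hG => h3 A
        ((hG.congr (hP D hD).compact (hiso D C hD hC)).good1_of_isTameInReal hA)⟩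
    · exact ⟨∅, by simp, by simp, fun A C _ hC => (hex ⟨C, hC⟩).elim⟩
  obtain ⟨S₁, a1, b1, c1⟩ := single (fun C => C = {0}) (fun C h => IsModel.blockModel (Or.inl h))
    (by rintro C D rfl rfl; exact .refl _)
  obtain ⟨S₂, a2, b2, c2⟩ := single (fun C => C = Icc 0 1)
    (fun C h => IsModel.blockModel (Or.inr (Or.inl h))) (by rintro C D rfl rfl; exact .refl _)
  obtain ⟨S₃, a3, b3, c3⟩ := single (fun C => NoFreeEnd C ∧ ∀ a b, ¬ Fat C a b)
    (fun C h => IsModel.blockModel (Or.inr (Or.inr h)))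
    (fun C D h h' => h.1.iso_of_no_fat h'.1 h.2 h'.2)
  have hle : ∀ {s t : Set (Set ℝ)}, #s ≤ ℵ₁ → #t ≤ ℵ₁ → #(s ∪ t : Set _) ≤ ℵ₁ := fun hs ht =>
    (mk_union_le _ _).trans (add_le_of_le (aleph0_le_aleph 1) hs ht)
  refine ⟨S₁ ∪ S₂ ∪ S₃, hle (hle a1 a2) a3, ?_, ?_⟩
  · rintro R ((h | h) | h)
    exacts [b1 R h, b2 R h, b3 R h]
  · rintro A C hA (h | h | h) hG
    · exact (c1 A C hA h hG).mono fun R hR => Or.inl (Or.inl hR)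
    · exact (c2 A C hA h hG).mono fun R hR => Or.inl (Or.inr hR)
    · exact (c3 A C hA h hG).mono fun R hR => Or.inr hR

open Cardinal in
theorem exists_locallyIn_of_isTameInReal : ∃ S : Set (Set ℝ), #S ≤ ℵ₁ ∧
    (∀ R ∈ S, IsCompact R) ∧ ∀ A, IsTameInReal A → LocallyIn S A := by
  obtain ⟨S, h1, h2, h3⟩ := exists_locallyIn_of_isModel
  -- Only uniqueness matters here: if no such set exists, any compact `D` will do.
  have hD : ∃ D : Set ℝ, IsCompact D ∧ ∀ A, NoFreeEnd A → FatDense A → Iso A D := by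
    by_cases hex : ∃ D, NoFreeEnd D ∧ FatDense D
    · obtain ⟨D, n, d⟩ := hex
      exact ⟨D, n.compact, fun A nA dA => nA.iso_of_fatDense n dA d⟩
    · exact ⟨∅, isCompact_empty, fun A nA dA => (hex ⟨A, nA, dA⟩).elim⟩
  obtain ⟨D, cD, hD⟩ := hD
  have hf : #({{0}, Icc 0 1, D} : Set (Set ℝ)) ≤ ℵ₁ :=
    (Set.toFinite _).lt_aleph0.le.trans (aleph0_le_aleph 1)
  refine ⟨S ∪ {{0}, Icc 0 1, D}, (mk_union_le _ _).trans
    (add_le_of_le (aleph0_le_aleph 1) h1 hf), ?_, fun A hA => ?_⟩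
  · rintro R (h | rfl | rfl | rfl)
    exacts [h2 R h, isCompact_singleton, isCompact_Icc, cD]
  have cA := isCompact_of_isTameInReal hA
  by_cases hS : Small A
  · exact (hS.locallyIn cA).mono fun R hR => Or.inr (by
      rcases hR with rfl | rfl <;> simp)
  rcases exists_model_or_noFreeEnd hA hS with ⟨C, hC, hG⟩ | ⟨n, d⟩
  · exact (h3 A C hA hC hG).mono subset_union_left
  · exact fun x hx => ⟨D, by simp, A, D, .refl cA.isClosed, hx, .refl cD.isClosed, hD A n d⟩

end TameReal

theorem theoremt25 (F : Set (Set ℝ))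
    (hF : ∀ A ∈ F, IsTameInReal A)
    (hne : ∀ A ∈ F, ∀ B ∈ F, A ≠ B → ¬ Nonempty (↥A ≃ₜ ↥B)) :
    Cardinal.mk ↥F ≤ Cardinal.aleph 1 := by
  obtain ⟨S, h1, h2, h3⟩ := TameReal.exists_locallyIn_of_isTameInReal
  have hc : ∀ A ∈ F, IsCompact A := fun A hA => TameReal.isCompact_of_isTameInReal (hF A hA)
  exact TameReal.mk_le_of_locallyIn h1 h2 hc (fun A hA => h3 A (hF A hA))
    fun A hA B hB hAB h => hne A hA B hB hAB (h.homeomorph (hc A hA))
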